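/- Let $\mathfrak g=\mathfrak g_0\oplus\mathfrak g_1$ be a finite-dimensional basic classical simple complex Lie superalgebra: $\mathfrak g$ is simple, $\mathfrak g_0$ is a reductive subalgebra of $\mathfrak g$ (i.e. $\mathfrak g$ is completely reducible under $\operatorname{ad}\mathfrak g_0$), and $\mathfrak g$ carries a nondegenerate even supersymmetric invariant bilinear form. Fix such a form, a Cartan subalgebra $\mathfrak h$ of $\mathfrak g_0$, and denote by $(\cdot,\cdot)$ the induced form on $\mathfrak h^*$. Let $\Phi=\Phi_0\cup\Phi_1$ be the set of even and odd roots, let $\Phi^+=\Phi_0^+\cup\Phi_1^+$ be the set of positive roots for a total order on the real span of $\Phi$ that is compatible with the real vector space structure, and put $\rho=\frac12\sum_{\alpha\in\Phi_0^+}\alpha-\frac12\sum_{\alpha\in\Phi_1^+}\alpha$, where in the second sum each root is counted $\dim\mathfrak g_\alpha$ times (this dimension is $1$ unless $\mathfrak g\cong\mathfrak{psl}(2|2)$). Let $W$ be the Weyl group of $\mathfrak g_0$, generated by the reflections $s_\alpha(\nu)=\nu-\frac{2(\nu,\alpha)}{(\alpha,\alpha)}\alpha$, $\alpha\in\Phi_0$,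 and $\ell$ its length function with respect to the simple roots of $\Phi_0^+$. A weight $\lambda\in\mathfrak h^*$ is dominant integral if the irreducible $\mathfrak g$-module of highest weight $\lambda$ is finite-dimensional, and typical if $(\lambda+\rho,\alpha)\neq0$ for every $\alpha\in\Phi_1^+$ with $(\alpha,\alpha)=0$. The normalized Weyl numerator of $\lambda$ is $$U(\lambda)=\sum_{w\in W}(-1)^{\ell(w)}e^{w(\lambda+\rho)-(\lambda+\rho)}$$ in the algebra of formal exponentials. Let $\Pi_0$ be the set of simple roots of $\Phi_0^+$ and let $C_1,\dots,C_k$ be the connected components of $\Pi_0$, two distinct roots being joined when they are not orthogonal. Let $W_i\subseteq W$ be the subgroup generated by the reflections $s_\alpha$, $\alpha\in C_i$, and put $$U_i(\lambda)=\sum_{w\in W_i}(-1)^{\ell(w)}e^{w(\lambda+\rho)-(\lambda+\rho)}.$$ Theorem. Let $\lambda_1,\dots,\lambda_r,\mu_1,\dots,\mu_s$ be typical dominant integral weights with $$U(\lambda_1)\cdots U(\lambda_r)=U(\mu_1)\cdots U(\mu_s).$$ Then $r=s$, and there is a bijection $\sigma$ of $\{1,\dots,k\}\times\{1,\dots,r\}$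 such that $U_i(\lambda_p)=U_j(\mu_q)$ whenever $\sigma(i,p)=(j,q)$. The same conclusion holds if $\Pi_0$ is replaced throughout (in the definition of the components and of the factors $U_i$) by the set of even roots contained in the simple system $\Pi$ of $\Phi^+$. -/

import Mathlib

open Module

noncomputable section

/-- The sign `(-1)^{ij}` for parities `i, j`. -/
def superSign (i j : ZMod 2) : ℂ := (-1) ^ (i.val * j.val)

/-- A complex Lie superalgebra structure on the vector space `g`: a `ℤ/2`-grading `part` and a
bracket `br` of degree zero satisfying skew-supersymmetry and the super Jacobi identity. -/
structure LieSuperalgebra (g : Type*) [AddCommGroup g] [Module ℂ g] where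
  part : ZMod 2 → Submodule ℂ g
  isInternal : DirectSum.IsInternal part
  br : g →ₗ[ℂ] g →ₗ[ℂ] g
  br_mem : ∀ {i j : ZMod 2} {a b : g}, a ∈ part i → b ∈ part j → br a b ∈ part (i + j)
  skew : ∀ {i j : ZMod 2} {a b : g}, a ∈ part i → b ∈ part j →
    br a b = -(superSign i j • br b a)
  jacobi : ∀ {i j k : ZMod 2} {a b c : g}, a ∈ part i → b ∈ part j → c ∈ part k →
    br a (br b c) = br (br a b) c + superSign i j • br b (br a c)

namespace LieSuperalgebra

variable {g : Type*} [AddCommGroup g] [Module ℂ g] (L : LieSuperalgebra g)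

/-- The even part of a Lie superalgebra. -/
abbrev Even : Type _ := ↥(L.part 0)

/-- The even part is a Lie algebra under the restricted bracket. -/
instance evenLieRing : LieRing L.Even where
  bracket a b := ⟨L.br a b, by simpa using L.br_mem a.2 b.2⟩
  add_lie a b c := by ext; simp
  lie_add a b c := by ext; simp
  lie_self a := by
    ext
    have h := L.skew a.2 a.2
    simp only [superSign, ZMod.val_zero, mul_zero, pow_zero, one_smul] at h
    have h2 : (2 : ℂ) • L.br (a : g) a = 0 := by
      rw [two_smul]
      exact eq_neg_iff_add_eq_zero.mp h
    exact (smul_eq_zero.mp h2).resolve_left two_ne_zero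
  leibniz_lie a b c := by
    ext
    have h := L.jacobi a.2 b.2 c.2
    simpa [superSign] using h

instance evenLieAlgebra : LieAlgebra ℂ L.Even where
  lie_smul t a b := by
    ext
    exact (L.br a).map_smul t (b : g)

/-- `L` is simple: its bracket is not zero, and its only graded ideals are `0` and itself. -/
def IsSimple : Prop :=
  (∃ a b : g, L.br a b ≠ 0) ∧
  ∀ I : Submodule ℂ g, I = (I ⊓ L.part 0) ⊔ (I ⊓ L.part 1) →
    (∀ a : g, ∀ x ∈ I, L.br a x ∈ I) → I = ⊥ ∨ I = ⊤

/-- The even part is a reductive subalgebra: under the adjoint action of the even part, the whole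
superalgebra is completely reducible. -/
def EvenIsReductive : Prop :=
  ∀ N : Submodule ℂ g, (∀ a ∈ L.part 0, ∀ x ∈ N, L.br a x ∈ N) →
    ∃ N' : Submodule ℂ g, (∀ a ∈ L.part 0, ∀ x ∈ N', L.br a x ∈ N') ∧ IsCompl N N'

/-- `B` is a nondegenerate, even, supersymmetric, invariant bilinear form. -/
structure IsInvariantForm (B : LinearMap.BilinForm ℂ g) : Prop where
  nondegenerate : B.Nondegenerate
  even : ∀ {i j : ZMod 2} {a b : g}, a ∈ L.part i → b ∈ L.part j → i ≠ j → B a b = 0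
  supersymmetric : ∀ {i j : ZMod 2} {a b : g}, a ∈ L.part i → b ∈ L.part j →
    B a b = superSign i j * B b a
  invariant : ∀ a b c : g, B (L.br a b) c = B a (L.br b c)

/-- Basic classical simple Lie superalgebras. -/
structure IsBasicClassical : Prop where
  simple : L.IsSimple
  reductive : L.EvenIsReductive
  exists_form : ∃ B : LinearMap.BilinForm ℂ g, L.IsInvariantForm B

section Roots

variable (H : LieSubalgebra ℂ L.Even)

/-- The root space `g_α = {x : [h, x] = α(h) x for all h ∈ H}`. -/
def rootSpace (α : Dual ℂ H) : Submodule ℂ g where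
  carrier := {x | ∀ h : H, L.br ((h : L.Even) : g) x = α h • x}
  add_mem' := by
    intro x y hx hy h
    rw [map_add, hx h, hy h, smul_add]
  zero_mem' := by intro h; simp
  smul_mem' := by
    intro c x hx h
    rw [map_smul, hx h, smul_comm]

/-- The root system `Φ`. -/
def roots : Set (Dual ℂ H) := {α | α ≠ 0 ∧ L.rootSpace H α ≠ ⊥}

/-- The even roots `Φ₀`. -/
def evenRoots : Set (Dual ℂ H) := {α | α ≠ 0 ∧ L.rootSpace H α ⊓ L.part 0 ≠ ⊥}

/-- The odd roots `Φ₁`. -/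
def oddRoots : Set (Dual ℂ H) := {α | α ≠ 0 ∧ L.rootSpace H α ⊓ L.part 1 ≠ ⊥}

/-- The real span `E` of the roots. -/
def realSpan : Submodule ℝ (Dual ℂ H) := Submodule.span ℝ (L.roots H)

/-- `P` is a positive system: the set of positive roots for some total order on the real span of
the roots that is compatible with the real vector space structure. -/
def IsPositiveSystem (P : Set (Dual ℂ H)) : Prop :=
  ∃ (_ : LinearOrder (L.realSpan H)) (_ : IsOrderedAddMonoid (L.realSpan H))
    (_ : PosSMulMono ℝ (L.realSpan H)),
    P = {α | ∃ hα : α ∈ L.roots H, 0 < (⟨α, Submodule.subset_span hα⟩ : L.realSpan H)}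

variable (P : Set (Dual ℂ H))

/-- The Weyl vector: half the sum of the positive even roots minus half the sum of the positive
odd roots, where an odd root is repeated according to the dimension of its root space (this
dimension is `1` except in `psl(2|2)`). -/
def weylVector : Dual ℂ H :=
  (1 / 2 : ℂ) • (∑ᶠ α ∈ P ∩ L.evenRoots H, α) -
    (1 / 2 : ℂ) • (∑ᶠ α ∈ P ∩ L.oddRoots H,
      finrank ℂ ↥(L.rootSpace H α ⊓ L.part 1) • α)

variable {H} in
/-- The elements of a set of roots that are not sums of two elements of the set. Applied to a
positive system this gives its simple roots; applied to the positive even roots it gives the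
base of the even root system. -/
def indecomposables (Q : Set (Dual ℂ H)) : Set (Dual ℂ H) :=
  {α | α ∈ Q ∧ ¬ ∃ β ∈ Q, ∃ γ ∈ Q, α = β + γ}

/-- The base of the positive even roots. -/
def evenBase : Set (Dual ℂ H) := L.indecomposables (P ∩ L.evenRoots H)

/-- The even roots among the simple roots of the positive system `P`. -/
def evenSimpleRoots : Set (Dual ℂ H) := L.indecomposables P ∩ L.evenRoots H

variable (B : LinearMap.BilinForm ℂ g)

/-- The vector `h_α ∈ H` with `B(h_α, h) = α(h)` for all `h ∈ H`. -/
def dualVector (α : Dual ℂ H) : H :=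
  Classical.epsilon fun t : H => ∀ h : H, B ((t : L.Even) : g) ((h : L.Even) : g) = α h

/-- The bilinear form `(α, β) = B(h_α, h_β)` on the dual of the Cartan subalgebra. -/
def pairing (α β : Dual ℂ H) : ℂ :=
  B ((L.dualVector H B α : L.Even) : g) ((L.dualVector H B β : L.Even) : g)

/-- `w` is the reflection `s_α : ν ↦ ν - (2 (ν, α) / (α, α)) α`. -/
def IsReflection (α : Dual ℂ H) (w : Dual ℂ H ≃ₗ[ℂ] Dual ℂ H) : Prop :=
  ∀ ν : Dual ℂ H, w ν = ν - (2 * L.pairing H B ν α / L.pairing H B α α) • α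

/-- The group generated by the reflections in the elements of `S`. -/
def reflectionGroup (S : Set (Dual ℂ H)) : Subgroup (Dual ℂ H ≃ₗ[ℂ] Dual ℂ H) :=
  Subgroup.closure {w | ∃ α ∈ S, L.IsReflection H B α w}

/-- The Weyl group of `L`, that is, of its even part. -/
def weylGroup : Subgroup (Dual ℂ H ≃ₗ[ℂ] Dual ℂ H) :=
  L.reflectionGroup H B (L.evenRoots H)

/-- The length of an element of the Weyl group: the least number of factors in an expression as
a product of reflections in elements of the base of the positive even roots. -/
def length (w : Dual ℂ H ≃ₗ[ℂ] Dual ℂ H) : ℕ :=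
  sInf {k | ∃ l : List (Dual ℂ H ≃ₗ[ℂ] Dual ℂ H), l.length = k ∧
    (∀ s ∈ l, ∃ α ∈ L.evenBase H P, L.IsReflection H B α s) ∧ l.prod = w}

/-- `∑_{w ∈ G} (-1)^{ℓ(w)} e^{w(λ+ρ) - (λ+ρ)}` in the group algebra of the additive group of
weights, where `e^ν` is the basis element of `ν`. -/
def alternatingSum (G : Subgroup (Dual ℂ H ≃ₗ[ℂ] Dual ℂ H)) (wt : Dual ℂ H) :
    AddMonoidAlgebra ℂ (Dual ℂ H) :=
  ∑ᶠ w ∈ G, AddMonoidAlgebra.single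
    (w (wt + L.weylVector H P) - (wt + L.weylVector H P)) ((-1 : ℂ) ^ L.length H P B w)

/-- The normalized Weyl numerator `U(λ)`. -/
def numerator (wt : Dual ℂ H) : AddMonoidAlgebra ℂ (Dual ℂ H) :=
  L.alternatingSum H P B (L.weylGroup H B) wt

/-- The graph on a set `S` of roots: distinct roots are joined when they are not orthogonal. -/
def rootGraph (S : Set (Dual ℂ H)) : SimpleGraph S :=
  SimpleGraph.fromRel fun α β => L.pairing H B α β ≠ 0

/-- The factor `U_C(λ)` attached to a connected component `C` of a set `S` of roots: the
alternating sum over the group generated by the reflections in the roots of `C`. -/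
def componentFactor (S : Set (Dual ℂ H)) (C : (L.rootGraph H B S).ConnectedComponent)
    (wt : Dual ℂ H) : AddMonoidAlgebra ℂ (Dual ℂ H) :=
  L.alternatingSum H P B (L.reflectionGroup H B (Subtype.val '' C.supp)) wt

/-- A weight `λ` is typical if `(λ + ρ, α) ≠ 0` for all positive isotropic odd roots `α`. -/
def IsTypical (wt : Dual ℂ H) : Prop :=
  ∀ α ∈ P ∩ L.oddRoots H, L.pairing H B α α = 0 →
    L.pairing H B (wt + L.weylVector H P) α ≠ 0

end Roots

/-- A module over the Lie superalgebra `L` on the vector space `V`. -/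
structure SuperModule (V : Type*) [AddCommGroup V] [Module ℂ V] where
  part : ZMod 2 → Submodule ℂ V
  isInternal : DirectSum.IsInternal part
  act : g →ₗ[ℂ] V →ₗ[ℂ] V
  act_mem : ∀ {i j : ZMod 2} {a : g} {v : V}, a ∈ L.part i → v ∈ part j → act a v ∈ part (i + j)
  act_br : ∀ {i j : ZMod 2} {a b : g} (v : V), a ∈ L.part i → b ∈ L.part j →
    act (L.br a b) v = act a (act b v) - superSign i j • act b (act a v)

variable {L} in
/-- A module is irreducible if it is nonzero and has no proper nonzero graded submodule. -/
def SuperModule.IsIrreducible {V : Type*} [AddCommGroup V] [Module ℂ V]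
    (M : L.SuperModule V) : Prop :=
  Nontrivial V ∧
  ∀ N : Submodule ℂ V, N = (N ⊓ M.part 0) ⊔ (N ⊓ M.part 1) →
    (∀ a : g, ∀ v ∈ N, M.act a v ∈ N) → N = ⊥ ∨ N = ⊤

/-- A weight `λ` is dominant integral if the irreducible module of highest weight `λ` is finite
dimensional, i.e. if there is a finite-dimensional irreducible module with a nonzero vector of
weight `λ` that is killed by all positive root spaces. -/
def IsDominantIntegral (H : LieSubalgebra ℂ L.Even) (P : Set (Dual ℂ H)) (wt : Dual ℂ H) : Prop :=
  ∃ (V : Type) (_ : AddCommGroup V) (_ : Module ℂ V) (_ : FiniteDimensional ℂ V)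
    (M : L.SuperModule V), M.IsIrreducible ∧
    ∃ v : V, v ≠ 0 ∧ (∀ h : H, M.act ((h : L.Even) : g) v = wt h • v) ∧
      ∀ α ∈ P, ∀ x ∈ L.rootSpace H α, M.act x v = 0

end LieSuperalgebra

end

noncomputable section
set_option linter.unusedSectionVars false

/-! Put $\Lambda=\lambda+\rho$ and let $\alpha_i$ run over the base of $\Phi_0^+$. Everything is
governed by the numbers $m_i=2\langle\Lambda,\alpha_i^\vee\rangle$, which are positive integers when
$\lambda$ is typical and dominant integral (`SuperModule.IsHighestWeight.isHalfRegular`). The factor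
2 is there because $\alpha_i/2$ may be an odd root. To see integrality, change the odd positive
roots until $\alpha_i$ or $\alpha_i/2$ is simple: typicality keeps $\Lambda$ unchanged on the way
(`IsWall.exists_isHighestWeight`), the new highest weight takes a natural value on $\alpha_i^\vee$,
and the new $2\rho$ takes the value 2 or 1.

Every $w\Lambda$ has the form $\Lambda-\frac12\sum n_i\alpha_i$ with each $n_i$ either $0$ or at
least $m_i$; if moreover $n_i\le m_i$ for all $i$, the support of $n$ consists of pairwise
orthogonal roots (`IsExponent.reflection_mul`). So $U(\lambda)$ is a polynomial in
$X_i=e^{-\alpha_i/2}$ which up to the exponent $m$ agrees with the signed independence polynomial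
$\sum_t(-1)^{|t|}\prod_{i\in t}X_i^{m_i}$ of the graph of nonorthogonal simple roots.

Now fix a connected set $C$ of simple roots and put the other variables equal to zero. The result
depends only on $m|_C$, and a product of such series determines the multiset of its $m|_C$
(`MvPowerSeries.multiset_eq_of_prod_eq`). Indeed, in the logarithmic derivative $X_v\partial_v\log$
of the series of $m$ the coefficient of $\prod_{i\in C}X_i^{m_i}$ is nonzero, because quotients of
independence polynomials have nonnegative coefficients and $C$ is connected
(`coeff_indepRatio_pos`). The series of another $m'$ contributes to this coefficient only if $m'\le
m$. For a minimal $m$ the coefficient therefore counts the occurrences of $m$ on either side; cancel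
one factor and repeat.

Each component thus has its own bijection of the weights that preserves $m|_C$, and $U_C$ depends on
$m|_C$ only. The argument needs no more than a connected subset of the base, so it covers both
choices of the set of simple roots. The root system of $\mathfrak g_0$ is obtained from simplicity,
reductivity and the form by trace arguments and $\mathfrak{sl}_2$-theory. -/

lemma zmod_two_eq_zero_or_one (i : ZMod 2) : i = 0 ∨ i = 1 := by revert i; decide

namespace LieSuperalgebra

variable {g : Type*} [AddCommGroup g] [Module ℂ g] (L : LieSuperalgebra g)

/-! ### Sign rules, the even part, and the use of simplicity and reductivity -/

section Grading

lemma part_sup_part : L.part 0 ⊔ L.part 1 = ⊤ := by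
  have h := L.isInternal.submodule_iSup_eq_top
  rw [← h]
  refine le_antisymm (sup_le (le_iSup _ 0) (le_iSup _ 1)) (iSup_le fun i => ?_)
  fin_cases i
  · exact le_sup_left
  · exact le_sup_right

lemma part_disjoint : Disjoint (L.part 0) (L.part 1) :=
  L.isInternal.submodule_iSupIndep.pairwiseDisjoint (by decide)

lemma exists_even_add_odd (x : g) : ∃ a ∈ L.part 0, ∃ b ∈ L.part 1, a + b = x :=
  Submodule.mem_sup.mp (L.part_sup_part ▸ Submodule.mem_top)

lemma homogeneous_induction {p : g → Prop} (h : ∀ i, ∀ x ∈ L.part i, p x)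
    (hadd : ∀ x y, p x → p y → p (x + y)) (x : g) : p x := by
  obtain ⟨a, ha, b, hb, rfl⟩ := L.exists_even_add_odd x
  exact hadd _ _ (h _ _ ha) (h _ _ hb)

lemma superSign_zero_left (i : ZMod 2) : superSign 0 i = 1 := by simp [superSign]

lemma superSign_one_one : superSign 1 1 = -1 := by
  simp [superSign, ZMod.val_one]

variable {L}

lemma jacobi_even {a b : g} (ha : a ∈ L.part 0) {i : ZMod 2} (hb : b ∈ L.part i) (c : g) :
    L.br a (L.br b c) = L.br (L.br a b) c + L.br b (L.br a c) := by
  induction c using L.homogeneous_induction with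
  | h k c hc => simpa [superSign_zero_left] using L.jacobi ha hb hc
  | hadd x y hx hy => rw [map_add, map_add, hx, hy, map_add, map_add, map_add]; abel

lemma jacobi_odd {a b : g} (ha : a ∈ L.part 1) (hb : b ∈ L.part 1) (c : g) :
    L.br a (L.br b c) = L.br (L.br a b) c - L.br b (L.br a c) := by
  induction c using L.homogeneous_induction with
  | h k c hc =>
    have := L.jacobi ha hb hc
    rw [superSign_one_one] at this
    rw [this]; simp [sub_eq_add_neg]
  | hadd x y hx hy => rw [map_add, map_add, hx, hy, map_add, map_add, map_add]; abel

lemma br_skew_even {a : g} (ha : a ∈ L.part 0) (b : g) : L.br a b = -L.br b a := by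
  induction b using L.homogeneous_induction with
  | h k c hc => simpa [superSign_zero_left] using L.skew ha hc
  | hadd x y hx hy => simp only [map_add, LinearMap.add_apply, hx, hy]; abel

lemma br_comm_odd {a b : g} (ha : a ∈ L.part 1) (hb : b ∈ L.part 1) : L.br a b = L.br b a := by
  have := L.skew ha hb
  simpa [superSign_one_one] using this

variable (L)

instance evenLieRingModule : LieRingModule L.Even g where
  bracket a x := L.br a x
  add_lie a b x := by simp
  lie_add a x y := by simp
  leibniz_lie a b x := jacobi_even a.2 b.2 x

instance evenLieModule : LieModule ℂ L.Even g where
  smul_lie t a x := by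
    change L.br ((t • a : L.Even) : g) x = t • L.br a x
    simp
  lie_smul t a x := (L.br a).map_smul t x

lemma even_lie_def (a : L.Even) (x : g) : ⁅a, x⁆ = L.br a x := rfl

lemma coe_even_lie (a b : L.Even) : ((⁅a, b⁆ : L.Even) : g) = L.br a b := rfl

variable {L}

/-- The line spanned by a homogeneous central element is a graded ideal. If it were everything, the
bracket would vanish. -/
lemma IsSimple.eq_zero_of_central (hs : L.IsSimple) {i : ZMod 2} {z : g} (hz : z ∈ L.part i)
    (h : ∀ x, L.br z x = 0) : z = 0 := by
  obtain ⟨⟨a, b, hab⟩, hI⟩ := hs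
  have hle : Submodule.span ℂ {z} ≤ L.part i := by simpa using hz
  have h' : ∀ a, L.br a z = 0 := fun a => by
    induction a using L.homogeneous_induction with
    | h k c hc => rw [L.skew hc hz, h, smul_zero, neg_zero]
    | hadd x y hx hy => rw [map_add, LinearMap.add_apply, hx, hy, add_zero]
  rcases hI (Submodule.span ℂ {z}) (by
      refine le_antisymm ?_ (sup_le inf_le_left inf_le_left)
      rcases zmod_two_eq_zero_or_one i with rfl | rfl
      · exact le_sup_of_le_left (le_inf le_rfl hle)
      · exact le_sup_of_le_right (le_inf le_rfl hle)) (by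
      intro a x hx
      obtain ⟨c, rfl⟩ := Submodule.mem_span_singleton.mp hx
      rw [map_smul, h', smul_zero]
      exact zero_mem _) with h0 | h1
  · simpa using h0
  · exfalso
    apply hab
    have hb : b ∈ Submodule.span ℂ {z} := h1 ▸ Submodule.mem_top
    obtain ⟨c, rfl⟩ := Submodule.mem_span_singleton.mp hb
    rw [map_smul, h', smul_zero]

/-- A complement of `D` stable under the even part would, if nonzero, share a nonzero vector with
`D`. This is how reductivity enters: it shows that sums of weight spaces, for the radical and for
`H`, exhaust the superalgebra. -/
lemma EvenIsReductive.eq_top (hr : L.EvenIsReductive) (D : LieSubmodule ℂ L.Even g)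
    (h : ∀ N : LieSubmodule ℂ L.Even g, N ≠ ⊥ → ∃ x ∈ N, x ≠ 0 ∧ x ∈ D) : D = ⊤ := by
  obtain ⟨N', hN', hc⟩ := hr D.toSubmodule (fun a ha x hx => D.lie_mem (x := ⟨a, ha⟩) hx)
  let N : LieSubmodule ℂ L.Even g := { N' with lie_mem := fun {a x} hx => hN' a a.2 x hx }
  by_cases hN : N = ⊥
  · have h0 : N' = ⊥ := by
      have : N.toSubmodule = ⊥ := by rw [hN]; simp
      exact this
    subst h0
    have := hc.sup_eq_top
    rw [sup_bot_eq] at this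
    rwa [← LieSubmodule.toSubmodule_eq_top]
  · obtain ⟨x, hx, hx0, hxD⟩ := h N hN
    exact absurd (Submodule.disjoint_def.mp hc.disjoint x hxD hx) hx0

end Grading

/-! ### The Cartan subalgebra: weights separate its points -/

section Cartan

variable [FiniteDimensional ℂ g] {L} {H : LieSubalgebra ℂ L.Even} [H.IsCartanSubalgebra]

lemma exists_weight_vector (N : LieSubmodule ℂ L.Even g) (hN : N ≠ ⊥) :
    ∃ (ψ : Dual ℂ H) (x : g), x ∈ N ∧ x ≠ 0 ∧ x ∈ L.rootSpace H ψ := by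
  have : Nontrivial N := (LieSubmodule.nontrivial_iff_ne_bot ℂ L.Even g).mpr hN
  obtain ⟨ψ, hψ⟩ := LieModule.exists_nontrivial_weightSpace_of_isNilpotent ℂ H N
  obtain ⟨⟨v, hv⟩, hv0⟩ := exists_ne (0 : LieModule.weightSpace N ψ)
  rw [LieModule.mem_weightSpace] at hv
  refine ⟨ψ, v, v.2, by simpa using hv0, fun h => ?_⟩
  exact congrArg Subtype.val (hv h)

/-- All roots vanish on `x`, so `x` is Killing-orthogonal to the even part and lies in its radical
$R$. By Lie's theorem and reductivity, the superalgebra is the sum of its $R$-weight spaces, which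
are stable under the even part. Each nonzero one contains a weight vector for `H`, on which `x` acts
by zero; hence `x` acts by zero on all of it. So `x` is central. -/
lemma eq_zero_of_forall_weight (hs : L.IsSimple) (hr : L.EvenIsReductive) (x : H)
    (hx : ∀ ψ : Dual ℂ H, L.rootSpace H ψ ≠ ⊥ → ψ x = 0) : x = 0 := by
  have hW : ∀ χ : LieModule.Weight ℂ H L.Even, χ x = 0 := fun χ => by
    obtain ⟨m, hm0, hm⟩ := LieModule.exists_forall_lie_eq_smul ℂ H L.Even χ
    refine hx χ.toLinear (fun h0 => hm0 ?_)
    have : (m : g) ∈ L.rootSpace H χ.toLinear := fun h => congrArg Subtype.val (hm h)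
    rw [h0] at this
    simpa using this
  have hrad : (x : L.Even) ∈ LieAlgebra.radical ℂ L.Even := by
    apply LieAlgebra.killingCompl_top_le_radical
    rw [LieIdeal.mem_killingCompl]
    intro y _
    have hy : y ∈ ⨆ β : H → ℂ, LieAlgebra.rootSpace H β := by
      simp [LieModule.iSup_genWeightSpace_eq_top ℂ H L.Even]
    have hx0 : (x : L.Even) ∈ LieAlgebra.rootSpace H (0 : H → ℂ) := by
      rw [LieAlgebra.rootSpace_zero_eq]; exact x.2
    induction hy using LieSubmodule.iSup_induction' with
    | mem β y hy =>
      by_cases hβ : β = 0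
      · subst hβ
        rw [LieAlgebra.rootSpace_zero_eq] at hy
        change LieModule.traceForm ℂ H L.Even ⟨y, hy⟩ x = 0
        rw [LieModule.traceForm_eq_sum_finrank_nsmul_mul]
        exact Finset.sum_eq_zero fun χ _ => by rw [hW χ, mul_zero, smul_zero]
      · exact LieAlgebra.killingForm_apply_eq_zero_of_mem_rootSpace_of_add_ne_zero ℂ L.Even H
          hy hx0 (by simpa using hβ)
    | zero => simp
    | add a b _ _ ha hb => rw [map_add, LinearMap.add_apply, ha trivial, hb trivial, add_zero]
  let R := LieAlgebra.radical ℂ L.Even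
  let D : LieSubmodule ℂ L.Even g :=
    ⨆ χ : Dual ℂ R, LieModule.weightSpaceOfIsLieTower ℂ g (L := L.Even) (A := R) χ
  have hD : D = ⊤ := by
    refine hr.eq_top D fun N hN => ?_
    have : Nontrivial N := (LieSubmodule.nontrivial_iff_ne_bot ℂ L.Even g).mpr hN
    obtain ⟨ψ, hψ⟩ := LieModule.exists_nontrivial_weightSpace_of_isSolvable ℂ R N
    obtain ⟨⟨v, hv⟩, hv0⟩ := exists_ne (0 : LieModule.weightSpace N ψ)
    rw [LieModule.mem_weightSpace] at hv
    refine ⟨v, v.2, by simpa using hv0, ?_⟩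
    refine LieSubmodule.mem_iSup_of_mem ψ ?_
    change (v : g) ∈ LieModule.weightSpace g ψ
    rw [LieModule.mem_weightSpace]
    exact fun h => congrArg Subtype.val (hv h)
  have hact : ∀ m : g, ⁅(x : L.Even), m⁆ = 0 := by
    intro m
    have hm : m ∈ D := hD ▸ LieSubmodule.mem_top m
    induction hm using LieSubmodule.iSup_induction' with
    | mem χ m hm =>
      by_cases hbot : LieModule.weightSpaceOfIsLieTower ℂ g (L := L.Even) (A := R) χ = ⊥
      · rw [hbot, LieSubmodule.mem_bot] at hm
        simp [hm]
      · obtain ⟨ψ, v, hv, hv0, hvψ⟩ := exists_weight_vector (H := H) _ hbot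
        have h1 := (LieModule.mem_weightSpace χ v).mp hv ⟨x, hrad⟩
        have h2 := hvψ x
        rw [hx ψ (fun h => hv0 (by rw [h] at hvψ; simpa using hvψ)), zero_smul] at h2
        have h3 : χ ⟨x, hrad⟩ = 0 := by
          have h1' : L.br ((x : L.Even) : g) v = χ ⟨x, hrad⟩ • v := h1
          rw [h2] at h1'
          exact (smul_eq_zero.mp h1'.symm).resolve_right hv0
        have h4 := (LieModule.mem_weightSpace χ m).mp hm ⟨x, hrad⟩
        rw [h3, zero_smul] at h4
        exact h4
    | zero => simp
    | add a b _ _ ha hb => rw [lie_add, ha, hb, add_zero]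
  have := hs.eq_zero_of_central (x : L.Even).2 hact
  exact Subtype.ext (Subtype.ext this)

/-- A commutator of operators that act by scalars on a vector kills it, so every weight vanishes on
$[a,b]$. -/
lemma cartan_isLieAbelian (hs : L.IsSimple) (hr : L.EvenIsReductive) : IsLieAbelian H where
  trivial a b := by
    refine eq_zero_of_forall_weight hs hr _ fun ψ hψ => ?_
    obtain ⟨v, hv, hv0⟩ := Submodule.exists_mem_ne_zero_of_ne_bot hψ
    have h1 := hv ⁅a, b⁆
    have h2 : L.br (((⁅a, b⁆ : H) : L.Even) : g) v = 0 := by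
      change ⁅⁅(a : L.Even), (b : L.Even)⁆, v⁆ = 0
      rw [lie_lie]
      simp only [even_lie_def]
      rw [hv b, hv a, map_smul, map_smul, hv a, hv b, smul_comm, sub_self]
    rw [h2] at h1
    exact (smul_eq_zero.mp h1.symm).resolve_right hv0

end Cartan

end LieSuperalgebra

/-- The trace of an endomorphism on a direct sum of subspaces on which it has a single
generalized eigenvalue. -/
lemma trace_restrict_biSup_of_sub_nilpotent {V ι : Type*} [AddCommGroup V] [Module ℂ V]
    [FiniteDimensional ℂ V] [DecidableEq ι] {N : ι → Submodule ℂ V} (s : Finset ι)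
    (hind : iSupIndep N) (T : End ℂ V) (c : ι → ℂ)
    (hT : ∀ i, ∀ x ∈ N i, T x ∈ N i) (hnil : ∀ i, ∃ k, ∀ x ∈ N i, ((T - c i • 1 : End ℂ V) ^ k) x = 0)
    (Y : Submodule ℂ V) (hY : Y = ⨆ i ∈ s, N i) (hTY : ∀ x ∈ Y, T x ∈ Y) :
    LinearMap.trace ℂ Y (T.restrict hTY) = ∑ i ∈ s, (finrank ℂ (N i) : ℂ) * c i := by
  rw [LinearMap.trace_eq_sum_trace_restrict_of_eq_biSup s
    (hind.comp Subtype.val_injective) hT Y hY hTY]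
  refine Finset.sum_congr rfl fun i _ => ?_
  obtain ⟨k, hk⟩ := hnil i
  have h1 : IsNilpotent (T.restrict (hT i) - c i • (1 : End ℂ (N i))) := by
    refine ⟨k, ?_⟩
    ext x
    have : ∀ n, (((T.restrict (hT i) - c i • (1 : End ℂ (N i))) ^ n) x : V) =
        ((T - c i • 1 : End ℂ V) ^ n) (x : V) := fun n => by
      induction n with
      | zero => simp
      | succ n ih =>
        rw [pow_succ', pow_succ', Module.End.mul_apply, Module.End.mul_apply, ← ih]
        simp
    rw [this, hk x x.2]
    simp
  have h2 := (LinearMap.isNilpotent_trace_of_isNilpotent h1).eq_zero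
  rw [map_sub, map_smul, LinearMap.trace_one, sub_eq_zero] at h2
  rw [h2, smul_eq_mul, mul_comm]

lemma trace_mul_sub_mul {V : Type*} [AddCommGroup V] [Module ℂ V] (S T : End ℂ V) :
    LinearMap.trace ℂ V (S * T - T * S) = 0 := by
  rw [map_sub, LinearMap.trace_mul_comm, sub_self]

namespace LieSuperalgebra

variable {g : Type*} [AddCommGroup g] [Module ℂ g] {L : LieSuperalgebra g}

/-! ### The invariant form and the generalized root spaces of the even part -/

section Form

variable {B : LinearMap.BilinForm ℂ g} (hB : L.IsInvariantForm B)
include hB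

lemma IsInvariantForm.skew_even {h : g} (hh : h ∈ L.part 0) (x y : g) :
    B (L.br h x) y = -B x (L.br h y) := by
  rw [br_skew_even hh, map_neg, LinearMap.neg_apply, hB.invariant]

lemma IsInvariantForm.eq_zero {i : ZMod 2} {x : g} (hx : x ∈ L.part i)
    (h : ∀ y ∈ L.part i, B x y = 0) : x = 0 := by
  refine hB.nondegenerate.1 x fun y => ?_
  induction y using L.homogeneous_induction with
  | h k y hy =>
    by_cases hk : i = k
    · subst hk; exact h y hy
    · exact hB.even hx hy hk
  | hadd a b ha hb => rw [map_add, ha, hb, add_zero]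

lemma IsInvariantForm.comm_even {x y : g} (hx : x ∈ L.part 0) (hy : y ∈ L.part 0) :
    B x y = B y x := by
  simpa [superSign_zero_left] using hB.supersymmetric hx hy

/-- Generalized eigenvectors of `ad h` are orthogonal unless the eigenvalues are opposite. -/
lemma IsInvariantForm.eq_zero_of_pow_eq_zero {h : g} (hh : h ∈ L.part 0) {a b : ℂ}
    (hab : a + b ≠ 0) (n : ℕ) : ∀ (k l : ℕ), k + l = n → ∀ x y : g,
    ((L.br h - a • 1 : End ℂ g) ^ k) x = 0 → ((L.br h - b • 1 : End ℂ g) ^ l) y = 0 →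
    B x y = 0 := by
  induction n with
  | zero =>
    intro k l hkl x y hx _
    obtain ⟨rfl, rfl⟩ : k = 0 ∧ l = 0 := by omega
    have : x = 0 := by simpa using hx
    simp [this]
  | succ n ih =>
    intro k l hkl x y hx hy
    rcases k with _ | k
    · have : x = 0 := by simpa using hx
      simp [this]
    rcases l with _ | l
    · have : y = 0 := by simpa using hy
      simp [this]
    rw [pow_succ, Module.End.mul_apply] at hx hy
    -- Lowering either exponent shows that $B((h-a)x,y)$ and $B(x,(h-b)y)$ vanish; by invariance
    -- they add up to $-(a+b)B(x,y)$.
    have h1 := ih k (l + 1) (by omega) _ y hx (by rw [pow_succ, Module.End.mul_apply]; exact hy)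
    have h2 := ih (k + 1) l (by omega) x _ (by rw [pow_succ, Module.End.mul_apply]; exact hx) hy
    have h3 := hB.skew_even hh x y
    simp only [LinearMap.sub_apply, LinearMap.smul_apply, Module.End.one_apply, map_sub, map_smul,
      smul_eq_mul] at h1 h2
    have : (a + b) * B x y = 0 := by linear_combination -h1 - h2 + h3
    exact (mul_eq_zero.mp this).resolve_left hab

end Form

section Cartan

variable [FiniteDimensional ℂ g] {H : LieSubalgebra ℂ L.Even} [H.IsCartanSubalgebra]
variable {B : LinearMap.BilinForm ℂ g}

lemma coe_pow_toEnd (h : H) (a : ℂ) (k : ℕ) (x : L.Even) :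
    ((((LieModule.toEnd ℂ H L.Even h - a • 1) ^ k) x : L.Even) : g) =
      ((L.br ((h : L.Even) : g) - a • 1 : End ℂ g) ^ k) (x : g) := by
  induction k with
  | zero => simp
  | succ k ih =>
    rw [pow_succ', pow_succ', Module.End.mul_apply, Module.End.mul_apply, ← ih]
    simp only [LinearMap.sub_apply, LieModule.toEnd_apply_apply, LinearMap.smul_apply,
      Module.End.one_apply, Submodule.coe_sub, Submodule.coe_smul]
    rfl

lemma IsInvariantForm.eq_zero_of_genRootSpace (hB : L.IsInvariantForm B) {α β : H → ℂ}
    (hαβ : α + β ≠ 0) {x y : L.Even} (hx : x ∈ LieAlgebra.rootSpace H α)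
    (hy : y ∈ LieAlgebra.rootSpace H β) : B x y = 0 := by
  obtain ⟨h, hh⟩ := Function.ne_iff.mp hαβ
  obtain ⟨k, hk⟩ := (LieModule.mem_genWeightSpace L.Even α x).mp hx h
  obtain ⟨l, hl⟩ := (LieModule.mem_genWeightSpace L.Even β y).mp hy h
  refine hB.eq_zero_of_pow_eq_zero (h : L.Even).2 hh _ k l rfl x y ?_ ?_
  · rw [← coe_pow_toEnd, hk]; rfl
  · rw [← coe_pow_toEnd, hl]; rfl

lemma mem_genRootSpace_zero {x : L.Even} :
    x ∈ LieAlgebra.rootSpace H (0 : H → ℂ) ↔ x ∈ H := by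
  rw [LieAlgebra.rootSpace_zero_eq]; exact Iff.rfl

lemma IsInvariantForm.exists_genRootSpace_neg (hB : L.IsInvariantForm B) {α : H → ℂ}
    {x : L.Even} (hx : x ∈ LieAlgebra.rootSpace H α) (hx0 : x ≠ 0) :
    ∃ y ∈ LieAlgebra.rootSpace H (-α), B x y = 1 := by
  by_contra! hcon
  have hall : ∀ y ∈ LieAlgebra.rootSpace H (-α), B x y = 0 := fun y hy => by
    by_contra h0
    refine hcon ((B x y)⁻¹ • y) (Submodule.smul_mem _ _ hy) ?_
    simp [h0]
  apply hx0
  have : (x : g) = 0 := by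
    refine hB.eq_zero x.2 fun y hy => ?_
    have hy' : (⟨y, hy⟩ : L.Even) ∈ ⨆ β : H → ℂ, LieAlgebra.rootSpace H β := by
      simp [LieModule.iSup_genWeightSpace_eq_top ℂ H L.Even]
    suffices ∀ z : L.Even, z ∈ ⨆ β : H → ℂ, LieAlgebra.rootSpace H β → B x z = 0 from
      this ⟨y, hy⟩ hy'
    intro z hz
    induction hz using LieSubmodule.iSup_induction' with
    | mem β z hz =>
      by_cases hβ : β = -α
      · subst hβ; exact hall z hz
      · refine hB.eq_zero_of_genRootSpace (fun h => hβ ?_) hx hz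
        exact (neg_eq_of_add_eq_zero_right h).symm
    | zero => simp
    | add a b _ _ ha hb => rw [Submodule.coe_add, map_add, ha, hb, add_zero]
  exact Subtype.ext this

lemma IsInvariantForm.cartan_eq_zero (hB : L.IsInvariantForm B) {t : H}
    (h : ∀ u : H, B ((t : L.Even) : g) ((u : L.Even) : g) = 0) : t = 0 := by
  by_contra h0
  have ht : (t : L.Even) ∈ LieAlgebra.rootSpace H (0 : H → ℂ) := mem_genRootSpace_zero.mpr t.2
  obtain ⟨y, hy, hy1⟩ := hB.exists_genRootSpace_neg ht (fun h' => h0 (Subtype.ext h'))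
  rw [neg_zero, mem_genRootSpace_zero] at hy
  exact zero_ne_one ((h ⟨y, hy⟩).symm.trans hy1)

/-- Structure of the generalized root spaces of the even part. -/
lemma finrank_genRootSpace (hs : L.IsSimple) (hr : L.EvenIsReductive) (hB : L.IsInvariantForm B)
    {χ : Dual ℂ H} (hχ : χ ≠ 0) {e : L.Even} (he0 : e ≠ 0)
    (he : (e : g) ∈ L.rootSpace H χ) :
    finrank ℂ (LieAlgebra.rootSpace H (-(χ : H → ℂ))) = 1 ∧
    (∀ n : ℕ, 2 ≤ n → LieAlgebra.rootSpace H (-(n • (χ : H → ℂ))) = ⊥) ∧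
    ∃ f ∈ LieAlgebra.rootSpace H (-(χ : H → ℂ)), ∃ t : H, ⁅e, f⁆ = t ∧ χ t ≠ 0 ∧
      ∀ h : H, B ((t : L.Even) : g) ((h : L.Even) : g) = χ h := by
  have hab := cartan_isLieAbelian (H := H) hs hr
  have he' : ∀ h : H, ⁅(h : L.Even), e⁆ = χ h • e := fun h => Subtype.ext (he h)
  have heχ : e ∈ LieAlgebra.rootSpace H (χ : H → ℂ) := by
    refine LieModule.weightSpace_le_genWeightSpace L.Even (χ : H → ℂ) ?_
    rw [LieModule.mem_weightSpace]
    exact he'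
  obtain ⟨f, hf, hBf⟩ := hB.exists_genRootSpace_neg heχ he0
  have htH : ⁅e, f⁆ ∈ H := by
    rw [← mem_genRootSpace_zero]
    have := LieAlgebra.lie_mem_genWeightSpace_of_mem_genWeightSpace heχ hf
    rwa [add_neg_cancel] at this
  let t : H := ⟨⁅e, f⁆, htH⟩
  have htB : ∀ h : H, B ((t : L.Even) : g) ((h : L.Even) : g) = χ h := fun h => by
    rw [hB.comm_even (t : L.Even).2 (h : L.Even).2]
    change B ((h : L.Even) : g) (L.br (e : g) (f : g)) = _
    rw [← hB.invariant, he h, map_smul, LinearMap.smul_apply, hBf, smul_eq_mul, mul_one]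
  have hχ' : (χ : H → ℂ) ≠ 0 := fun h => hχ (LinearMap.ext fun x => congrFun h x)
  -- A root string argument gives $b\,\psi(t)=-a\,\chi(t)$ with $b\neq0$ for every weight $\psi$. If
  -- $\chi(t)=0$, all weights vanish on $t$, hence $t=0$, which contradicts $B(t,\cdot)=\chi\neq0$.
  have htχ : χ t ≠ 0 := by
    intro h0
    have hcor : t ∈ LieAlgebra.corootSpace (χ : H → ℂ) := by
      rw [LieAlgebra.mem_corootSpace]
      exact Submodule.subset_span ⟨e, heχ, f, hf, rfl⟩
    have ht0 : t = 0 := by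
      refine eq_zero_of_forall_weight hs hr t fun ψ hψ => ?_
      have hψ' : LieModule.genWeightSpace g (ψ : H → ℂ) ≠ ⊥ := by
        obtain ⟨v, hv, hv0⟩ := Submodule.exists_mem_ne_zero_of_ne_bot hψ
        intro hbot
        apply hv0
        have : v ∈ LieModule.genWeightSpace g (ψ : H → ℂ) := by
          refine LieModule.weightSpace_le_genWeightSpace g (ψ : H → ℂ) ?_
          rw [LieModule.mem_weightSpace]
          exact hv
        rwa [hbot, LieSubmodule.mem_bot] at this
      obtain ⟨a, b, hb, hall⟩ :=
        LieModule.exists_forall_mem_corootSpace_smul_add_eq_zero g (χ : H → ℂ) (ψ : H → ℂ) hχ' hψ'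
      have h1 := hall t hcor
      simp only [Pi.add_apply, Pi.smul_apply, h0, smul_zero, zero_add] at h1
      exact (smul_eq_zero.mp h1).resolve_left hb.ne'
    apply hχ
    ext h
    rw [← htB h, ht0]
    simp
  -- the subspace on which the trace is computed
  let wt : ℕ → (H → ℂ) := fun k => ((1 : ℂ) - k) • (χ : H → ℂ)
  have hwt : Function.Injective wt := fun k l hkl => by
    have : ((1 : ℂ) - k) = 1 - l := smul_left_injective ℂ hχ' hkl
    have : (k : ℂ) = l := by linear_combination -this
    exact_mod_cast this
  have hwts : ∀ k : ℕ, wt (k + 1) = -(k • (χ : H → ℂ)) := fun k => by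
    ext h
    simp only [wt, Pi.smul_apply, Pi.neg_apply]
    simp only [smul_eq_mul, nsmul_eq_mul, Nat.cast_add, Nat.cast_one]
    ring
  -- The space is $\mathbb Ce\oplus\bigoplus_{k\ge0}\mathfrak g_{-k\chi}$. Index 0 is the line of
  -- `e` only, which keeps the unknown dimension of the root space of $\chi$ out of the trace; index
  -- $k+1$ is the generalized root space of $-k\chi$.
  let N : ℕ → Submodule ℂ L.Even := fun k =>
    if k = 0 then Submodule.span ℂ {e} else (LieAlgebra.rootSpace H (wt k)).toSubmodule
  have hN0 : N 0 = Submodule.span ℂ {e} := if_pos rfl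
  have hNs : ∀ k, N (k + 1) = (LieAlgebra.rootSpace H (-(k • (χ : H → ℂ)))).toSubmodule :=
    fun k => by
      simp only [N, Nat.succ_ne_zero, if_false, hwts]
  have hNle : ∀ k, N k ≤ (LieAlgebra.rootSpace H (wt k)).toSubmodule := fun k => by
    rcases k with _ | k
    · rw [hN0, Submodule.span_singleton_le_iff_mem]
      simpa [wt] using heχ
    · simp only [N, Nat.succ_ne_zero, if_false]
      exact le_rfl
  have hind : iSupIndep N := by
    have h1 := (LieSubmodule.iSupIndep_toSubmodule.mpr
      (LieModule.iSupIndep_genWeightSpace ℂ H L.Even)).comp hwt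
    exact h1.mono hNle
  obtain ⟨m, hm⟩ : ∃ m : ℕ, ∀ n, m < n → LieAlgebra.rootSpace H (-(n • (χ : H → ℂ))) = ⊥ := by
    have hfin := LieModule.finite_genWeightSpace_ne_bot ℂ H L.Even
    have hinj : Function.Injective fun n : ℕ => (-(n • (χ : H → ℂ))) := fun a b hab => by
      have h2 : wt (a + 1) = wt (b + 1) := by
        rw [hwts, hwts]; exact hab
      have := hwt h2
      omega
    obtain ⟨m, hm⟩ := (hfin.preimage (hinj.injOn (s := _))).bddAbove
    refine ⟨m, fun n hn => ?_⟩
    by_contra hne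
    exact absurd (hm hne) (not_le.mpr hn)
  let s := Finset.range (m + 2)
  let Y : Submodule ℂ L.Even := ⨆ k ∈ s, N k
  have hNY : ∀ k, N k ≤ Y := fun k => by
    by_cases hk : k ∈ s
    · exact le_biSup N hk
    · have : N k = ⊥ := by
        obtain ⟨k, rfl⟩ : ∃ k', k = k' + 1 := ⟨k - 1, by simp [s] at hk; omega⟩
        rw [hNs, hm k (by simp [s] at hk; omega)]
        simp
      simp [this]
  have hYind : ∀ {p : L.Even → Prop}, (∀ k, ∀ x ∈ N k, p x) → p 0 →
      (∀ x y, p x → p y → p (x + y)) → ∀ x ∈ Y, p x := by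
    intro p h1 h2 h3 x hx
    refine Submodule.iSup_induction (p := fun k => ⨆ (_ : k ∈ s), N k) (motive := p) hx
      (fun k y hy => ?_) h2 h3
    by_cases hk : k ∈ s
    · rw [iSup_pos hk] at hy
      exact h1 k y hy
    · rw [iSup_neg hk, Submodule.mem_bot] at hy
      rw [hy]; exact h2
  have hstab : ∀ T : End ℂ L.Even, (∀ k, ∀ x ∈ N k, T x ∈ Y) → ∀ x ∈ Y, T x ∈ Y := fun T hT =>
    hYind hT (by rw [map_zero]; exact zero_mem _)
      (fun x y hx hy => by rw [map_add]; exact add_mem hx hy)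
  have hHmem : ∀ {k x}, x ∈ N k → ∀ h : H, ⁅(h : L.Even), x⁆ ∈ N k := by
    intro k x hx h
    rcases k with _ | k
    · rw [hN0] at hx ⊢
      obtain ⟨c, rfl⟩ := Submodule.mem_span_singleton.mp hx
      rw [lie_smul, he' h]
      exact Submodule.smul_mem _ _ (Submodule.smul_mem _ _ (Submodule.mem_span_singleton_self e))
    · rw [hNs] at hx ⊢
      exact (LieAlgebra.rootSpace H (-(k • (χ : H → ℂ)))).lie_mem (x := h) hx
  have hEY : ∀ x ∈ Y, LieAlgebra.ad ℂ L.Even e x ∈ Y := by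
    refine hstab _ fun k x hx => ?_
    rw [LieAlgebra.ad_apply]
    rcases k with _ | _ | k
    · rw [hN0] at hx
      obtain ⟨c, rfl⟩ := Submodule.mem_span_singleton.mp hx
      rw [lie_smul, lie_self, smul_zero]
      exact zero_mem _
    · rw [hNs, zero_smul, neg_zero, LieSubmodule.mem_toSubmodule, mem_genRootSpace_zero] at hx
      refine hNY 0 ?_
      rw [hN0, ← lie_skew, he' ⟨x, hx⟩, ← neg_smul]
      exact Submodule.smul_mem _ _ (Submodule.mem_span_singleton_self e)
    · rw [hNs] at hx
      refine hNY (k + 1) ?_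
      rw [hNs]
      have := LieAlgebra.lie_mem_genWeightSpace_of_mem_genWeightSpace heχ hx
      have h2 : (χ : H → ℂ) + -((k + 1) • (χ : H → ℂ)) = -(k • (χ : H → ℂ)) := by
        rw [add_smul, one_smul]; abel
      rwa [h2] at this
  have hFY : ∀ x ∈ Y, LieAlgebra.ad ℂ L.Even f x ∈ Y := by
    refine hstab _ fun k x hx => ?_
    rw [LieAlgebra.ad_apply]
    rcases k with _ | k
    · rw [hN0] at hx
      obtain ⟨c, rfl⟩ := Submodule.mem_span_singleton.mp hx
      refine hNY 1 ?_
      rw [hNs, zero_smul, neg_zero, LieSubmodule.mem_toSubmodule, mem_genRootSpace_zero, lie_smul,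
        ← lie_skew]
      exact H.smul_mem _ (H.neg_mem htH)
    · rw [hNs] at hx
      refine hNY (k + 2) ?_
      rw [hNs]
      have := LieAlgebra.lie_mem_genWeightSpace_of_mem_genWeightSpace hf hx
      have h2 : -(χ : H → ℂ) + -(k • (χ : H → ℂ)) = -((k + 1) • (χ : H → ℂ)) := by
        rw [add_smul, one_smul]; abel
      rwa [h2] at this
  have hTY : ∀ x ∈ Y, LieAlgebra.ad ℂ L.Even (t : L.Even) x ∈ Y :=
    hstab _ fun k x hx => hNY k (hHmem hx t)
  have htr0 : LinearMap.trace ℂ Y ((LieAlgebra.ad ℂ L.Even (t : L.Even)).restrict hTY) = 0 := by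
    have : (LieAlgebra.ad ℂ L.Even (t : L.Even)).restrict hTY =
        ((LieAlgebra.ad ℂ L.Even e).restrict hEY) * ((LieAlgebra.ad ℂ L.Even f).restrict hFY) -
        ((LieAlgebra.ad ℂ L.Even f).restrict hFY) *
          ((LieAlgebra.ad ℂ L.Even e).restrict hEY) := by
      ext x
      exact congrArg Subtype.val (lie_lie e f (x : L.Even))
    rw [this]
    exact trace_mul_sub_mul _ _
  rw [trace_restrict_biSup_of_sub_nilpotent s hind (LieAlgebra.ad ℂ L.Even (t : L.Even))
    (fun k => (1 - (k : ℂ)) * χ t) (fun k x hx => hHmem hx t) (fun k => ?_) Y rfl hTY] at htr0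
  swap
  · obtain ⟨n, hn⟩ := LieModule.exists_genWeightSpace_le_ker_of_isNoetherian L.Even (wt k) t
    refine ⟨n, fun x hx => ?_⟩
    have := hn (hNle k hx)
    rw [LinearMap.mem_ker, Algebra.algebraMap_eq_smul_one] at this
    exact this
  -- extract the dimensions
  have hd0 : finrank ℂ (N 0) = 1 := by rw [hN0]; exact finrank_span_singleton he0
  let d : ℕ → ℕ := fun k => finrank ℂ (N (k + 2))
  -- The trace of the commutator $t=[e,f]$ is zero, but it is also
  -- $\chi(t)\bigl(1-\sum_{n\ge1}n\dim\mathfrak g_{-n\chi}\bigr)$. Since $\mathfrak g_{-\chi}\neq0$,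
  -- the sum can only be 1 if the term $n=1$ is 1 and the others vanish.
  have hsum : ∑ k ∈ Finset.range m, (k + 1) * d k = 1 := by
    have h1 : ∑ k ∈ s, (finrank ℂ (N k) : ℂ) * ((1 - (k : ℂ)) * χ t) =
        χ t * (1 - ∑ k ∈ Finset.range m, ((k : ℂ) + 1) * d k) := by
      simp only [s]
      rw [Finset.sum_range_succ', Finset.sum_range_succ', hd0]
      have h5 : ∑ k ∈ Finset.range m, (finrank ℂ (N (k + 1 + 1)) : ℂ) *
          ((1 - ((k + 1 + 1 : ℕ) : ℂ)) * χ t) =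
          -(χ t * ∑ k ∈ Finset.range m, ((k : ℂ) + 1) * d k) := by
        rw [Finset.mul_sum, ← Finset.sum_neg_distrib]
        refine Finset.sum_congr rfl fun k _ => ?_
        simp only [d]
        push_cast
        ring
      rw [h5]
      push_cast
      ring
    rw [h1] at htr0
    have h2 := (mul_eq_zero.mp htr0).resolve_left htχ
    have h3 : (∑ k ∈ Finset.range m, ((k : ℂ) + 1) * d k) = 1 := by linear_combination -h2
    exact_mod_cast h3
  have hd1 : 0 < finrank ℂ (LieAlgebra.rootSpace H (-(χ : H → ℂ))) := by
    have : Nontrivial (LieAlgebra.rootSpace H (-(χ : H → ℂ))) :=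
      ⟨⟨⟨f, hf⟩, 0, fun h => by
        have : f = 0 := congrArg Subtype.val h
        rw [this] at hBf
        simp at hBf⟩⟩
    exact finrank_pos
  have hdk : ∀ k, d k = finrank ℂ (LieAlgebra.rootSpace H (-((k + 1) • (χ : H → ℂ)))) := fun k => by
    simp only [d]
    rw [hNs]
    rfl
  have hd1' : d 0 = finrank ℂ (LieAlgebra.rootSpace H (-(χ : H → ℂ))) := by
    rw [hdk, zero_add, one_smul]
  have hm1 : 0 < m := by
    rcases Nat.eq_zero_or_pos m with h | h
    · rw [h] at hsum; simp at hsum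
    · exact h
  obtain ⟨m', rfl⟩ : ∃ m', m = m' + 1 := ⟨m - 1, by omega⟩
  rw [Finset.sum_range_succ'] at hsum
  have hz : ∑ k ∈ Finset.range m', (k + 1 + 1) * d (k + 1) = 0 := by omega
  refine ⟨by omega, fun n hn => ?_, f, hf, t, rfl, htχ, htB⟩
  by_cases hnm : m' + 1 < n
  · exact hm n hnm
  · obtain ⟨k, rfl⟩ : ∃ k, n = k + 2 := ⟨n - 2, by omega⟩
    have h1 := (Finset.sum_eq_zero_iff.mp hz) k (by simp; omega)
    have h2 : d (k + 1) = 0 := by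
      rcases Nat.mul_eq_zero.mp h1 with h | h
      · omega
      · exact h
    rw [hdk] at h2
    rw [← LieSubmodule.toSubmodule_eq_bot]
    exact Submodule.finrank_eq_zero.mp h2

end Cartan

end LieSuperalgebra

namespace LieSuperalgebra

variable {g : Type*} [AddCommGroup g] [Module ℂ g] {L : LieSuperalgebra g}

lemma leibniz_even {h : g} (hh : h ∈ L.part 0) (a x : g) :
    L.br h (L.br a x) = L.br (L.br h a) x + L.br a (L.br h x) := by
  induction a using L.homogeneous_induction with
  | h k a ha => exact jacobi_even hh ha x
  | hadd a b ha hb => simp only [map_add, LinearMap.add_apply, ha, hb]; abel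

/-! ### Root spaces and their homogeneous parts -/

section RootSpaces

variable {H : LieSubalgebra ℂ L.Even}

lemma br_mem_rootSpace {α β : Dual ℂ H} {a x : g} (ha : a ∈ L.rootSpace H α)
    (hx : x ∈ L.rootSpace H β) : L.br a x ∈ L.rootSpace H (α + β) := fun h => by
  rw [leibniz_even (h : L.Even).2, ha h, hx h, map_smul, map_smul, LinearMap.smul_apply,
    ← add_smul, LinearMap.add_apply]

variable (L H) in
/-- The homogeneous part of parity `i` of the root space of `α`. -/
abbrev rootPart (α : Dual ℂ H) (i : ZMod 2) : Submodule ℂ g := L.rootSpace H α ⊓ L.part i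

lemma br_mem_rootPart {α β : Dual ℂ H} {i j : ZMod 2} {a x : g} (ha : a ∈ L.rootPart H α i)
    (hx : x ∈ L.rootPart H β j) : L.br a x ∈ L.rootPart H (α + β) (i + j) :=
  ⟨br_mem_rootSpace ha.1 hx.1, L.br_mem ha.2 hx.2⟩

lemma mem_rootSpace_of_add {α : Dual ℂ H} {a b : g} (ha : a ∈ L.part 0) (hb : b ∈ L.part 1)
    (hab : a + b ∈ L.rootSpace H α) : a ∈ L.rootSpace H α ∧ b ∈ L.rootSpace H α := by
  have key : ∀ h : H, L.br ((h : L.Even) : g) a - α h • a = 0 ∧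
      L.br ((h : L.Even) : g) b - α h • b = 0 := fun h => by
    have h1 := hab h
    have ha' : L.br ((h : L.Even) : g) a - α h • a ∈ L.part 0 :=
      sub_mem (by simpa using L.br_mem (h : L.Even).2 ha) (Submodule.smul_mem _ _ ha)
    have hb' : L.br ((h : L.Even) : g) b - α h • b ∈ L.part 1 :=
      sub_mem (by simpa using L.br_mem (h : L.Even).2 hb) (Submodule.smul_mem _ _ hb)
    have h2 : L.br ((h : L.Even) : g) a - α h • a = -(L.br ((h : L.Even) : g) b - α h • b) := by
      rw [map_add, smul_add] at h1
      rw [neg_sub, sub_eq_sub_iff_add_eq_add, h1, add_comm]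
    have h3 : L.br ((h : L.Even) : g) a - α h • a = 0 :=
      Submodule.disjoint_def.mp L.part_disjoint _ ha' (h2 ▸ neg_mem hb')
    rw [h3] at h2
    exact ⟨h3, neg_eq_zero.mp h2.symm⟩
  exact ⟨fun h => sub_eq_zero.mp (key h).1, fun h => sub_eq_zero.mp (key h).2⟩

lemma rootSpace_eq_sup (α : Dual ℂ H) :
    L.rootSpace H α = L.rootPart H α 0 ⊔ L.rootPart H α 1 := by
  refine le_antisymm (fun x hx => ?_) (sup_le inf_le_left inf_le_left)
  obtain ⟨a, ha, b, hb, rfl⟩ := L.exists_even_add_odd x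
  obtain ⟨h1, h2⟩ := mem_rootSpace_of_add ha hb hx
  exact add_mem (Submodule.mem_sup_left ⟨h1, ha⟩) (Submodule.mem_sup_right ⟨h2, hb⟩)

lemma rootSpace_homogeneous_induction {α : Dual ℂ H} {p : g → Prop}
    (h : ∀ i, ∀ x ∈ L.rootPart H α i, p x) (hadd : ∀ x y, p x → p y → p (x + y)) (x : g)
    (hx : x ∈ L.rootSpace H α) : p x := by
  rw [rootSpace_eq_sup] at hx
  obtain ⟨a, ha, b, hb, rfl⟩ := Submodule.mem_sup.mp hx
  exact hadd _ _ (h 0 a ha) (h 1 b hb)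

lemma mem_roots_iff {α : Dual ℂ H} :
    α ∈ L.roots H ↔ α ∈ L.evenRoots H ∨ α ∈ L.oddRoots H := by
  simp only [roots, evenRoots, oddRoots, Set.mem_ofPred_eq]
  rw [rootSpace_eq_sup (L := L) α]
  simp only [ne_eq, sup_eq_bot_iff, not_and_or]
  have e0 : (L.rootPart H α 0 ⊔ L.rootPart H α 1) ⊓ L.part 0 = L.rootPart H α 0 := by
    rw [← rootSpace_eq_sup]
  have e1 : (L.rootPart H α 0 ⊔ L.rootPart H α 1) ⊓ L.part 1 = L.rootPart H α 1 := by
    rw [← rootSpace_eq_sup]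
  rw [e0, e1]
  tauto

end RootSpaces

/-! ### The root space decomposition and the form on the dual of the Cartan subalgebra -/

section Structure

variable [FiniteDimensional ℂ g] {H : LieSubalgebra ℂ L.Even} [H.IsCartanSubalgebra]
variable {B : LinearMap.BilinForm ℂ g} (hL : L.IsBasicClassical) (hB : L.IsInvariantForm B)

include hL hB in
-- For $\beta\neq0$ the space of $-\beta$ is nonzero too, and `finrank_genRootSpace` applied to
-- $-\beta$ shows that the generalized root space of $\beta$ is a line. It contains a genuine
-- eigenvector, so it consists of eigenvectors. For $\beta=0$ it is `H`, which is abelian.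
lemma exists_eq_of_genRootSpace_ne_bot {β : H → ℂ} (hβ : LieAlgebra.rootSpace H β ≠ ⊥) :
    ∃ ψ : Dual ℂ H, β = ψ ∧ ∀ x ∈ LieAlgebra.rootSpace H β, (x : g) ∈ L.rootSpace H ψ := by
  have hab := cartan_isLieAbelian (H := H) hL.simple hL.reductive
  by_cases h0 : β = 0
  · subst h0
    refine ⟨0, rfl, fun x hx h => ?_⟩
    rw [mem_genRootSpace_zero] at hx
    rw [LinearMap.zero_apply, zero_smul]
    have : ⁅h, (⟨x, hx⟩ : H)⁆ = 0 := trivial_lie_zero H H h _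
    exact congrArg (fun y : H => ((y : L.Even) : g)) this
  · obtain ⟨v, hv, hv0⟩ : ∃ v ∈ LieAlgebra.rootSpace H β, v ≠ 0 := by
      by_contra! hcon
      exact hβ ((LieSubmodule.eq_bot_iff _).mpr hcon)
    obtain ⟨y, hy, hy1⟩ := hB.exists_genRootSpace_neg hv hv0
    have hβ' : LieAlgebra.rootSpace H (-β) ≠ ⊥ := fun hbot => by
      have h := (LieSubmodule.eq_bot_iff _).mp hbot y hy
      rw [h] at hy1
      simp at hy1
    let w : LieModule.Weight ℂ H L.Even := ⟨β, hβ⟩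
    let w' : LieModule.Weight ℂ H L.Even := ⟨-β, hβ'⟩
    obtain ⟨e, he0, he⟩ := LieModule.exists_forall_lie_eq_smul ℂ H L.Even w
    obtain ⟨e', he0', he'⟩ := LieModule.exists_forall_lie_eq_smul ℂ H L.Even w'
    have hw : (w.toLinear : H → ℂ) = β := rfl
    have hw' : (w'.toLinear : H → ℂ) = -β := rfl
    refine ⟨w.toLinear, rfl, fun x hx => ?_⟩
    have h1 := (finrank_genRootSpace hL.simple hL.reductive hB (χ := w'.toLinear)
      (fun h => h0 (by
        have : (w'.toLinear : H → ℂ) = 0 := by rw [h]; rfl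
        rw [hw'] at this
        exact neg_eq_zero.mp this)) he0' (fun h => congrArg Subtype.val (he' h))).1
    rw [hw', neg_neg] at h1
    have heβ : e ∈ LieAlgebra.rootSpace H β := by
      refine LieModule.weightSpace_le_genWeightSpace L.Even β ?_
      rw [LieModule.mem_weightSpace]
      exact he
    obtain ⟨c, hc⟩ := (finrank_eq_one_iff_of_nonzero' (⟨e, heβ⟩ : LieAlgebra.rootSpace H β)
      (fun h => he0 (congrArg Subtype.val h))).mp h1 ⟨x, hx⟩
    have hx' : x = c • e := (congrArg Subtype.val hc).symm
    rw [hx', Submodule.coe_smul]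
    exact Submodule.smul_mem _ _ (fun h => congrArg Subtype.val (he h))

include hL hB in
lemma even_induction {p : g → Prop} (h : ∀ ψ : Dual ℂ H, ∀ x ∈ L.rootPart H ψ 0, p x) (h0 : p 0)
    (hadd : ∀ x y, p x → p y → p (x + y)) (x : L.Even) : p x := by
  have hx : x ∈ ⨆ β : H → ℂ, LieAlgebra.rootSpace H β := by
    simp [LieModule.iSup_genWeightSpace_eq_top ℂ H L.Even]
  induction hx using LieSubmodule.iSup_induction' with
  | mem β x hx =>
    by_cases hb : LieAlgebra.rootSpace H β = ⊥
    · rw [hb, LieSubmodule.mem_bot] at hx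
      rw [hx]; exact h0
    · obtain ⟨ψ, -, hψ⟩ := exists_eq_of_genRootSpace_ne_bot hL hB hb
      exact h ψ x ⟨hψ x hx, x.2⟩
  | zero => exact h0
  | add a b _ _ ha hb => exact hadd _ _ ha hb

include hL hB in
-- The even part is spanned by root vectors, so the sum of the root spaces is stable under it. Every
-- nonzero stable subspace contains a weight vector, and reductivity concludes.
lemma iSup_rootSpace : ⨆ ψ : Dual ℂ H, L.rootSpace H ψ = ⊤ := by
  let D : LieSubmodule ℂ L.Even g :=
    { toSubmodule := ⨆ ψ : Dual ℂ H, L.rootSpace H ψ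
      lie_mem := by
        intro a x hx
        change L.br (a : g) x ∈ ⨆ ψ : Dual ℂ H, L.rootSpace H ψ
        refine even_induction (H := H) hL hB (p := fun a => L.br a x ∈ ⨆ ψ, L.rootSpace H ψ)
          (fun α a ha => ?_) ?_ ?_ a
        · refine Submodule.iSup_induction _ (motive := fun x => L.br a x ∈ ⨆ ψ, L.rootSpace H ψ)
            hx (fun ψ x hx => ?_) ?_ ?_
          · exact Submodule.mem_iSup_of_mem (α + ψ) (br_mem_rootSpace ha.1 hx)
          · rw [map_zero]; exact zero_mem _
          · intro x y h1 h2
            rw [map_add]; exact add_mem h1 h2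
        · rw [map_zero, LinearMap.zero_apply]; exact zero_mem _
        · intro b c h1 h2
          rw [map_add, LinearMap.add_apply]; exact add_mem h1 h2 }
  have hD : D = ⊤ := by
    refine hL.reductive.eq_top D fun N hN => ?_
    obtain ⟨ψ, x, hx, hx0, hxψ⟩ := exists_weight_vector (H := H) N hN
    exact ⟨x, hx, hx0, Submodule.mem_iSup_of_mem ψ hxψ⟩
  have : D.toSubmodule = ⊤ := by rw [hD]; simp
  exact this

variable (L H) in
lemma iSupIndep_rootSpace : iSupIndep fun ψ : Dual ℂ H => L.rootSpace H ψ := by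
  have hinj : Function.Injective fun ψ : Dual ℂ H => (ψ : H → ℂ) := DFunLike.coe_injective
  have h1 := (LieSubmodule.iSupIndep_toSubmodule.mpr
    (LieModule.iSupIndep_genWeightSpace ℂ H g)).comp hinj
  refine h1.mono fun ψ x hx => ?_
  refine LieModule.weightSpace_le_genWeightSpace g (ψ : H → ℂ) ?_
  rw [LieModule.mem_weightSpace]
  exact hx

variable (L H) in
lemma finite_setOf_rootSpace_ne_bot : {ψ : Dual ℂ H | L.rootSpace H ψ ≠ ⊥}.Finite :=
  WellFoundedGT.finite_ne_bot_of_iSupIndep (L.iSupIndep_rootSpace H)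

variable (L H) in
lemma finite_roots : (L.roots H).Finite :=
  (L.finite_setOf_rootSpace_ne_bot H).subset fun _ h => h.2

include hL in
lemma coe_mem_rootPart_zero (h : H) : ((h : L.Even) : g) ∈ L.rootPart H 0 0 := by
  have hab := cartan_isLieAbelian (H := H) hL.simple hL.reductive
  refine ⟨fun k => ?_, (h : L.Even).2⟩
  rw [LinearMap.zero_apply, zero_smul]
  have : ⁅k, h⁆ = 0 := trivial_lie_zero H H k h
  exact congrArg (fun y : H => ((y : L.Even) : g)) this

lemma exists_cartan_of_mem_rootPart_zero {x : g} (hx : x ∈ L.rootPart H 0 0) :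
    ∃ h : H, ((h : L.Even) : g) = x := by
  have : (⟨x, hx.2⟩ : L.Even) ∈ LieAlgebra.rootSpace H (0 : H → ℂ) := by
    refine LieModule.weightSpace_le_genWeightSpace L.Even (0 : H → ℂ) ?_
    rw [LieModule.mem_weightSpace]
    exact fun h => Subtype.ext (hx.1 h)
  exact ⟨⟨⟨x, hx.2⟩, mem_genRootSpace_zero.mp this⟩, rfl⟩

include hB in
lemma IsInvariantForm.eq_zero_of_add_ne_zero {α β : Dual ℂ H} (hαβ : α + β ≠ 0) {x y : g}
    (hx : x ∈ L.rootSpace H α) (hy : y ∈ L.rootSpace H β) : B x y = 0 := by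
  obtain ⟨h, hh⟩ : ∃ h, (α + β) h ≠ 0 := by
    by_contra! hcon
    exact hαβ (LinearMap.ext hcon)
  have h1 := hB.skew_even (h : L.Even).2 x y
  rw [hx h, hy h, map_smul, map_smul, LinearMap.smul_apply, smul_eq_mul, smul_eq_mul] at h1
  have : (α + β) h * B x y = 0 := by
    rw [LinearMap.add_apply]; linear_combination h1
  exact (mul_eq_zero.mp this).resolve_left hh

include hL hB in
lemma IsInvariantForm.exists_dual_root_vector {α : Dual ℂ H} {i : ZMod 2} {x : g}
    (hx : x ∈ L.rootPart H α i) (hx0 : x ≠ 0) : ∃ y ∈ L.rootPart H (-α) i, B x y = 1 := by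
  by_contra! hcon
  have hall : ∀ y ∈ L.rootPart H (-α) i, B x y = 0 := fun y hy => by
    by_contra h0
    refine hcon ((B x y)⁻¹ • y) (Submodule.smul_mem _ _ hy) ?_
    simp [h0]
  refine hx0 (hB.nondegenerate.1 x fun y => ?_)
  have hy : y ∈ ⨆ ψ : Dual ℂ H, L.rootSpace H ψ := by
    rw [iSup_rootSpace hL hB]; exact Submodule.mem_top
  refine Submodule.iSup_induction _ (motive := fun y => B x y = 0) hy (fun ψ y hy => ?_)
    (map_zero _) (fun a b ha hb => by rw [map_add, ha, hb, add_zero])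
  by_cases hψ : α + ψ = 0
  · obtain rfl : ψ = -α := (neg_eq_of_add_eq_zero_right hψ).symm
    refine rootSpace_homogeneous_induction (p := fun y => B x y = 0) (fun j y hy => ?_)
      (fun a b ha hb => by rw [map_add, ha, hb, add_zero]) y hy
    by_cases hij : i = j
    · subst hij; exact hall y hy
    · exact hB.even hx.2 hy.2 hij
  · exact hB.eq_zero_of_add_ne_zero hψ hx.1 hy

include hL hB in
lemma rootPart_neg_ne_bot {α : Dual ℂ H} {i : ZMod 2} (h : L.rootPart H α i ≠ ⊥) :
    L.rootPart H (-α) i ≠ ⊥ := by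
  obtain ⟨x, hx, hx0⟩ := Submodule.exists_mem_ne_zero_of_ne_bot h
  obtain ⟨y, hy, hy1⟩ := hB.exists_dual_root_vector hL hx hx0
  intro hbot
  rw [hbot, Submodule.mem_bot] at hy
  rw [hy] at hy1
  simp at hy1

include hL hB in
lemma neg_mem_evenRoots {α : Dual ℂ H} (h : α ∈ L.evenRoots H) : -α ∈ L.evenRoots H :=
  ⟨neg_ne_zero.mpr h.1, rootPart_neg_ne_bot hL hB h.2⟩

include hL hB in
lemma neg_mem_oddRoots {α : Dual ℂ H} (h : α ∈ L.oddRoots H) : -α ∈ L.oddRoots H :=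
  ⟨neg_ne_zero.mpr h.1, rootPart_neg_ne_bot hL hB h.2⟩

include hL hB in
lemma neg_mem_roots {α : Dual ℂ H} (h : α ∈ L.roots H) : -α ∈ L.roots H := by
  rw [mem_roots_iff] at h ⊢
  exact h.imp (neg_mem_evenRoots hL hB) (neg_mem_oddRoots hL hB)

section Pairing

variable (H) in
/-- The map `H → H^*` given by the form. -/
def cartanForm (B : LinearMap.BilinForm ℂ g) : H →ₗ[ℂ] Dual ℂ H :=
  B.compl₁₂ ((L.part 0).subtype ∘ₗ H.toSubmodule.subtype)
    ((L.part 0).subtype ∘ₗ H.toSubmodule.subtype)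

lemma cartanForm_apply (t h : H) :
    cartanForm H B t h = B ((t : L.Even) : g) ((h : L.Even) : g) := rfl

include hB in
lemma cartanForm_bijective : Function.Bijective (cartanForm H B) := by
  have hinj : Function.Injective (cartanForm H B) := by
    rw [injective_iff_map_eq_zero]
    exact fun t ht => hB.cartan_eq_zero fun u => LinearMap.congr_fun ht u
  exact ⟨hinj, (LinearMap.injective_iff_surjective_of_finrank_eq_finrank
    (Subspace.dual_finrank_eq).symm).mp hinj⟩

include hB in
lemma dualVector_spec (α : Dual ℂ H) (h : H) :
    B ((L.dualVector H B α : L.Even) : g) ((h : L.Even) : g) = α h := by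
  obtain ⟨t, ht⟩ := (cartanForm_bijective hB).2 α
  exact Classical.epsilon_spec
    (p := fun t : H => ∀ h : H, B ((t : L.Even) : g) ((h : L.Even) : g) = α h)
    ⟨t, fun h => LinearMap.congr_fun ht h⟩ h

include hB in
lemma eq_dualVector {α : Dual ℂ H} {t : H}
    (ht : ∀ h : H, B ((t : L.Even) : g) ((h : L.Even) : g) = α h) : t = L.dualVector H B α :=
  (cartanForm_bijective hB).1 (LinearMap.ext fun h => by
    rw [cartanForm_apply, cartanForm_apply, ht, dualVector_spec hB])

include hB in
lemma pairing_eq (α β : Dual ℂ H) : L.pairing H B α β = α (L.dualVector H B β) :=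
  dualVector_spec hB α _

include hB in
lemma pairing_comm (α β : Dual ℂ H) : L.pairing H B α β = L.pairing H B β α :=
  hB.comm_even (L.dualVector H B α : L.Even).2 (L.dualVector H B β : L.Even).2

include hB in
lemma pairing_add_left (α β γ : Dual ℂ H) :
    L.pairing H B (α + β) γ = L.pairing H B α γ + L.pairing H B β γ := by
  simp [pairing_eq hB]

include hB in
lemma pairing_smul_left (c : ℂ) (α γ : Dual ℂ H) :
    L.pairing H B (c • α) γ = c * L.pairing H B α γ := by
  simp [pairing_eq hB]

include hB in
lemma pairing_add_right (α β γ : Dual ℂ H) :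
    L.pairing H B γ (α + β) = L.pairing H B γ α + L.pairing H B γ β := by
  rw [pairing_comm hB, pairing_add_left hB, pairing_comm hB α, pairing_comm hB β]

include hB in
lemma pairing_smul_right (c : ℂ) (α γ : Dual ℂ H) :
    L.pairing H B γ (c • α) = c * L.pairing H B γ α := by
  rw [pairing_comm hB, pairing_smul_left hB, pairing_comm hB α]

include hB in
lemma dualVector_ne_zero {α : Dual ℂ H} (hα : α ≠ 0) : L.dualVector H B α ≠ 0 := by
  intro h
  apply hα
  ext t
  rw [← dualVector_spec hB α t, h]
  simp

include hL hB in
/-- Opposite root vectors of the same parity have bracket `B(x, y) h_α`. -/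
lemma br_opposite {α : Dual ℂ H} {i : ZMod 2} {x y : g} (hx : x ∈ L.rootPart H α i)
    (hy : y ∈ L.rootPart H (-α) i) :
    L.br x y = B x y • ((L.dualVector H B α : L.Even) : g) := by
  have h1 : L.br x y ∈ L.rootPart H 0 0 := by
    have := br_mem_rootPart hx hy
    rwa [add_neg_cancel, CharTwo.add_self_eq_zero] at this
  obtain ⟨t, ht⟩ := exists_cartan_of_mem_rootPart_zero h1
  have h2 : t = B x y • L.dualVector H B α := by
    apply (cartanForm_bijective hB).1
    ext h
    rw [map_smul, LinearMap.smul_apply, cartanForm_apply, cartanForm_apply, dualVector_spec hB, ht,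
      hB.invariant, ← neg_neg (L.br y _), ← br_skew_even (h : L.Even).2, hy.1 h]
    simp [mul_comm]
  rw [← ht, h2]
  rfl

end Pairing

section EvenRoots

include hL hB

/-- `finrank_genRootSpace` describes the root spaces opposite to a given root vector, so it is
applied to a root vector of $-\alpha$. -/
lemma evenRoots_structure {α : Dual ℂ H} (hα : α ∈ L.evenRoots H) :
    finrank ℂ (L.rootPart H α 0) = 1 ∧ L.pairing H B α α ≠ 0 ∧
      (2 : ℂ) • α ∉ L.evenRoots H := by
  have hα' := neg_mem_evenRoots hL hB hα
  obtain ⟨x, hx, hx0⟩ := Submodule.exists_mem_ne_zero_of_ne_bot hα'.2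
  obtain ⟨h1, h2, f, hf, t, hft, hχt, htB⟩ := finrank_genRootSpace hL.simple hL.reductive hB hα'.1
    (e := ⟨x, hx.2⟩) (fun h => hx0 (congrArg Subtype.val h)) hx.1
  have hcoe : -((-α : Dual ℂ H) : H → ℂ) = (α : H → ℂ) := by
    ext h; simp
  have hgen : ∀ (β : Dual ℂ H) (y : L.Even), (y : g) ∈ L.rootSpace H β →
      y ∈ LieAlgebra.rootSpace H (β : H → ℂ) := fun β y hy => by
    refine LieModule.weightSpace_le_genWeightSpace L.Even (β : H → ℂ) ?_
    rw [LieModule.mem_weightSpace]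
    exact fun h => Subtype.ext (hy h)
  refine ⟨?_, ?_, ?_⟩
  · have hle : L.rootPart H α 0 ≤
        ((LieAlgebra.rootSpace H (α : H → ℂ)).toSubmodule.map (L.part 0).subtype) := fun y hy =>
      ⟨⟨y, hy.2⟩, hgen α ⟨y, hy.2⟩ hy.1, rfl⟩
    have h3 := Submodule.finrank_mono hle
    rw [hcoe] at h1
    have h4 : finrank ℂ ((LieAlgebra.rootSpace H (α : H → ℂ)).toSubmodule.map
        (L.part 0).subtype) = 1 :=
      (LinearEquiv.finrank_eq (Submodule.equivMapOfInjective _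
        (L.part 0).injective_subtype _)).symm.trans h1
    have h5 : 0 < finrank ℂ (L.rootPart H α 0) := by
      have : Nontrivial (L.rootPart H α 0) := Submodule.nontrivial_iff_ne_bot.mpr hα.2
      exact finrank_pos
    omega
  · have ht := eq_dualVector hB htB
    have h3 : L.pairing H B (-α) (-α) ≠ 0 := by
      rw [pairing_eq hB, ← ht]; exact hχt
    have h4 : (-α) = (-1 : ℂ) • α := by simp
    rw [h4, pairing_smul_left hB, pairing_smul_right hB] at h3
    simpa using h3
  · intro h2α
    obtain ⟨y, hy, hy0⟩ := Submodule.exists_mem_ne_zero_of_ne_bot h2α.2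
    have h3 := hgen _ ⟨y, hy.2⟩ hy.1
    have h4 : (((2 : ℂ) • α : Dual ℂ H) : H → ℂ) = -(2 • ((-α : Dual ℂ H) : H → ℂ)) := by
      ext h; simp
    rw [h4, h2 2 le_rfl, LieSubmodule.mem_bot] at h3
    exact hy0 (congrArg Subtype.val h3)

lemma pairing_self_ne_zero {α : Dual ℂ H} (hα : α ∈ L.evenRoots H) : L.pairing H B α α ≠ 0 :=
  (evenRoots_structure hL hB hα).2.1

end EvenRoots

end Structure

end LieSuperalgebra

namespace LieSuperalgebra

variable {g : Type*} [AddCommGroup g] [Module ℂ g] {L : LieSuperalgebra g}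

/-! ### Coroots and root strings -/

section Strings

variable [FiniteDimensional ℂ g] {H : LieSubalgebra ℂ L.Even} [H.IsCartanSubalgebra]
variable {B : LinearMap.BilinForm ℂ g} (hL : L.IsBasicClassical) (hB : L.IsInvariantForm B)

variable (L H B) in
/-- The coroot `2 h_α / (α, α)`. -/
def corootVector (α : Dual ℂ H) : H := (2 / L.pairing H B α α) • L.dualVector H B α

include hB in
lemma apply_corootVector (α β : Dual ℂ H) :
    β (L.corootVector H B α) = 2 * L.pairing H B β α / L.pairing H B α α := by
  rw [corootVector, map_smul, ← pairing_eq hB, smul_eq_mul]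
  ring

include hL hB

lemma apply_corootVector_self {α : Dual ℂ H} (hα : α ∈ L.evenRoots H) :
    α (L.corootVector H B α) = 2 := by
  rw [apply_corootVector hB]
  field_simp [pairing_self_ne_zero hL hB hα]

lemma exists_isSl2Triple {α : Dual ℂ H} (hα : α ∈ L.evenRoots H) :
    ∃ e f : L.Even, (e : g) ∈ L.rootPart H α 0 ∧ (f : g) ∈ L.rootPart H (-α) 0 ∧
      IsSl2Triple (L.corootVector H B α : L.Even) e f := by
  obtain ⟨x, hx, hx0⟩ := Submodule.exists_mem_ne_zero_of_ne_bot hα.2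
  obtain ⟨y, hy, hy1⟩ := hB.exists_dual_root_vector hL hx hx0
  have h0 := pairing_self_ne_zero hL hB hα
  have h2 := apply_corootVector_self hL hB hα
  refine ⟨⟨x, hx.2⟩, (2 / L.pairing H B α α) • ⟨y, hy.2⟩, hx, Submodule.smul_mem _ _ hy, ?_, ?_,
    ?_, ?_⟩
  · intro h
    have : L.corootVector H B α = 0 := Subtype.ext h
    rw [this, map_zero] at h2
    exact two_ne_zero h2.symm
  · ext
    rw [lie_smul, Submodule.coe_smul, coe_even_lie, br_opposite hL hB hx hy, hy1, one_smul]
    rfl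
  · ext
    rw [coe_even_lie, hx.1, h2, Submodule.coe_smul_of_tower, two_smul, two_smul]
  · ext
    rw [coe_even_lie, Submodule.coe_smul, map_smul, hy.1, LinearMap.neg_apply, h2,
      Submodule.coe_neg, Submodule.coe_smul_of_tower, Submodule.coe_smul, two_smul, neg_smul,
      two_smul, smul_neg, smul_add]

omit [FiniteDimensional ℂ g] [H.IsCartanSubalgebra] hL hB in
lemma pow_toEnd_mem_rootPart {α β : Dual ℂ H} {i : ZMod 2} {e : L.Even}
    (he : (e : g) ∈ L.rootPart H α 0) {x : g} (hx : x ∈ L.rootPart H β i) (k : ℕ) :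
    (LieModule.toEnd ℂ L.Even g e ^ k) x ∈ L.rootPart H (β + (k : ℂ) • α) i := by
  induction k with
  | zero => simpa using hx
  | succ k ih =>
    rw [pow_succ', Module.End.mul_apply]
    have := br_mem_rootPart he ih
    rw [zero_add] at this
    have e1 : β + ((k + 1 : ℕ) : ℂ) • α = α + (β + (k : ℂ) • α) := by push_cast; module
    rw [e1]
    exact this

/-- Root strings: the value `n` of a root on the coroot of `α` is an integer, and one may
subtract `α` from the root `n` times. -/
lemma exists_int_string {α β : Dual ℂ H} (hα : α ∈ L.evenRoots H) {i : ZMod 2}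
    (hβ : L.rootPart H β i ≠ ⊥) :
    ∃ n : ℤ, β (L.corootVector H B α) = n ∧
      ∀ j : ℕ, (j : ℤ) ≤ n → L.rootPart H (β - (j : ℂ) • α) i ≠ ⊥ := by
  obtain ⟨e, f, he, hf, t⟩ := exists_isSl2Triple hL hB hα
  obtain ⟨x, hx, hx0⟩ := Submodule.exists_mem_ne_zero_of_ne_bot hβ
  have h2 := apply_corootVector_self hL hB hα
  have hex : ∃ k : ℕ, (LieModule.toEnd ℂ L.Even g e ^ k) x = 0 := by
    by_contra! hcon
    have hinj : Function.Injective fun k : ℕ => β + (k : ℂ) • α := fun a b hab => by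
      have := congrArg (fun φ : Dual ℂ H => φ (L.corootVector H B α)) hab
      simpa [h2] using this
    refine Set.infinite_of_injective_forall_mem (s := {ψ : Dual ℂ H | L.rootSpace H ψ ≠ ⊥}) hinj
      (fun k hk => ?_) (L.finite_setOf_rootSpace_ne_bot H)
    have h1 := (pow_toEnd_mem_rootPart he hx k).1
    rw [hk] at h1
    exact hcon k ((Submodule.mem_bot ℂ).mp h1)
  -- The last nonzero $e^kx$ is a primitive vector, of some weight $n'\in\mathbb N$ on the coroot.
  -- Then $\beta$ takes the value $n'-2k$, and applying $f$ to it $j+k\le n'$ times gives a nonzero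
  -- vector of weight $\beta-j\alpha$.
  obtain ⟨k, hk0, hk1⟩ := Nat.exists_not_and_succ_of_not_zero_of_exists
    (p := fun k => (LieModule.toEnd ℂ L.Even g e ^ k) x = 0) (by simpa using hx0) hex
  set y := (LieModule.toEnd ℂ L.Even g e ^ k) x with hy
  have hyβ := pow_toEnd_mem_rootPart he hx k
  rw [← hy] at hyβ
  have hprim : t.HasPrimitiveVectorWith y ((β + (k : ℂ) • α) (L.corootVector H B α)) := by
    refine ⟨hk0, hyβ.1 _, ?_⟩
    rw [pow_succ', Module.End.mul_apply] at hk1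
    exact hk1
  obtain ⟨n, hn⟩ := hprim.exists_nat
  refine ⟨n - 2 * k, ?_, fun j hj => ?_⟩
  · rw [LinearMap.add_apply, LinearMap.smul_apply, h2, smul_eq_mul] at hn
    push_cast
    linear_combination hn
  · have h1 := hprim.pow_toEnd_f_ne_zero_of_eq_nat hn (i := j + k) (by omega)
    have h3 := pow_toEnd_mem_rootPart hf hyβ (j + k)
    have h4 : β + (k : ℂ) • α + ((j + k : ℕ) : ℂ) • -α = β - (j : ℂ) • α := by
      push_cast; module
    rw [h4] at h3
    exact fun hbot => h1 (by rwa [hbot, Submodule.mem_bot] at h3)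

/-- If the value of $\beta$ on the coroot is nonnegative, its reflection lies on the string of
`exists_int_string`; otherwise the same applies to $-\beta$. -/
lemma rootPart_reflection_ne_bot {α β : Dual ℂ H} (hα : α ∈ L.evenRoots H) {i : ZMod 2}
    (hβ : L.rootPart H β i ≠ ⊥) :
    L.rootPart H (β - β (L.corootVector H B α) • α) i ≠ ⊥ := by
  obtain ⟨n, hn, hs⟩ := exists_int_string hL hB hα hβ
  obtain ⟨n', hn', hs'⟩ := exists_int_string hL hB hα (rootPart_neg_ne_bot hL hB hβ)
  rw [LinearMap.neg_apply, hn] at hn'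
  have hnn : n' = -n := by exact_mod_cast hn'.symm
  rcases le_total 0 n with h | h
  · lift n to ℕ using h
    rw [hn]
    simpa using hs n le_rfl
  · have h0 : 0 ≤ n' := by omega
    lift n' to ℕ using h0
    have := rootPart_neg_ne_bot hL hB (hs' n' le_rfl)
    have e : -(-β - ((n' : ℕ) : ℂ) • α) = β - β (L.corootVector H B α) • α := by
      rw [hn]
      have : (n : ℂ) = -((n' : ℕ) : ℂ) := by
        have h3 : n = -(n' : ℤ) := by omega
        rw [h3]; push_cast; rfl
      rw [this]
      module
    rwa [e] at this

omit hL [FiniteDimensional ℂ g] [H.IsCartanSubalgebra] hB in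
lemma sub_smul_ne_zero {β α : Dual ℂ H} {t : H} (h2 : α t = 2) (hβ : β ≠ 0) :
    β - β t • α ≠ 0 := by
  intro h
  have h1 := congrArg (fun φ : Dual ℂ H => φ t) h
  simp only [LinearMap.sub_apply, LinearMap.smul_apply, h2, LinearMap.zero_apply, smul_eq_mul] at h1
  have h3 : β t = 0 := by linear_combination -h1
  rw [h3, zero_smul, sub_zero] at h
  exact hβ h

lemma reflection_mem_evenRoots {α β : Dual ℂ H} (hα : α ∈ L.evenRoots H)
    (hβ : β ∈ L.evenRoots H) : β - β (L.corootVector H B α) • α ∈ L.evenRoots H :=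
  ⟨sub_smul_ne_zero (apply_corootVector_self hL hB hα) hβ.1,
    rootPart_reflection_ne_bot hL hB hα hβ.2⟩

omit [FiniteDimensional ℂ g] [H.IsCartanSubalgebra] hL hB in
lemma corootVector_smul_eq {c : ℂ} (hc : c ≠ 0) (α : Dual ℂ H) (hB : L.IsInvariantForm B)
    [FiniteDimensional ℂ g] [H.IsCartanSubalgebra] (β : Dual ℂ H) :
    β (L.corootVector H B (c • α)) = c⁻¹ * β (L.corootVector H B α) := by
  rw [apply_corootVector hB, apply_corootVector hB, pairing_smul_left hB, pairing_smul_right hB,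
    pairing_smul_right hB]
  by_cases h : L.pairing H B α α = 0
  · simp [h]
  · field_simp

/-- The only multiples of an even root that are even roots are its opposites. -/
lemma eq_or_eq_neg_of_smul_mem_evenRoots {α : Dual ℂ H} (hα : α ∈ L.evenRoots H) {c : ℂ}
    (hc : c • α ∈ L.evenRoots H) : c = 1 ∨ c = -1 := by
  have hc0 : c ≠ 0 := fun h => hc.1 (by rw [h, zero_smul])
  have h2 := apply_corootVector_self hL hB hα
  obtain ⟨n, hn, -⟩ := exists_int_string hL hB hα hc.2
  obtain ⟨m, hm, -⟩ := exists_int_string hL hB hc hα.2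
  rw [LinearMap.smul_apply, h2, smul_eq_mul] at hn
  rw [corootVector_smul_eq hc0 α hB, h2] at hm
  -- Here $n=2c$ and $m=2/c$ are integers. The values $c=\pm2$ and $c=\pm\frac12$ are excluded
  -- because the double of an even root is never an even root.
  have hnm : n * m = 4 := by
    have : (n : ℂ) * m = 4 := by
      rw [← hn, ← hm]; field_simp; norm_num
    exact_mod_cast this
  have key1 : ∀ γ ∈ L.evenRoots H, ∀ d : ℂ, d • γ ∈ L.evenRoots H → d ≠ 2 ∧ d ≠ -2 :=
      fun γ hγ d hd => by
    have h3 := (evenRoots_structure hL hB hγ).2.2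
    refine ⟨fun h => h3 (h ▸ hd), fun h => h3 ?_⟩
    have := neg_mem_evenRoots hL hB hd
    rwa [h, neg_smul, neg_neg] at this
  have k1 := key1 α hα c hc
  have k2 := key1 (c • α) hc c⁻¹ (by rwa [smul_smul, inv_mul_cancel₀ hc0, one_smul])
  have hn4 : n ∣ 4 := ⟨m, hnm.symm⟩
  have hnb : n ≤ 4 := Int.le_of_dvd (by norm_num) hn4
  have hnb' : -4 ≤ n := by
    have := Int.le_of_dvd (by norm_num) (neg_dvd.mpr hn4); omega
  have hcn : c = n / 2 := by rw [← hn]; ring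
  have hcm : c⁻¹ = m / 2 := by rw [← hm]; ring
  rw [hcn] at k1 ⊢
  rw [hcm] at k2
  interval_cases n
  · exact absurd (by norm_num) k1.2
  · omega
  · right; norm_num
  · obtain rfl : m = -4 := by omega
    exact absurd (by norm_num) k2.2
  · omega
  · obtain rfl : m = 4 := by omega
    exact absurd (by norm_num) k2.1
  · left; norm_num
  · omega
  · exact absurd (by norm_num) k1.1

end Strings

/-! ### Odd roots -/

section OddRoots

variable [FiniteDimensional ℂ g] {H : LieSubalgebra ℂ L.Even} [H.IsCartanSubalgebra]
variable {B : LinearMap.BilinForm ℂ g} (hL : L.IsBasicClassical) (hB : L.IsInvariantForm B)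
include hL hB

/-- An odd root vector with vanishing square forces its root to be isotropic. -/
lemma eq_zero_of_br_self_eq_zero {β : Dual ℂ H} (hβ : L.pairing H B β β ≠ 0) {x : g}
    (hx : x ∈ L.rootPart H β 1) (hxx : L.br x x = 0) : x = 0 := by
  by_contra hx0
  obtain ⟨y, hy, hy1⟩ := hB.exists_dual_root_vector hL hx hx0
  -- The Jacobi identity gives $2[x,[x,y]]=[[x,x],y]=0$, and $[x,y]=h_\beta$, so $(\beta,\beta)x=0$.
  have h1 := jacobi_odd hx.2 hx.2 y
  rw [hxx, map_zero, LinearMap.zero_apply, zero_sub, br_opposite hL hB hx hy, hy1, one_smul] at h1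
  have h2 : L.br x ((L.dualVector H B β : L.Even) : g) = 0 := by
    have : (2 : ℂ) • L.br x ((L.dualVector H B β : L.Even) : g) = 0 := by
      rw [two_smul]; nth_rw 1 [h1]; exact neg_add_cancel _
    exact (smul_eq_zero.mp this).resolve_left two_ne_zero
  rw [← neg_eq_zero, ← br_skew_even (L.dualVector H B β : L.Even).2, hx.1, ← pairing_eq hB] at h2
  exact (smul_eq_zero.mp h2).elim hβ hx0

lemma two_smul_mem_evenRoots {β : Dual ℂ H} (hβ : β ∈ L.oddRoots H)
    (h0 : L.pairing H B β β ≠ 0) : (2 : ℂ) • β ∈ L.evenRoots H := by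
  obtain ⟨x, hx, hx0⟩ := Submodule.exists_mem_ne_zero_of_ne_bot hβ.2
  refine ⟨smul_ne_zero two_ne_zero hβ.1, fun hbot => ?_⟩
  have h1 := br_mem_rootPart hx hx
  rw [CharTwo.add_self_eq_zero, ← two_smul ℂ β] at h1
  have h2 : L.br x x ∈ (⊥ : Submodule ℂ g) := hbot ▸ h1
  exact hx0 (eq_zero_of_br_self_eq_zero hL hB h0 hx ((Submodule.mem_bot ℂ).mp h2))

/-- The map $w\mapsto[w,w]$ is a quadratic form on the root space with values in the line $\mathfrak
g_{2\beta}$. It is anisotropic by `eq_zero_of_br_self_eq_zero`, and over $\mathbb C$ an anisotropic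
form has rank at most one. -/
lemma finrank_oddRoot_eq_one {β : Dual ℂ H} (hβ : β ∈ L.oddRoots H)
    (h0 : L.pairing H B β β ≠ 0) : finrank ℂ (L.rootPart H β 1) = 1 := by
  have h2 := two_smul_mem_evenRoots hL hB hβ h0
  obtain ⟨v, hv, hv0⟩ := Submodule.exists_mem_ne_zero_of_ne_bot hβ.2
  have hbr : ∀ {x y : g}, x ∈ L.rootPart H β 1 → y ∈ L.rootPart H β 1 →
      L.br x y ∈ L.rootPart H ((2 : ℂ) • β) 0 := fun hx hy => by
    have := br_mem_rootPart hx hy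
    rwa [CharTwo.add_self_eq_zero, ← two_smul ℂ β] at this
  have hvv0 : L.br v v ≠ 0 := fun h => hv0 (eq_zero_of_br_self_eq_zero hL hB h0 hv h)
  have h1 := (finrank_eq_one_iff_of_nonzero' (⟨L.br v v, hbr hv hv⟩ : L.rootPart H ((2 : ℂ) • β) 0)
    (fun h => hvv0 (congrArg Subtype.val h))).mp (evenRoots_structure hL hB h2).1
  refine (finrank_eq_one_iff_of_nonzero' (⟨v, hv⟩ : L.rootPart H β 1)
    (fun h => hv0 (congrArg Subtype.val h))).mpr fun ⟨w, hw⟩ => ?_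
  obtain ⟨a, ha⟩ := h1 ⟨_, hbr hw hw⟩
  obtain ⟨b, hb⟩ := h1 ⟨_, hbr hv hw⟩
  replace ha : a • L.br v v = L.br w w := congrArg Subtype.val ha
  replace hb : b • L.br v v = L.br v w := congrArg Subtype.val hb
  obtain ⟨r, hr⟩ := IsAlgClosed.exists_pow_nat_eq (b ^ 2 - a) (n := 2) two_pos
  have h3 : w - (b + r) • v = 0 := by
    refine eq_zero_of_br_self_eq_zero hL hB h0 (sub_mem hw (Submodule.smul_mem _ _ hv)) ?_
    simp only [map_sub, map_smul, LinearMap.sub_apply, LinearMap.smul_apply]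
    rw [br_comm_odd hw.2 hv.2, ← ha, ← hb]
    have : a - (b + r) * b - (b + r) * (b - (b + r)) = 0 := by linear_combination hr
    rw [← zero_smul ℂ (L.br v v), ← this]
    module
  exact ⟨b + r, Subtype.ext (sub_eq_zero.mp h3).symm⟩

lemma notMem_oddRoots {α : Dual ℂ H} (hα : α ∈ L.evenRoots H) : α ∉ L.oddRoots H := fun h =>
  (evenRoots_structure hL hB hα).2.2
    (two_smul_mem_evenRoots hL hB h (pairing_self_ne_zero hL hB hα))

lemma eq_half_of_smul_mem_oddRoots {α : Dual ℂ H} (hα : α ∈ L.evenRoots H) {c : ℂ}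
    (hc : c • α ∈ L.oddRoots H) : c = 1 / 2 ∨ c = -1 / 2 := by
  have hc0 : c ≠ 0 := fun h => hc.1 (by rw [h, zero_smul])
  have h1 : L.pairing H B (c • α) (c • α) ≠ 0 := by
    rw [pairing_smul_left hB, pairing_smul_right hB]
    exact mul_ne_zero hc0 (mul_ne_zero hc0 (pairing_self_ne_zero hL hB hα))
  have h2 := two_smul_mem_evenRoots hL hB hc h1
  rw [smul_smul] at h2
  rcases eq_or_eq_neg_of_smul_mem_evenRoots hL hB hα h2 with h | h
  · left; linear_combination h / 2
  · right; linear_combination h / 2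

/-- Suppose there are no even roots. Then odd roots are isotropic, since otherwise their doubles
would be even roots. For root vectors $x,y$ of $\pm\beta$ and $z$ of $\gamma\ne\pm\beta$ one has
$[x,z]=[y,z]=0$, hence $(\beta,\gamma)=0$. So $h_\beta$ is killed by all weights and vanishes, which
is absurd; there are no roots at all. Then `H` and the even part are zero, and so is the bracket.
This is needed for $r=s$: without even roots every numerator would be 1. -/
lemma evenRoots_nonempty : (L.evenRoots H).Nonempty := by
  by_contra hne
  have hbot : ∀ γ : Dual ℂ H, γ ≠ 0 → L.rootPart H γ 0 = ⊥ := fun γ hγ => by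
    by_contra h
    exact hne ⟨γ, hγ, h⟩
  have hodd : ∀ β : Dual ℂ H, β ∉ L.oddRoots H := fun β hβ => by
    have hββ : L.pairing H B β β = 0 := by
      by_contra h
      exact hne ⟨_, two_smul_mem_evenRoots hL hB hβ h⟩
    obtain ⟨x, hx, hx0⟩ := Submodule.exists_mem_ne_zero_of_ne_bot hβ.2
    obtain ⟨y, hy, hy1⟩ := hB.exists_dual_root_vector hL hx hx0
    refine dualVector_ne_zero hB hβ.1 (eq_zero_of_forall_weight hL.simple hL.reductive _ ?_)
    intro γ hγ
    by_cases hγ0 : γ = 0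
    · rw [hγ0, LinearMap.zero_apply]
    obtain ⟨z, hz, hz0⟩ : ∃ z ∈ L.rootPart H γ 1, z ≠ 0 := by
      refine Submodule.exists_mem_ne_zero_of_ne_bot fun h => hγ ?_
      rw [rootSpace_eq_sup, hbot γ hγ0, h, sup_bot_eq]
    rw [← pairing_eq hB]
    by_cases h1 : β + γ = 0
    · have : γ = (-1 : ℂ) • β := by rw [neg_smul, one_smul]; exact eq_neg_of_add_eq_zero_right h1
      rw [this, pairing_smul_left hB, hββ, mul_zero]
    by_cases h2 : -β + γ = 0
    · have : γ = β := by rw [neg_add_eq_zero] at h2; exact h2.symm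
      rw [this, hββ]
    have h3 : L.br x z = 0 := by
      have := br_mem_rootPart hx hz
      rwa [CharTwo.add_self_eq_zero, hbot _ h1, Submodule.mem_bot] at this
    have h4 : L.br y z = 0 := by
      have := br_mem_rootPart hy hz
      rwa [CharTwo.add_self_eq_zero, hbot _ h2, Submodule.mem_bot] at this
    have h5 := jacobi_odd hx.2 hy.2 z
    rw [h3, h4, map_zero, map_zero, sub_zero, br_opposite hL hB hx hy, hy1, one_smul, hz.1,
      ← pairing_eq hB] at h5
    exact (smul_eq_zero.mp h5.symm).resolve_right hz0
  have hzero : ∀ γ : Dual ℂ H, γ ≠ 0 → L.rootSpace H γ = ⊥ := fun γ hγ => by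
    by_contra h
    exact (mem_roots_iff.mp ⟨hγ, h⟩).elim (fun h => hne ⟨γ, h⟩) (hodd γ)
  have hH : ∀ t : H, t = 0 := fun t =>
    eq_zero_of_forall_weight hL.simple hL.reductive t fun ψ hψ => by
      have : ψ = 0 := by
        by_contra h
        exact hψ (hzero ψ h)
      rw [this, LinearMap.zero_apply]
  have htop : L.rootSpace H 0 = ⊤ := by
    rw [eq_top_iff, ← iSup_rootSpace (H := H) hL hB]
    refine iSup_le fun ψ => ?_
    by_cases h : ψ = 0
    · rw [h]
    · rw [hzero ψ h]; exact bot_le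
  have heven : ∀ x ∈ L.part 0, x = 0 := fun x hx => by
    obtain ⟨t, rfl⟩ := exists_cartan_of_mem_rootPart_zero (H := H) (x := x)
      ⟨htop ▸ Submodule.mem_top, hx⟩
    rw [hH t]; rfl
  obtain ⟨a, b, hab⟩ := hL.simple.1
  obtain ⟨a₀, ha₀, a₁, ha₁, rfl⟩ := L.exists_even_add_odd a
  obtain ⟨b₀, hb₀, b₁, hb₁, rfl⟩ := L.exists_even_add_odd b
  refine hab ?_
  rw [heven a₀ ha₀, heven b₀ hb₀, zero_add, zero_add]
  exact heven _ (by simpa [CharTwo.add_self_eq_zero] using L.br_mem ha₁ hb₁)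

end OddRoots

/-! ### The even roots as a reduced crystallographic root pairing -/

section RootPairing

variable [FiniteDimensional ℂ g] {H : LieSubalgebra ℂ L.Even} [H.IsCartanSubalgebra]
variable {B : LinearMap.BilinForm ℂ g} (hL : L.IsBasicClassical) (hB : L.IsInvariantForm B)

include hL hB in
lemma dualVector_sub_smul (α β : Dual ℂ H) (c : ℂ) :
    L.dualVector H B (β - c • α) = L.dualVector H B β - c • L.dualVector H B α := by
  symm
  refine eq_dualVector hB fun h => ?_
  change cartanForm H B (L.dualVector H B β - c • L.dualVector H B α) h = _
  rw [map_sub, map_smul, LinearMap.sub_apply, LinearMap.smul_apply, cartanForm_apply,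
    cartanForm_apply, dualVector_spec hB, dualVector_spec hB, LinearMap.sub_apply,
    LinearMap.smul_apply]

include hL hB in
lemma pairing_reflection {α : Dual ℂ H} (hα : α ∈ L.evenRoots H) (β γ : Dual ℂ H) :
    L.pairing H B (β - β (L.corootVector H B α) • α) (γ - γ (L.corootVector H B α) • α) =
      L.pairing H B β γ := by
  have h0 := pairing_self_ne_zero hL hB hα
  rw [apply_corootVector hB, apply_corootVector hB, sub_eq_add_neg, sub_eq_add_neg, ← neg_smul,
    ← neg_smul]
  simp only [pairing_add_left hB, pairing_add_right hB, pairing_smul_left hB,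
    pairing_smul_right hB]
  rw [pairing_comm hB α γ]
  field_simp
  ring

include hL hB in
lemma corootVector_reflection {α : Dual ℂ H} (hα : α ∈ L.evenRoots H) (β : Dual ℂ H) :
    L.corootVector H B (β - β (L.corootVector H B α) • α) =
      L.corootVector H B β - α (L.corootVector H B β) • L.corootVector H B α := by
  have h0 := pairing_self_ne_zero hL hB hα
  unfold corootVector
  rw [show L.pairing H B (β - β ((2 / L.pairing H B α α) • L.dualVector H B α) • α)
    (β - β ((2 / L.pairing H B α α) • L.dualVector H B α) • α) = L.pairing H B β β from
    pairing_reflection hL hB hα β β, dualVector_sub_smul hL hB, map_smul, map_smul, smul_sub,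
    smul_smul, smul_smul, ← pairing_eq hB, ← pairing_eq hB, pairing_comm hB α β]
  congr 2
  simp only [smul_eq_mul]
  ring

include hL hB in
lemma corootVector_injOn : Set.InjOn (L.corootVector H B) (L.evenRoots H) := by
  intro α hα β hβ h
  have hα0 := pairing_self_ne_zero hL hB hα
  have hβ0 := pairing_self_ne_zero hL hB hβ
  have hform : ∀ γ : Dual ℂ H, cartanForm H B (L.dualVector H B γ) = γ := fun γ =>
    LinearMap.ext fun t => dualVector_spec hB γ t
  have h1 := congrArg (cartanForm H B) h
  rw [corootVector, corootVector, map_smul, map_smul, hform, hform] at h1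
  have h2 : α = (L.pairing H B α α / L.pairing H B β β) • β := by
    have := congrArg (fun γ : Dual ℂ H => (L.pairing H B α α / 2) • γ) h1
    simp only [smul_smul] at this
    rw [show L.pairing H B α α / 2 * (2 / L.pairing H B α α) = 1 by field_simp, one_smul] at this
    refine this.trans ?_
    congr 1
    field_simp
  have h3 := congrArg β h
  rw [apply_corootVector_self hL hB hβ] at h3
  have hc0 : L.pairing H B α α / L.pairing H B β β ≠ 0 := div_ne_zero hα0 hβ0
  generalize L.pairing H B α α / L.pairing H B β β = c at h2 hc0
  rw [h2, corootVector_smul_eq hc0 β hB, apply_corootVector_self hL hB hβ] at h3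
  have : c = 1 := by field_simp at h3; exact h3.symm
  rw [h2, this, one_smul]

variable (L H) in
lemma finite_evenRoots : (L.evenRoots H).Finite :=
  (L.finite_roots H).subset fun _ h => mem_roots_iff.mpr (Or.inl h)

variable (L H) in
instance instFiniteEvenRoots : Finite (L.evenRoots H) := (L.finite_evenRoots H).to_subtype

/-- The root system of the even part, as a root pairing between `H^*` and `H`. -/
def evenRootPairing : RootPairing (L.evenRoots H) ℂ (Dual ℂ H) H :=
  RootPairing.mk' (LinearMap.id : Dual ℂ H →ₗ[ℂ] Dual ℂ H) ⟨Subtype.val, Subtype.val_injective⟩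
    ⟨fun α => L.corootVector H B α, fun α β h =>
      Subtype.ext (corootVector_injOn hL hB α.2 β.2 h)⟩
    (fun α => apply_corootVector_self hL hB α.2)
    (by
      rintro α - ⟨β, rfl⟩
      exact ⟨⟨_, reflection_mem_evenRoots hL hB α.2 β.2⟩, rfl⟩)
    (by
      rintro α - ⟨β, rfl⟩
      exact ⟨⟨_, reflection_mem_evenRoots hL hB α.2 β.2⟩,
        corootVector_reflection hL hB α.2 β⟩)

lemma evenRootPairing_root (α : L.evenRoots H) : (evenRootPairing hL hB).root α = α := rfl

lemma evenRootPairing_pairing (α β : L.evenRoots H) :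
    (evenRootPairing hL hB).pairing α β = (α : Dual ℂ H) (L.corootVector H B β) := rfl

lemma evenRootPairing_reflection (α : L.evenRoots H) (ν : Dual ℂ H) :
    (evenRootPairing hL hB).reflection α ν = ν - ν (L.corootVector H B α) • (α : Dual ℂ H) := rfl

instance instIsCrystallographic : (evenRootPairing (H := H) hL hB).IsCrystallographic :=
  ⟨fun α β => by
    obtain ⟨n, hn, -⟩ := exists_int_string hL hB β.2 α.2.2
    exact ⟨n, by simpa [evenRootPairing_pairing] using hn.symm⟩⟩

instance instIsReduced : (evenRootPairing (H := H) hL hB).IsReduced :=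
  ⟨fun α β hli => by
    have hli' : ¬ LinearIndependent ℂ ![(α : Dual ℂ H), (β : Dual ℂ H)] := hli
    rw [LinearIndependent.pair_iff' α.2.1, not_forall_not] at hli'
    obtain ⟨c, hc⟩ := hli'
    rw [evenRootPairing_root, evenRootPairing_root, ← hc]
    rcases eq_or_eq_neg_of_smul_mem_evenRoots hL hB α.2 (hc ▸ β.2) with h | h
    · left; rw [h, one_smul]
    · right; rw [h, neg_smul, one_smul, neg_neg]⟩

end RootPairing

end LieSuperalgebra

namespace RootPairing

open IsAddIndecomposable

variable {ι M N : Type*} [Finite ι] [AddCommGroup M] [Module ℂ M] [AddCommGroup N] [Module ℂ N]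
  (P : RootPairing ι ℂ M N) [P.IsCrystallographic] [P.IsReduced]
  {f : M →+ ℝ} (hf : ∀ i, f (P.root i) ≠ 0)

/-! ### Positive and simple roots of a root pairing with a regular functional -/

section PositiveRoots

lemma map_root_reflectionPerm (f : M →+ ℝ) (i j : ι) :
    f (P.root (P.reflectionPerm i j)) = f (P.root j) - P.pairingIn ℤ j i * f (P.root i) := by
  rw [root_reflectionPerm, P.reflection_apply_root' ℤ, map_sub, map_zsmul, zsmul_eq_mul]

lemma map_root_reflectionPerm_self (f : M →+ ℝ) (i : ι) :
    f (P.root (P.reflectionPerm i i)) = -f (P.root i) := by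
  rw [root_reflectionPerm, reflection_apply_self, map_neg]

lemma wellFounded_map_root (f : M →+ ℝ) :
    WellFounded fun i j : ι => f (P.root i) < f (P.root j) :=
  haveI : IsTrans ι fun i j => f (P.root i) < f (P.root j) := ⟨fun _ _ _ => lt_trans⟩
  haveI : Std.Irrefl fun i j : ι => f (P.root i) < f (P.root j) := ⟨fun _ => lt_irrefl _⟩
  Finite.wellFounded_of_trans_of_irrefl _

lemma pos_of_mem_baseOf {i : ι} (hi : i ∈ baseOf P.root f) : 0 < f (P.root i) := hi.1

lemma root_ne_add_of_mem_baseOf {i j k : ι} (hi : i ∈ baseOf P.root f) (hj : 0 < f (P.root j))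
    (hk : 0 < f (P.root k)) : P.root i ≠ P.root j + P.root k := fun h =>
  (hi.2 j hj k hk h).elim (P.ne_zero j) (P.ne_zero k)

include hf in
lemma pos_sub_of_mem_baseOf {i j k : ι} (hi : i ∈ baseOf P.root f) (hj : 0 < f (P.root j))
    (hk : P.root k = P.root j - P.root i) : 0 < f (P.root k) := by
  rcases lt_or_gt_of_ne (hf k) with h | h
  · refine absurd ?_ (P.root_ne_add_of_mem_baseOf (k := P.reflectionPerm k k) hi hj
      (by rw [map_root_reflectionPerm_self]; linarith))
    rw [root_reflectionPerm, reflection_apply_self, hk]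
    abel
  · exact h

include hf in
/-- A simple reflection permutes the positive roots other than its own root. -/
lemma pos_reflectionPerm {i j : ι} (hi : i ∈ baseOf P.root f) (hj : 0 < f (P.root j))
    (hne : j ≠ i) : 0 < f (P.root (P.reflectionPerm i j)) := by
  induction j using (P.wellFounded_map_root f).induction with
  | h j ih =>
  -- If the pairing is not positive, the reflection adds a nonnegative multiple of $\alpha_i$.
  -- Otherwise $\alpha_j-\alpha_i$ is a smaller positive root, to which induction applies; if
  -- $s_i\alpha_j$ were negative, $\alpha_i=s_i(\alpha_j-\alpha_i)+(-s_i\alpha_j)$ would be a sum of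
  -- positive roots.
  rcases le_or_gt (P.pairingIn ℤ j i) 0 with hle | hgt
  · rw [map_root_reflectionPerm]
    have h1 : (P.pairingIn ℤ j i : ℝ) ≤ 0 := by exact_mod_cast hle
    nlinarith [P.pos_of_mem_baseOf hi]
  · obtain ⟨k, hk⟩ := P.root_sub_root_mem_of_pairingIn_pos hgt hne
    have hkpos := P.pos_sub_of_mem_baseOf hf hi hj hk
    have hki : k ≠ i := by
      rintro rfl
      have h2 : P.root j = 2 • P.root k := by rw [two_smul]; nth_rw 1 [hk]; abel
      have : IsReflexive ℂ M := .of_isPerfPair P.toLinearMap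
      have : IsAddTorsionFree M := .of_isTorsionFree ℂ M
      exact P.nsmul_notMem_range_root ⟨j, h2⟩
    have h3 := ih k (by rw [hk, map_sub]; linarith [P.pos_of_mem_baseOf hi]) hkpos hki
    have h4 : P.root (P.reflectionPerm i k) = P.root (P.reflectionPerm i j) + P.root i := by
      rw [root_reflectionPerm, root_reflectionPerm, hk, map_sub, reflection_apply_self,
        sub_neg_eq_add]
    rcases lt_or_gt_of_ne (hf (P.reflectionPerm i j)) with h | h
    · refine absurd ?_ (P.root_ne_add_of_mem_baseOf (j := P.reflectionPerm i k)
        (k := P.reflectionPerm (P.reflectionPerm i j) (P.reflectionPerm i j)) hi h3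
        (by rw [map_root_reflectionPerm_self]; linarith))
      rw [P.root_reflectionPerm (P.reflectionPerm i j), reflection_apply_self, h4]
      abel
    · exact h

include hf in
-- A positive root is a sum of simple roots. If no simple root had a positive value on its coroot,
-- then $2=\langle\alpha_j,\alpha_j^\vee\rangle\le0$.
lemma exists_mem_baseOf_pairing_pos {j : ι} (hj : 0 < f (P.root j)) :
    ∃ i ∈ baseOf P.root f, 0 < P.pairingIn ℤ i j := by
  by_contra! hcon
  have hmem : P.root j ∈ AddSubmonoid.closure (P.root '' baseOf P.root f) := by
    rw [AddSubmonoid.closure_image_isAddIndecomposable_baseOf]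
    exact AddSubmonoid.subset_closure ⟨j, hj, rfl⟩
  have key : ∃ z : ℤ, z ≤ 0 ∧ P.coroot' j (P.root j) = z := by
    refine AddSubmonoid.closure_induction (motive := fun x _ => ∃ z : ℤ, z ≤ 0 ∧ P.coroot' j x = z)
      ?_ ⟨0, le_rfl, by simp⟩ ?_ hmem
    · rintro - ⟨i, hi, rfl⟩
      exact ⟨P.pairingIn ℤ i j, hcon i hi, by
        rw [root_coroot'_eq_pairing, ← P.algebraMap_pairingIn ℤ]; rfl⟩
    · rintro x y - - ⟨a, ha, ha'⟩ ⟨b, hb, hb'⟩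
      exact ⟨a + b, by omega, by rw [map_add, ha', hb']; push_cast; rfl⟩
  obtain ⟨z, hz, hz'⟩ := key
  rw [root_coroot'_eq_pairing, pairing_same] at hz'
  have : (2 : ℤ) = z := by exact_mod_cast hz'
  omega

include hf in
/-- Every positive root is obtained from simple ones by simple reflections that increase it. -/
lemma pos_induction {p : ι → Prop} (hbase : ∀ i ∈ baseOf P.root f, p i)
    (hstep : ∀ i ∈ baseOf P.root f, ∀ j, 0 < f (P.root j) → P.pairingIn ℤ i j < 0 → p j →
      p (P.reflectionPerm i j)) {j : ι} (hj : 0 < f (P.root j)) : p j := by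
  induction j using (P.wellFounded_map_root f).induction with
  | h j ih =>
  obtain ⟨i, hi, hij⟩ := P.exists_mem_baseOf_pairing_pos hf hj
  by_cases h : j = i
  · exact h ▸ hbase i hi
  · have h1 := P.pos_reflectionPerm hf hi hj h
    have h2 : f (P.root (P.reflectionPerm i j)) < f (P.root j) := by
      rw [map_root_reflectionPerm]
      have h3 : (0 : ℝ) < P.pairingIn ℤ j i := by
        exact_mod_cast (P.zero_lt_pairingIn_iff' ℤ).mp hij
      nlinarith [P.pos_of_mem_baseOf hi]
    have h4 := hstep i hi (P.reflectionPerm i j) h1 (by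
      rw [P.pairingIn_reflectionPerm ℤ, P.pairingIn_reflectionPerm_self_left ℤ]; omega) (ih _ h2 h1)
    rwa [reflectionPerm_self] at h4

end PositiveRoots

/-! ### The reflection group: words, exchange, finiteness, determinant -/

section ReflectionGroup

/-- The group generated by the reflections in a set of roots. -/
def reflectionSubgroup (s : Set ι) : Subgroup (M ≃ₗ[ℂ] M) :=
  Subgroup.closure (P.reflection '' s)

omit [Finite ι] [P.IsCrystallographic] [P.IsReduced] in
lemma reflection_mem_reflectionSubgroup {s : Set ι} {i : ι} (hi : i ∈ s) :
    P.reflection i ∈ P.reflectionSubgroup s := Subgroup.subset_closure ⟨i, hi, rfl⟩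

omit [Finite ι] [P.IsCrystallographic] [P.IsReduced] in
lemma reflectionSubgroup_mono {s t : Set ι} (h : s ⊆ t) :
    P.reflectionSubgroup s ≤ P.reflectionSubgroup t :=
  Subgroup.closure_mono (Set.image_mono h)

omit [Finite ι] [P.IsCrystallographic] [P.IsReduced] in
lemma reflectionSubgroup_induction {s : Set ι} {p : (M ≃ₗ[ℂ] M) → Prop} (h1 : p 1)
    (hmul : ∀ i ∈ s, ∀ w ∈ P.reflectionSubgroup s, p w → p (P.reflection i * w))
    {w : M ≃ₗ[ℂ] M} (hw : w ∈ P.reflectionSubgroup s) : p w := by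
  induction hw using Subgroup.closure_induction_left with
  | one => exact h1
  | mul_left x hx y hy ih =>
    obtain ⟨i, hi, rfl⟩ := hx
    exact hmul i hi y hy ih
  | inv_mul_cancel x hx y hy ih =>
    obtain ⟨i, hi, rfl⟩ := hx
    rw [reflection_inv]
    exact hmul i hi y hy ih

omit [Finite ι] [P.IsCrystallographic] [P.IsReduced] in
lemma exists_root_eq_of_mem {s : Set ι} {w : M ≃ₗ[ℂ] M} (hw : w ∈ P.reflectionSubgroup s) (j : ι) :
    ∃ k, w (P.root j) = P.root k ∧ P.reflection k * w = w * P.reflection j ∧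
      ∀ x, P.coroot' k (w x) = P.coroot' j x := by
  refine P.reflectionSubgroup_induction (p := fun w => ∃ k, w (P.root j) = P.root k ∧
    P.reflection k * w = w * P.reflection j ∧ ∀ x, P.coroot' k (w x) = P.coroot' j x)
    ⟨j, rfl, by simp, fun x => rfl⟩ (fun i hi w hw ih => ?_) hw
  · obtain ⟨k, hk1, hk2, hk3⟩ := ih
    refine ⟨P.reflectionPerm i k, ?_, ?_, fun x => ?_⟩
    · rw [root_reflectionPerm, LinearEquiv.mul_apply, hk1]
    · rw [reflection_reflectionPerm]
      have : P.reflection i * P.reflection i = 1 := by rw [← sq, reflection_sq]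
      calc P.reflection i * P.reflection k * P.reflection i * (P.reflection i * w)
          = P.reflection i * P.reflection k * (P.reflection i * P.reflection i) * w := by
            simp only [mul_assoc]
        _ = P.reflection i * w * P.reflection j := by
            rw [this, mul_one, mul_assoc, hk2, mul_assoc]
    · rw [LinearEquiv.mul_apply, coroot'_reflection, reflectionPerm_self, hk3]

include hf in
-- By `pos_induction` the reflection in a positive root is a conjugate of a simple one by simple
-- reflections, and opposite roots have the same reflection.
lemma reflectionSubgroup_univ :
    P.reflectionSubgroup Set.univ = P.reflectionSubgroup (baseOf P.root f) := by
  refine le_antisymm ((Subgroup.closure_le _).mpr ?_) (P.reflectionSubgroup_mono (Set.subset_univ _))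
  have hpos : ∀ j, 0 < f (P.root j) → P.reflection j ∈ P.reflectionSubgroup (baseOf P.root f) := by
    intro j hj
    refine P.pos_induction hf (p := fun j => P.reflection j ∈
      P.reflectionSubgroup (baseOf P.root f)) (fun i hi => P.reflection_mem_reflectionSubgroup hi)
      (fun i hi j hj hij ih => ?_) hj
    · rw [reflection_reflectionPerm]
      have := P.reflection_mem_reflectionSubgroup hi
      exact mul_mem (mul_mem this ih) this
  rintro - ⟨j, -, rfl⟩
  rcases lt_or_gt_of_ne (hf j) with h | h
  · have h1 := hpos (P.reflectionPerm j j) (by rw [map_root_reflectionPerm_self]; linarith)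
    have : P.reflection j * P.reflection j = 1 := by rw [← sq, reflection_sq]
    rwa [reflection_reflectionPerm, this, one_mul] at h1
  · exact hpos j h

omit [Finite ι] [P.IsCrystallographic] [P.IsReduced] in
lemma exists_list_of_mem {s : Set ι} {w : M ≃ₗ[ℂ] M} (hw : w ∈ P.reflectionSubgroup s) :
    ∃ l : List ι, (∀ i ∈ l, i ∈ s) ∧ (l.map P.reflection).prod = w := by
  refine P.reflectionSubgroup_induction (p := fun w => ∃ l : List ι, (∀ i ∈ l, i ∈ s) ∧
    (l.map P.reflection).prod = w) ⟨[], by simp, by simp⟩ (fun i hi w hw ih => ?_) hw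
  · obtain ⟨l, hl, rfl⟩ := ih
    exact ⟨i :: l, by simpa using ⟨hi, hl⟩, by simp⟩

omit [Finite ι] [P.IsCrystallographic] [P.IsReduced] in
lemma list_prod_mem {s : Set ι} {l : List ι} (hl : ∀ i ∈ l, i ∈ s) :
    (l.map P.reflection).prod ∈ P.reflectionSubgroup s := by
  refine Subgroup.list_prod_mem _ fun w hw => ?_
  obtain ⟨i, hi, rfl⟩ := List.mem_map.mp hw
  exact P.reflection_mem_reflectionSubgroup (hl i hi)

include hf in
/-- The exchange property. -/
lemma exists_shorter_list {l : List ι} (hl : ∀ i ∈ l, i ∈ baseOf P.root f) {j : ι}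
    (hj : j ∈ baseOf P.root f) (hneg : f ((l.map P.reflection).prod (P.root j)) < 0) :
    ∃ l' : List ι, (∀ i ∈ l', i ∈ baseOf P.root f) ∧ l'.length < l.length ∧
      (l.map P.reflection).prod * P.reflection j = (l'.map P.reflection).prod := by
  induction l with
  | nil =>
    have := P.pos_of_mem_baseOf hj
    simp only [List.map_nil, List.prod_nil] at hneg
    exact absurd hneg (not_lt.mpr this.le)
  | cons i l ih =>
    have hl' : ∀ i ∈ l, i ∈ baseOf P.root f := fun k hk => hl k (List.mem_cons_of_mem _ hk)
    have hi : i ∈ baseOf P.root f := hl i List.mem_cons_self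
    obtain ⟨k, hk1, hk2, -⟩ := P.exists_root_eq_of_mem (P.list_prod_mem hl') j
    rw [hk1] at ih
    rcases lt_or_gt_of_ne (hf k) with h | h
    · obtain ⟨l', h1, h2, h3⟩ := ih hl' h
      refine ⟨i :: l', by simpa using ⟨hi, h1⟩, by simpa using h2, ?_⟩
      rw [List.map_cons, List.prod_cons, mul_assoc, h3, List.map_cons, List.prod_cons]
    -- A positive root made negative by $s_i$ must be $\alpha_i$; then $s_i$ cancels against $s_j$
    -- moved through the word.
    · have hki : k = i := by
        by_contra hne
        have := P.pos_reflectionPerm hf hi h hne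
        rw [List.map_cons, List.prod_cons, LinearEquiv.mul_apply, hk1,
          ← root_reflectionPerm] at hneg
        linarith
      subst hki
      refine ⟨l, hl', by simp, ?_⟩
      have : P.reflection k * P.reflection k = 1 := by rw [← sq, reflection_sq]
      rw [List.map_cons, List.prod_cons, mul_assoc, ← hk2, ← mul_assoc, this, one_mul]

include hf in
-- In a shortest word $ts_j$ for $w\neq1$, positivity of $w\alpha_j=-t\alpha_j$ means that $t$ makes
-- $\alpha_j$ negative, and the exchange property yields a shorter word.
lemma eq_one_of_forall_pos {w : M ≃ₗ[ℂ] M} (hw : w ∈ P.reflectionSubgroup (baseOf P.root f))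
    (hpos : ∀ i ∈ baseOf P.root f, 0 < f (w (P.root i))) : w = 1 := by
  classical
  have hex : ∃ n : ℕ, ∃ l : List ι, l.length = n ∧ (∀ i ∈ l, i ∈ baseOf P.root f) ∧
      (l.map P.reflection).prod = w := by
    obtain ⟨l, h1, h2⟩ := P.exists_list_of_mem hw
    exact ⟨_, l, rfl, h1, h2⟩
  obtain ⟨l, hlen, hl, hlw⟩ := Nat.find_spec hex
  rcases List.eq_nil_or_concat l with rfl | ⟨t, j, rfl⟩
  · simpa using hlw.symm
  · exfalso
    simp only [List.concat_eq_append] at hlen hl hlw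
    have hj : j ∈ baseOf P.root f := hl j (by simp)
    have ht : ∀ i ∈ t, i ∈ baseOf P.root f := fun i hi => hl i (by simp [hi])
    rw [List.map_append, List.prod_append, List.map_singleton, List.prod_singleton] at hlw
    have h1 := hpos j hj
    rw [← hlw, LinearEquiv.mul_apply, reflection_apply_self, map_neg, map_neg] at h1
    obtain ⟨l', h2, h3, h4⟩ := P.exists_shorter_list hf ht hj (by linarith)
    have h5 := Nat.find_min' hex ⟨l', rfl, h2, h4 ▸ hlw⟩
    rw [List.length_append, List.length_singleton] at hlen
    omega

include hf in
-- An element is determined by its permutation of the roots. The roots need not span the space, so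
-- this is derived from `eq_one_of_forall_pos`.
lemma finite_reflectionSubgroup : Finite (P.reflectionSubgroup (Set.univ : Set ι)) := by
  choose F hF using fun w : P.reflectionSubgroup (Set.univ : Set ι) =>
    P.exists_root_eq_of_mem w.2
  refine Finite.of_injective F fun w w' h => ?_
  have hroot : ∀ j, w.1 (P.root j) = w'.1 (P.root j) := fun j => by
    rw [(hF w j).1, (hF w' j).1, h]
  have h1 : (w'⁻¹ * w : P.reflectionSubgroup (Set.univ : Set ι)).1 = 1 := by
    refine P.eq_one_of_forall_pos hf (P.reflectionSubgroup_univ hf ▸ (w'⁻¹ * w).2) fun i hi => ?_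
    have : (w'⁻¹ * w).1 (P.root i) = P.root i := by
      change w'.1⁻¹ (w.1 (P.root i)) = _
      rw [hroot]
      exact w'.1.symm_apply_apply _
    rw [this]
    exact P.pos_of_mem_baseOf hi
  have h2 : w'⁻¹ * w = 1 := Subtype.ext h1
  exact (inv_mul_eq_one.mp h2).symm

omit [Finite ι] [P.IsCrystallographic] [P.IsReduced] in
lemma det_reflection [FiniteDimensional ℂ M] (i : ι) :
    LinearMap.det (P.reflection i : M →ₗ[ℂ] M) = -1 := by
  have : (P.reflection i : M →ₗ[ℂ] M) = LinearMap.transvection (P.coroot' i) (-P.root i) := by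
    ext x
    rw [LinearMap.transvection.apply, LinearEquiv.coe_coe, reflection_apply, smul_neg, sub_eq_add_neg]
  rw [this, LinearMap.transvection.det, map_neg, root_coroot'_eq_pairing, pairing_same]
  norm_num

end ReflectionGroup

end RootPairing

namespace MvPowerSeries

open _root_.Finset

/-! ### Power series with restricted coefficients -/

section CoeffIn

variable {σ K : Type*} [Field K]

/-- The coefficients of `φ` lie in the given family of subsets. -/
def CoeffIn (c : (σ →₀ ℕ) → AddSubmonoid K) (φ : MvPowerSeries σ K) : Prop :=
  ∀ n, coeff n φ ∈ c n

variable {c : (σ →₀ ℕ) → AddSubmonoid K} (hc : ∀ i j, ∀ a ∈ c i, ∀ b ∈ c j, a * b ∈ c (i + j))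
  {φ ψ : MvPowerSeries σ K}

lemma CoeffIn.add (hφ : CoeffIn c φ) (hψ : CoeffIn c ψ) : CoeffIn c (φ + ψ) := fun n => by
  rw [map_add]; exact add_mem (hφ n) (hψ n)

include hc in
lemma CoeffIn.mul (hφ : CoeffIn c φ) (hψ : CoeffIn c ψ) : CoeffIn c (φ * ψ) := fun n => by
  classical
  rw [coeff_mul]
  refine sum_mem fun p hp => ?_
  rw [← HasAntidiagonal.mem_antidiagonal.mp hp]
  exact hc _ _ _ (hφ _) _ (hψ _)

include hc in
-- As `ζ` has no constant term, the equation determines each coefficient of `φ` from those at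
-- smaller exponents. It is used both for nonnegativity and for conditions on the support.
lemma CoeffIn.of_eq_add_mul {ω ζ : MvPowerSeries σ K} (hω : CoeffIn c ω) (hζ : CoeffIn c ζ)
    (hζ0 : coeff 0 ζ = 0) (h : φ = ω + ζ * φ) : CoeffIn c φ := by
  classical
  intro n
  induction n using WellFoundedLT.induction with
  | ind n ih =>
  rw [h, map_add, coeff_mul]
  refine add_mem (hω n) (sum_mem fun p hp => ?_)
  rw [HasAntidiagonal.mem_antidiagonal] at hp
  by_cases h0 : p.1 = 0
  · rw [h0, hζ0, zero_mul]; exact zero_mem _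
  · have hlt : p.2 < n := by
      rw [← hp]
      exact lt_add_of_pos_left _ (pos_of_ne_zero h0)
    have := hc _ _ _ (hζ p.1) _ (ih _ hlt)
    rwa [hp] at this

end CoeffIn

/-! ### Independence series of a graph and their quotients -/

section Independence

variable {σ K : Type*} [Field K] [DecidableEq σ] (G : SimpleGraph σ) (m : σ → ℕ)

/-- The exponent of the product of the variables `X_i ^ m_i`, `i ∈ s`. -/
def supportExponent (s : Finset σ) : σ →₀ ℕ := ∑ i ∈ s, Finsupp.single i (m i)

lemma supportExponent_apply (s : Finset σ) (i : σ) :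
    supportExponent m s i = if i ∈ s then m i else 0 := by
  simp [supportExponent, Finsupp.finsetSum_apply, Finsupp.single_apply]

lemma supportExponent_insert {s : Finset σ} {u : σ} (hu : u ∉ s) :
    supportExponent m (insert u s) = Finsupp.single u (m u) + supportExponent m s := by
  rw [supportExponent, sum_insert hu, supportExponent]

open Classical in
variable (K) in
/-- The independence polynomial of a set of vertices, in the variables `X_i ^ m_i`, with signs. -/
def indepSeries (s : Finset σ) : MvPowerSeries σ K :=
  ∑ t ∈ s.powerset, if (t : Set σ).Pairwise (fun i j => ¬ G.Adj i j) then
    monomial (supportExponent m t) ((-1 : K) ^ #t) else 0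

open Classical in
-- Independent subsets of $s\cup\{u\}$ either avoid $u$, or consist of $u$ and an independent set of
-- non-neighbours of $u$.
lemma indepSeries_insert {s : Finset σ} {u : σ} (hu : u ∉ s) :
    indepSeries K G m (insert u s) = indepSeries K G m s -
      monomial (Finsupp.single u (m u)) 1 * indepSeries K G m (s.filter fun i => ¬ G.Adj u i) := by
  have hpow : (s.filter fun i => ¬ G.Adj u i).powerset =
      s.powerset.filter fun t => ∀ b ∈ t, ¬ G.Adj u b := by
    ext t
    simp only [mem_powerset, mem_filter, Finset.subset_iff]
    exact ⟨fun h => ⟨fun _ hb => (h hb).1, fun _ hb => (h hb).2⟩, fun h _ hb => ⟨h.1 hb, h.2 _ hb⟩⟩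
  rw [indepSeries, sum_powerset_insert hu, sub_eq_add_neg, indepSeries, add_right_inj, indepSeries,
    hpow, sum_filter, mul_sum, ← sum_neg_distrib]
  refine sum_congr rfl fun t ht => ?_
  have hut : u ∉ t := fun h => hu (mem_powerset.mp ht h)
  have hiff : ((insert u t : Finset σ) : Set σ).Pairwise (fun i j => ¬ G.Adj i j) ↔
      (t : Set σ).Pairwise (fun i j => ¬ G.Adj i j) ∧ ∀ b ∈ t, ¬ G.Adj u b := by
    rw [coe_insert, Set.pairwise_insert_of_notMem (by simpa using hut)]
    simp only [G.adj_comm _ u, and_self, mem_coe]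
  by_cases h1 : (t : Set σ).Pairwise fun i j => ¬ G.Adj i j
  · by_cases h2 : ∀ b ∈ t, ¬ G.Adj u b
    · rw [if_pos (hiff.mpr ⟨h1, h2⟩), if_pos h2,
        if_pos h1, monomial_mul_monomial, one_mul, ← supportExponent_insert m hut,
        card_insert_of_notMem hut, pow_succ, mul_neg_one, map_neg]
    · rw [if_neg (fun h => h2 (hiff.mp h).2), if_neg h2]
      simp
  · rw [if_neg (fun h => h1 (hiff.mp h).1), if_neg h1]
    simp

lemma indepSeries_empty : indepSeries K G m ∅ = 1 := by
  simp [indepSeries, supportExponent]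

variable {m} (hm : ∀ i, 0 < m i)

include hm in
lemma coeff_zero_monomial_mul (u : σ) (φ : MvPowerSeries σ K) :
    coeff 0 (monomial (Finsupp.single u (m u)) 1 * φ) = 0 := by
  rw [coeff_monomial_mul, if_neg]
  intro h
  have := h u
  simp only [Finsupp.single_eq_same, Finsupp.coe_zero, Pi.zero_apply] at this
  exact absurd (hm u) (by omega)

include hm in
lemma coeff_zero_indepSeries (s : Finset σ) : coeff 0 (indepSeries K G m s) = 1 := by
  classical
  induction s using Finset.induction_on with
  | empty => rw [indepSeries_empty]; exact coeff_zero_one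
  | insert u s hu ih =>
    rw [indepSeries_insert G m hu, map_sub, ih, coeff_zero_monomial_mul hm, sub_zero]

include hm in
lemma indepSeries_mul_inv (s : Finset σ) :
    indepSeries K G m s * (indepSeries K G m s)⁻¹ = 1 := by
  refine MvPowerSeries.mul_inv_cancel _ ?_
  rw [← coeff_zero_eq_constantCoeff_apply, coeff_zero_indepSeries G hm]
  exact one_ne_zero

variable (K m) in
/-- The quotient of the independence series of `s \ t` by that of `s`. -/
def indepRatio (s t : Finset σ) : MvPowerSeries σ K :=
  indepSeries K G m (s \ t) * (indepSeries K G m s)⁻¹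

include hm in
lemma indepRatio_union (s t t' : Finset σ) :
    indepRatio K G m s (t ∪ t') = indepRatio K G m s t * indepRatio K G m (s \ t) t' := by
  rw [indepRatio, indepRatio, indepRatio, sdiff_sdiff_left, sup_eq_union]
  calc _ = indepSeries K G m (s \ (t ∪ t')) * (indepSeries K G m s)⁻¹ * 1 := (mul_one _).symm
    _ = _ := by rw [← indepSeries_mul_inv G hm (s \ t)]; ring

include hm in
lemma indepRatio_of_disjoint {s t : Finset σ} (h : Disjoint s t) : indepRatio K G m s t = 1 := by
  rw [indepRatio, sdiff_eq_self_of_disjoint h, indepSeries_mul_inv G hm]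

open Classical in
include hm in
-- This is `indepSeries_insert` divided by the independence series of `s`. It has the shape
-- $D=1+\zeta D$ with $\zeta(0)=0$, from which positivity is read off recursively.
lemma indepRatio_singleton {s : Finset σ} {u : σ} (hu : u ∈ s) :
    indepRatio K G m s {u} = 1 + (monomial (Finsupp.single u (m u)) 1 *
      indepRatio K G m (s.erase u) (s.filter (G.Adj u))) * indepRatio K G m s {u} := by
  have h1 := indepSeries_insert (K := K) G m (notMem_erase u s)
  rw [insert_erase hu] at h1
  have h2 : (s.erase u) \ (s.filter (G.Adj u)) = (s.erase u).filter fun i => ¬ G.Adj u i := by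
    ext i; simp only [mem_sdiff, mem_erase, mem_filter]; tauto
  have h3 := indepSeries_mul_inv (K := K) G hm s
  have h4 := indepSeries_mul_inv (K := K) G hm (s.erase u)
  rw [indepRatio, indepRatio, h2, sdiff_singleton_eq_erase]
  linear_combination h3 - (indepSeries K G m s)⁻¹ * h1 -
    (monomial (Finsupp.single u (m u)) 1 * (indepSeries K G m s)⁻¹ *
      indepSeries K G m ((s.erase u).filter fun i => ¬ G.Adj u i)) * h4

end Independence

/-! ### Nonnegativity of the quotients -/

section Positivity

variable {σ K : Type*} [Field K] [PartialOrder K] [IsStrictOrderedRing K]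

/-- All coefficients are nonnegative. -/
def NonnegCoeff (φ : MvPowerSeries σ K) : Prop := CoeffIn (fun _ => AddSubmonoid.nonneg K) φ

variable {φ ψ φ' ψ' : MvPowerSeries σ K}

lemma nonnegCoeff_iff : NonnegCoeff φ ↔ ∀ n, 0 ≤ coeff n φ := Iff.rfl

lemma NonnegCoeff.add (hφ : NonnegCoeff φ) (hψ : NonnegCoeff ψ) : NonnegCoeff (φ + ψ) :=
  CoeffIn.add hφ hψ

lemma NonnegCoeff.mul (hφ : NonnegCoeff φ) (hψ : NonnegCoeff ψ) : NonnegCoeff (φ * ψ) :=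
  CoeffIn.mul (fun _ _ _ ha _ hb => mul_nonneg ha hb) hφ hψ

lemma NonnegCoeff.of_eq_add_mul {ω ζ : MvPowerSeries σ K} (hω : NonnegCoeff ω)
    (hζ : NonnegCoeff ζ) (hζ0 : coeff 0 ζ = 0) (h : φ = ω + ζ * φ) : NonnegCoeff φ :=
  CoeffIn.of_eq_add_mul (fun _ _ _ ha _ hb => mul_nonneg ha hb) hω hζ hζ0 h

lemma nonnegCoeff_zero : NonnegCoeff (0 : MvPowerSeries σ K) := fun _ => le_rfl

lemma nonnegCoeff_monomial (n : σ →₀ ℕ) : NonnegCoeff (monomial n (1 : K)) := fun k => by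
  classical
  rw [coeff_monomial]
  split_ifs
  · exact zero_le_one
  · exact le_rfl

lemma nonnegCoeff_one : NonnegCoeff (1 : MvPowerSeries σ K) := nonnegCoeff_monomial 0

lemma NonnegCoeff.mul_sub_mul (h1 : NonnegCoeff (φ' - φ)) (h2 : NonnegCoeff (ψ' - ψ))
    (hφ : NonnegCoeff φ) (hψ : NonnegCoeff ψ') : NonnegCoeff (φ' * ψ' - φ * ψ) := by
  have : φ' * ψ' - φ * ψ = (φ' - φ) * ψ' + φ * (ψ' - ψ) := by ring
  rw [this]
  exact (h1.mul hψ).add (hφ.mul h2)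

lemma NonnegCoeff.trans (h1 : NonnegCoeff (ψ - φ)) (h2 : NonnegCoeff (φ' - ψ)) :
    NonnegCoeff (φ' - φ) := by
  simpa using h2.add h1

variable [DecidableEq σ] (G : SimpleGraph σ) {m : σ → ℕ} (hm : ∀ i, 0 < m i)

include hm in
-- In the language of Cartier and Foata the quotient counts heaps of vertices of `s` whose maximal
-- pieces lie in `t`, so it is nonnegative and grows with `s`. The two properties are proved
-- together by induction on `s`: first for singletons from `indepRatio_singleton`, then for all `t`
-- by multiplicativity.
lemma nonnegCoeff_indepRatio_aux (s : Finset σ) : ∀ t,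
    NonnegCoeff (indepRatio K G m s t) ∧
      ∀ x, NonnegCoeff (indepRatio K G m s t - indepRatio K G m (s.erase x) t) := by
  classical
  induction s using Finset.strongInduction with
  | H s ih =>
  have hone : ∀ u ∈ s, NonnegCoeff (indepRatio K G m s {u}) ∧
      ∀ x, NonnegCoeff (indepRatio K G m s {u} - indepRatio K G m (s.erase x) {u}) := by
    intro u hu
    have ihu := ih _ (erase_ssubset hu)
    have heq := indepRatio_singleton (K := K) G hm hu
    have hZ := (nonnegCoeff_monomial (K := K) (Finsupp.single u (m u))).mul
      (ihu (s.filter (G.Adj u))).1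
    have hR : NonnegCoeff (indepRatio K G m s {u}) :=
      NonnegCoeff.of_eq_add_mul nonnegCoeff_one hZ (coeff_zero_monomial_mul hm u _) heq
    refine ⟨hR, fun x => ?_⟩
    by_cases hxu : x = u
    · subst hxu
      rw [indepRatio_of_disjoint G hm (s := s.erase x) (by simp), heq, add_sub_cancel_left]
      exact hZ.mul hR
    by_cases hxs : x ∈ s
    swap
    · rw [erase_eq_of_notMem hxs, sub_self]; exact nonnegCoeff_zero
    have heq' := indepRatio_singleton (K := K) G hm (mem_erase.mpr ⟨fun h => hxu h.symm, hu⟩ :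
      u ∈ s.erase x)
    have hfil : indepRatio K G m ((s.erase x).erase u) ((s.erase x).filter (G.Adj u)) =
        indepRatio K G m ((s.erase u).erase x) (s.filter (G.Adj u)) := by
      rw [indepRatio, indepRatio, erase_right_comm]
      congr 2
      ext i; simp only [mem_sdiff, mem_erase, mem_filter]; tauto
    rw [hfil] at heq'
    set Y : MvPowerSeries σ K := monomial (Finsupp.single u (m u)) 1
    set A := indepRatio K G m (s.erase u) (s.filter (G.Adj u))
    set A' := indepRatio K G m ((s.erase u).erase x) (s.filter (G.Adj u))
    set D := indepRatio K G m s {u}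
    set D' := indepRatio K G m (s.erase x) {u}
    have hA' : NonnegCoeff A' := by
      by_cases hx : x ∈ s.erase u
      · exact (ih _ ((erase_ssubset hx).trans (erase_ssubset hu)) _).1
      · exact absurd (mem_erase.mpr ⟨hxu, hxs⟩) hx
    -- Subtracting the recursions $D=1+YAD$ and $D'=1+YA'D'$ gives $D-D'=Y(A-A')D+YA'(D-D')$.
    refine NonnegCoeff.of_eq_add_mul (ω := Y * (A - A') * D) (ζ := Y * A')
      (((nonnegCoeff_monomial _).mul ((ihu _).2 x)).mul hR)
      ((nonnegCoeff_monomial _).mul hA') (coeff_zero_monomial_mul hm u _) ?_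
    linear_combination heq - heq'
  intro t
  induction t using Finset.induction_on with
  | empty =>
    refine ⟨?_, fun x => ?_⟩
    · rw [indepRatio_of_disjoint G hm (disjoint_empty_right _)]; exact nonnegCoeff_one
    · rw [indepRatio_of_disjoint G hm (disjoint_empty_right _),
        indepRatio_of_disjoint G hm (disjoint_empty_right _), sub_self]
      exact nonnegCoeff_zero
  | insert u t hut iht =>
    by_cases hu : u ∈ s
    · have key : ∀ s' : Finset σ, indepRatio K G m s' (insert u t) =
          indepRatio K G m s' {u} * indepRatio K G m (s'.erase u) t := fun s' => by
        rw [insert_eq, indepRatio_union G hm, sdiff_singleton_eq_erase]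
      have ihu := ih _ (erase_ssubset hu) t
      refine ⟨by rw [key]; exact (hone u hu).1.mul ihu.1, fun x => ?_⟩
      rw [key, key, erase_right_comm]
      have hone' : NonnegCoeff (indepRatio K G m (s.erase x) {u}) := by
        by_cases hx : x ∈ s
        · exact (ih _ (erase_ssubset hx) {u}).1
        · rw [erase_eq_of_notMem hx]; exact (hone u hu).1
      exact NonnegCoeff.mul_sub_mul ((hone u hu).2 x) (ihu.2 x) hone' ihu.1
    · have key : ∀ s' : Finset σ, s' ⊆ s → indepRatio K G m s' (insert u t) =
          indepRatio K G m s' t := fun s' hs' => by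
        rw [indepRatio, indepRatio, sdiff_insert_of_notMem (fun h => hu (hs' h))]
      rw [key s le_rfl]
      exact ⟨iht.1, fun x => by rw [key _ (erase_subset _ _)]; exact iht.2 x⟩

include hm in
lemma nonnegCoeff_indepRatio (s t : Finset σ) : NonnegCoeff (indepRatio K G m s t) :=
  (nonnegCoeff_indepRatio_aux G hm s t).1

include hm in
lemma nonnegCoeff_indepRatio_sub_sdiff (s t r : Finset σ) :
    NonnegCoeff (indepRatio K G m s t - indepRatio K G m (s \ r) t) := by
  induction r using Finset.induction_on with
  | empty => rw [sdiff_empty, sub_self]; exact nonnegCoeff_zero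
  | insert x r hx ih =>
    rw [sdiff_insert]
    exact ((nonnegCoeff_indepRatio_aux G hm (s \ r) t).2 x).trans ih

include hm in
-- By multiplicativity the quotient for $t\cup t'$ is that of $t$ times the quotient of $t'$ in the
-- smaller set $s\setminus t$, which monotonicity bounds by the one in $s$.
lemma nonnegCoeff_indepRatio_mul_sub (s t t' : Finset σ) :
    NonnegCoeff (indepRatio K G m s t * indepRatio K G m s t' - indepRatio K G m s (t ∪ t')) := by
  rw [indepRatio_union G hm, ← mul_sub]
  exact (nonnegCoeff_indepRatio G hm s t).mul (nonnegCoeff_indepRatio_sub_sdiff G hm s t' t)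

include hm in
/-- If every component of `s` meets `t`, then the full monomial of `s` occurs in the ratio. -/
lemma coeff_indepRatio_pos (s : Finset σ) : ∀ t ⊆ s,
    (∀ a ⊆ s, a.Nonempty → Disjoint a t → ∃ i ∈ a, ∃ j ∈ s \ a, G.Adj i j) →
    0 < coeff (supportExponent m s) (indepRatio K G m s t) := by
  classical
  induction s using Finset.strongInduction with
  | H s ih =>
  intro t hts hreach
  by_cases hs : s = ∅
  · subst hs
    rw [indepRatio_of_disjoint G hm (disjoint_empty_left _), supportExponent, sum_empty,
      coeff_zero_one]
    exact zero_lt_one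
  obtain ⟨u, hu⟩ : t.Nonempty := by
    by_contra h
    rw [not_nonempty_iff_eq_empty] at h
    obtain ⟨i, -, j, hj, -⟩ := hreach s le_rfl (nonempty_iff_ne_empty.mpr hs)
      (h ▸ disjoint_empty_right _)
    simp at hj
  have hus := hts hu
  -- Removing $u$, the neighbours of $u$ join `t`. The hypothesis persists: a set avoiding $t$ and
  -- the neighbours of $u$ has an edge leaving it, and this edge cannot end at $u$.
  have hpos := ih (s.erase u) (erase_ssubset hus) ((s.filter (G.Adj u)) ∪ t.erase u) (by
    intro i hi
    rcases mem_union.mp hi with hi | hi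
    · rw [mem_filter] at hi
      exact mem_erase.mpr ⟨fun h => G.loopless.irrefl u (h ▸ hi.2), hi.1⟩
    · exact erase_subset_erase u hts hi) (by
    intro a ha hane hdis
    have hdis' : Disjoint a t := by
      rw [disjoint_left]
      intro i hia hit
      by_cases hiu : i = u
      · exact (mem_erase.mp (ha hia)).1 hiu
      · exact disjoint_left.mp hdis hia (mem_union_right _ (mem_erase.mpr ⟨hiu, hit⟩))
    obtain ⟨i, hi, j, hj, hij⟩ := hreach a (ha.trans (erase_subset _ _)) hane hdis'
    refine ⟨i, hi, j, ?_, hij⟩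
    rw [mem_sdiff] at hj ⊢
    refine ⟨mem_erase.mpr ⟨fun h => ?_, hj.1⟩, hj.2⟩
    exact disjoint_left.mp hdis hi (mem_union_left _ (mem_filter.mpr
      ⟨(mem_erase.mp (ha hi)).2, (h ▸ hij).symm⟩)))
  set Y : MvPowerSeries σ K := monomial (Finsupp.single u (m u)) 1
  set A := indepRatio K G m (s.erase u) (s.filter (G.Adj u))
  set D := indepRatio K G m s {u}
  set E := indepRatio K G m (s.erase u) (t.erase u)
  have hA : NonnegCoeff A := nonnegCoeff_indepRatio G hm _ _
  have hE : NonnegCoeff E := nonnegCoeff_indepRatio G hm _ _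
  have hD : NonnegCoeff D := nonnegCoeff_indepRatio G hm _ _
  have hY : NonnegCoeff Y := nonnegCoeff_monomial _
  have hDeq : D = 1 + (Y * A) * D := indepRatio_singleton G hm hus
  have h1 : indepRatio K G m s t = D * E := by
    have : t = {u} ∪ t.erase u := by rw [← insert_eq, insert_erase hu]
    conv_lhs => rw [this]
    rw [indepRatio_union G hm, sdiff_singleton_eq_erase]
  -- Iterating $D=1+YAD$ once gives $D=1+YA+YA\cdot YAD$, so $DE$ dominates $YAE$; and $AE$
  -- dominates the quotient to which induction was applied.
  have h2 : NonnegCoeff (D * E - Y * (A * E)) := by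
    have : D * E - Y * (A * E) = E + Y * A * (Y * A * D) * E := by
      linear_combination (E + Y * A * E) * hDeq
    rw [this]
    exact hE.add (((hY.mul hA).mul ((hY.mul hA).mul hD)).mul hE)
  have h3 : 0 < coeff (supportExponent m s) (Y * (A * E)) := by
    have : supportExponent m s = Finsupp.single u (m u) + supportExponent m (s.erase u) := by
      rw [← supportExponent_insert m (notMem_erase u s), insert_erase hus]
    rw [this, coeff_add_monomial_mul, one_mul]
    have h4 := nonnegCoeff_iff.mp (nonnegCoeff_indepRatio_mul_sub (K := K) G hm (s.erase u)
      (s.filter (G.Adj u)) (t.erase u)) (supportExponent m (s.erase u))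
    rw [map_sub, sub_nonneg] at h4
    exact hpos.trans_le h4
  have h5 := nonnegCoeff_iff.mp h2 (supportExponent m s)
  rw [map_sub, sub_nonneg] at h5
  rw [h1]
  exact h3.trans_le h5

end Positivity

/-! ### Logarithmic derivatives -/

section LogDerivative

variable {σ K : Type*} [Field K] (v : σ)

/-- The Euler operator `X_v ∂/∂X_v`. -/
def euler (φ : MvPowerSeries σ K) : MvPowerSeries σ K := fun n => (n v : K) * coeff n φ

lemma coeff_euler (φ : MvPowerSeries σ K) (n : σ →₀ ℕ) :
    coeff n (euler v φ) = (n v : K) * coeff n φ := rfl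

lemma euler_sub (φ ψ : MvPowerSeries σ K) : euler v (φ - ψ) = euler v φ - euler v ψ := by
  ext n; simp only [map_sub, coeff_euler, mul_sub]

lemma euler_one : euler v (1 : MvPowerSeries σ K) = 0 := by
  classical
  ext n
  rw [coeff_euler, coeff_one, map_zero]
  split_ifs with h
  · simp [h]
  · simp

lemma euler_mul (φ ψ : MvPowerSeries σ K) :
    euler v (φ * ψ) = euler v φ * ψ + φ * euler v ψ := by
  classical
  ext n
  simp only [map_add, coeff_euler, coeff_mul, mul_sum, ← sum_add_distrib]
  refine sum_congr rfl fun p hp => ?_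
  rw [← HasAntidiagonal.mem_antidiagonal.mp hp, Finsupp.add_apply, Nat.cast_add]
  ring

/-- The logarithmic derivative with respect to `euler v`. -/
def logEuler (φ : MvPowerSeries σ K) : MvPowerSeries σ K := euler v φ * φ⁻¹

lemma logEuler_mul {φ ψ : MvPowerSeries σ K} (hφ : coeff 0 φ = 1) (hψ : coeff 0 ψ = 1) :
    logEuler v (φ * ψ) = logEuler v φ + logEuler v ψ := by
  have h1 : φ * φ⁻¹ = 1 := MvPowerSeries.mul_inv_cancel _ (by
    rw [← coeff_zero_eq_constantCoeff_apply, hφ]; exact one_ne_zero)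
  have h2 : ψ * ψ⁻¹ = 1 := MvPowerSeries.mul_inv_cancel _ (by
    rw [← coeff_zero_eq_constantCoeff_apply, hψ]; exact one_ne_zero)
  rw [logEuler, logEuler, logEuler, euler_mul, MvPowerSeries.mul_inv_rev]
  linear_combination (euler v φ * φ⁻¹) * h2 + (euler v ψ * ψ⁻¹) * h1

lemma logEuler_multiset_prod (s : Multiset (MvPowerSeries σ K)) (hs : ∀ φ ∈ s, coeff 0 φ = 1) :
    coeff 0 s.prod = 1 ∧ logEuler v s.prod = (s.map (logEuler v)).sum := by
  induction s using Multiset.induction_on with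
  | empty => exact ⟨coeff_zero_one, by simp [logEuler, euler_one]⟩
  | cons φ s ih =>
    have h1 := hs φ (Multiset.mem_cons_self _ _)
    obtain ⟨h2, h3⟩ := ih fun ψ hψ => hs ψ (Multiset.mem_cons_of_mem hψ)
    rw [Multiset.prod_cons, Multiset.map_cons, Multiset.sum_cons, logEuler_mul v h1 h2, h3]
    refine ⟨?_, rfl⟩
    rw [coeff_zero_eq_constantCoeff_apply] at *
    rw [map_mul, h1, h2, one_mul]

end LogDerivative

/-! ### Adapted series and the uniqueness of their factors -/

section Adapted

variable {σ K : Type*} [Field K] [PartialOrder K] [IsStrictOrderedRing K] [DecidableEq σ] [Fintype σ]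
  (G : SimpleGraph σ) {m : σ → ℕ} (hm : ∀ i, 0 < m i)

/-- A series that agrees with the independence series of `G` up to the exponent `m`, and all of
whose exponents are either zero or at least `m` in each variable. -/
structure IsAdapted (m : σ → ℕ) (p : MvPowerSeries σ K) : Prop where
  gap : ∀ n, coeff n p ≠ 0 → ∀ i, n i = 0 ∨ m i ≤ n i
  coeff_eq : ∀ n : σ →₀ ℕ, (∀ i, n i ≤ m i) → coeff n p = coeff n (indepSeries K G m univ)

variable {G} {p : MvPowerSeries σ K}

include hm in
lemma IsAdapted.coeff_zero (hp : IsAdapted G m p) : coeff 0 p = 1 := by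
  rw [hp.coeff_eq 0 (fun i => Nat.zero_le _), coeff_zero_indepSeries G hm]

include hm in
lemma IsAdapted.mul_inv (hp : IsAdapted G m p) : p * p⁻¹ = 1 :=
  MvPowerSeries.mul_inv_cancel _ (by
    rw [← coeff_zero_eq_constantCoeff_apply, hp.coeff_zero hm]; exact one_ne_zero)

include hm in
-- The exponents whose entries are each $0$ or at least $m_i$ form a monoid. So the inverse of `p`,
-- and with it the logarithmic derivative, is supported on such exponents too.
lemma IsAdapted.le_of_coeff_logEuler_ne_zero (hp : IsAdapted G m p) (v : σ) {k : σ →₀ ℕ}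
    (hk : ∀ i, k i ≠ 0) (h : coeff k (logEuler v p) ≠ 0) (i : σ) : m i ≤ k i := by
  classical
  let c : (σ →₀ ℕ) → AddSubmonoid K := fun n => if ∀ i, n i = 0 ∨ m i ≤ n i then ⊤ else ⊥
  have hmem : ∀ n x, x ∈ c n ↔ (x ≠ 0 → ∀ i, n i = 0 ∨ m i ≤ n i) := fun n x => by
    simp only [c]
    split_ifs with h
    · simp [h]
    · rw [AddSubmonoid.mem_bot]; tauto
  have hc : ∀ i j, ∀ a ∈ c i, ∀ b ∈ c j, a * b ∈ c (i + j) := fun i j a ha b hb => by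
    rw [hmem] at ha hb ⊢
    intro hab l
    have h1 := ha (left_ne_zero_of_mul hab) l
    have h2 := hb (right_ne_zero_of_mul hab) l
    rw [Finsupp.add_apply]
    omega
  have hpc : CoeffIn c p := fun n => (hmem _ _).mpr (hp.gap n)
  have hone : CoeffIn c (1 : MvPowerSeries σ K) := fun n => (hmem _ _).mpr fun h i => by
    rw [coeff_one] at h
    have : n = 0 := by by_contra h0; simp [h0] at h
    simp [this]
  have hinv : CoeffIn c p⁻¹ := by
    refine CoeffIn.of_eq_add_mul hc hone (ζ := 1 - p) (fun n => (hmem _ _).mpr fun h => ?_) ?_ ?_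
    · rw [map_sub] at h
      by_cases h1 : coeff n p = 0
      · rw [h1, sub_zero] at h
        exact (hmem _ _).mp (hone n) h
      · exact hp.gap n h1
    · rw [map_sub, hp.coeff_zero hm, coeff_zero_one, sub_self]
    · linear_combination hp.mul_inv hm
  have heul : CoeffIn c (euler v p) := fun n => (hmem _ _).mpr fun h => by
    rw [coeff_euler] at h
    exact hp.gap n (right_ne_zero_of_mul h)
  exact ((hmem _ _).mp (CoeffIn.mul hc heul hinv k) h i).resolve_left (hk i)

omit [PartialOrder K] [IsStrictOrderedRing K] [Fintype σ] in
lemma apply_eq_zero_of_coeff_indepSeries_ne_zero {s : Finset σ} {v : σ} (hv : v ∉ s) {n : σ →₀ ℕ}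
    (h : coeff n (indepSeries K G m s) ≠ 0) : n v = 0 := by
  classical
  rw [indepSeries, map_sum] at h
  obtain ⟨t, ht, h⟩ := exists_ne_zero_of_sum_ne_zero h
  split_ifs at h with h1
  · have := eq_of_coeff_monomial_ne_zero h
    rw [this, supportExponent_apply, if_neg fun hvt => hv (mem_powerset.mp ht hvt)]
  · simp at h

open Classical in
omit [PartialOrder K] [IsStrictOrderedRing K] in
lemma euler_indepSeries (v : σ) : euler v (indepSeries K G m univ) =
    -((m v : K) • (monomial (Finsupp.single v (m v)) 1 *
      indepSeries K G m ((univ.erase v).filter fun i => ¬ G.Adj v i))) := by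
  have h1 := indepSeries_insert (K := K) G m (notMem_erase v univ)
  rw [insert_erase (mem_univ v)] at h1
  ext n
  rw [coeff_euler, h1, map_sub, mul_sub, map_neg, map_smul, smul_eq_mul]
  have h2 : (n v : K) * coeff n (indepSeries K G m (univ.erase v)) = 0 := by
    by_contra h
    have := apply_eq_zero_of_coeff_indepSeries_ne_zero (notMem_erase v univ)
      (right_ne_zero_of_mul h)
    rw [this] at h
    simp at h
  rw [h2, zero_sub, neg_inj, coeff_monomial_mul]
  split_ifs with h
  · rw [one_mul]
    by_cases h0 : coeff (n - Finsupp.single v (m v))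
        (indepSeries K G m ((univ.erase v).filter fun i => ¬ G.Adj v i)) = 0
    · rw [h0, mul_zero, mul_zero]
    · have h3 := apply_eq_zero_of_coeff_indepSeries_ne_zero (v := v) (by simp) h0
      have h4 := h v
      simp only [Finsupp.tsub_apply, Finsupp.single_eq_same] at h3 h4
      rw [show n v = m v by omega]
  · simp

include hm in
-- Up to sign the logarithmic derivative is $m_vX_v^{m_v}DA$, where $D$ is the quotient for removing
-- $v$ and $A$ the one for removing the neighbours of $v$ from the rest. Here $D-1$ and $A$ have
-- nonnegative coefficients, and `coeff_indepRatio_pos` applies to $A$ because, $G$ being connected,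
-- every component of $G-v$ contains a neighbour of $v$.
lemma coeff_logEuler_indepSeries_ne_zero (hG : G.Preconnected) (v : σ) :
    coeff (supportExponent m univ) (logEuler v (indepSeries K G m univ)) ≠ 0 := by
  classical
  have hexp : supportExponent m univ =
      Finsupp.single v (m v) + supportExponent m (univ.erase v) := by
    rw [← supportExponent_insert m (notMem_erase v univ), insert_erase (mem_univ v)]
  set A := indepRatio K G m (univ.erase v) (univ.filter (G.Adj v))
  set D := indepRatio K G m univ {v}
  have h1 : logEuler v (indepSeries K G m univ) =
      -((m v : K) • (monomial (Finsupp.single v (m v)) 1 * (D * A))) := by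
    have : D * A = indepSeries K G m ((univ.erase v).filter fun i => ¬ G.Adj v i) *
        (indepSeries K G m univ)⁻¹ := by
      have h2 := indepRatio_union (K := K) G hm univ {v} (univ.filter (G.Adj v))
      rw [sdiff_singleton_eq_erase] at h2
      rw [← h2, indepRatio]
      congr 2
      ext i
      simp only [mem_sdiff, mem_union, mem_singleton, mem_filter, mem_erase, mem_univ]
      tauto
    rw [logEuler, euler_indepSeries, this]
    simp only [neg_mul, smul_mul_assoc, mul_assoc]
  have hpos : 0 < coeff (supportExponent m (univ.erase v)) A := by
    refine coeff_indepRatio_pos G hm _ _ (fun i hi => ?_) fun a ha hane hdis => ?_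
    · rw [mem_filter] at hi
      exact mem_erase.mpr ⟨fun h => G.loopless.irrefl v (h ▸ hi.2), mem_univ _⟩
    · obtain ⟨i, hi⟩ := hane
      obtain ⟨w⟩ := hG i v
      obtain ⟨d, -, hd1, hd2⟩ := w.exists_boundary_dart (a : Set σ) (by simpa using hi)
        (by simpa using fun h => (mem_erase.mp (ha h)).1 rfl)
      refine ⟨d.fst, by simpa using hd1, d.snd, ?_, d.adj⟩
      rw [mem_sdiff]
      refine ⟨mem_erase.mpr ⟨fun h => ?_, mem_univ _⟩, by simpa using hd2⟩
      exact disjoint_left.mp hdis (by simpa using hd1)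
        (mem_filter.mpr ⟨mem_univ _, (h ▸ d.adj).symm⟩)
  have hDA : 0 < coeff (supportExponent m (univ.erase v)) (D * A) := by
    have hA : NonnegCoeff A := nonnegCoeff_indepRatio G hm _ _
    have h2 : NonnegCoeff (D * A - A) := by
      have h3 := (nonnegCoeff_indepRatio_aux (K := K) G hm univ {v}).2 v
      rw [indepRatio_of_disjoint G hm (s := univ.erase v) (by simp)] at h3
      have : D * A - A = (D - 1) * A := by ring
      rw [this]
      exact h3.mul hA
    have h4 := nonnegCoeff_iff.mp h2 (supportExponent m (univ.erase v))
    rw [map_sub, sub_nonneg] at h4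
    exact hpos.trans_le h4
  rw [h1, hexp, map_neg, map_smul, coeff_add_monomial_mul, one_mul, neg_ne_zero, smul_eq_mul]
  refine mul_ne_zero ?_ hDA.ne'
  exact Nat.cast_ne_zero.mpr (hm v).ne'

include hm in
-- Coefficients of the logarithmic derivative up to the exponent $m$ only involve coefficients of
-- `p` up to $m$, and there `p` agrees with the independence series.
lemma IsAdapted.coeff_logEuler_ne_zero (hp : IsAdapted G m p) (hG : G.Preconnected) (v : σ) :
    coeff (supportExponent m univ) (logEuler v p) ≠ 0 := by
  set I := indepSeries K G m univ
  set N := supportExponent m univ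
  have hI := indepSeries_mul_inv (K := K) G hm univ
  have hp' := hp.mul_inv hm
  have hvan : ∀ φ ψ : MvPowerSeries σ K, (∀ n ≤ N, coeff n φ = 0) →
      ∀ n ≤ N, coeff n (φ * ψ) = 0 := fun φ ψ h n hn => by
    rw [coeff_mul]
    refine sum_eq_zero fun q hq => ?_
    rw [h q.1, zero_mul]
    exact le_trans (le_iff_exists_add.mpr ⟨q.2, (HasAntidiagonal.mem_antidiagonal.mp hq).symm⟩) hn
  have h0 : ∀ n ≤ N, coeff n (p - I) = 0 := fun n hn => by
    rw [map_sub, hp.coeff_eq n (fun i => ?_), sub_self]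
    have := hn i
    simpa [N, supportExponent_apply] using this
  have h1 : ∀ n ≤ N, coeff n (euler v (p - I)) = 0 := fun n hn => by
    rw [coeff_euler, h0 n hn, mul_zero]
  have h2 : logEuler v p = logEuler v I + (euler v (p - I) * p⁻¹ +
      (p - I) * (-(euler v I * p⁻¹ * I⁻¹))) := by
    rw [euler_sub, logEuler, logEuler]
    linear_combination (euler v I * I⁻¹) * hp' - (euler v I * p⁻¹) * hI
  rw [h2, map_add, map_add, hvan _ _ h1 N le_rfl, hvan _ _ h0 N le_rfl, add_zero, add_zero]
  exact coeff_logEuler_indepSeries_ne_zero hm hG v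

/-- Products of series adapted to a connected graph determine the multiset of their factors. -/
theorem multiset_eq_of_prod_eq (hG : G.Preconnected) [Nonempty σ]
    (p : (σ → ℕ) → MvPowerSeries σ K) (S S' : Multiset (σ → ℕ))
    (hS : ∀ m ∈ S, (∀ i, 0 < m i) ∧ IsAdapted G m (p m))
    (hS' : ∀ m ∈ S', (∀ i, 0 < m i) ∧ IsAdapted G m (p m))
    (h : (S.map p).prod = (S'.map p).prod) : S = S' := by
  classical
  obtain ⟨v⟩ := ‹Nonempty σ›
  induction hcard : Multiset.card S + Multiset.card S' using Nat.strong_induction_on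
    generalizing S S' with
  | _ N ih =>
  by_cases hempty : S + S' = 0
  · rw [add_eq_zero] at hempty
    rw [hempty.1, hempty.2]
  obtain ⟨m₀, hm₀, hmin⟩ : ∃ m₀ ∈ S + S', ∀ m ∈ S + S', m ≤ m₀ → m = m₀ := by
    have hne : (S + S').toFinset.Nonempty := by
      rwa [nonempty_iff_ne_empty, ne_eq, Multiset.toFinset_eq_empty]
    obtain ⟨m₀, h1, h2⟩ := (S + S').toFinset.exists_minimal hne
    exact ⟨m₀, Multiset.mem_toFinset.mp h1, fun m hm hle =>
      le_antisymm hle (h2 (Multiset.mem_toFinset.mpr hm) hle)⟩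
  have hall : ∀ m ∈ S + S', (∀ i, 0 < m i) ∧ IsAdapted G m (p m) := fun m hm =>
    (Multiset.mem_add.mp hm).elim (hS m) (hS' m)
  obtain ⟨hpos, had⟩ := hall m₀ hm₀
  -- A factor with parameter $m$ contributes to the coefficient at $m_0$ only if $m\le m_0$, that is
  -- $m=m_0$ by minimality. The coefficient is the multiplicity of $m_0$ times a nonzero constant.
  have hcount : ∀ T : Multiset (σ → ℕ), T ≤ S + S' →
      coeff (supportExponent m₀ univ) (logEuler v (T.map p).prod) =
        T.count m₀ • coeff (supportExponent m₀ univ) (logEuler v (p m₀)) := fun T hT => by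
    rw [(logEuler_multiset_prod v (T.map p) ?_).2, Multiset.map_map, map_multiset_sum,
      Multiset.map_map]
    · refine Multiset.sum_map_eq_nsmul_single m₀ fun m hne hm => ?_
      by_contra hc
      have hmem := Multiset.mem_of_le hT hm
      have h2 := (hall m hmem).2.le_of_coeff_logEuler_ne_zero (hall m hmem).1 v
        (k := supportExponent m₀ univ) (fun i => by
          rw [supportExponent_apply, if_pos (mem_univ i)]; exact (hpos i).ne') hc
      refine hne (hmin m hmem fun i => ?_)
      simpa [supportExponent_apply] using h2 i
    · intro φ hφ
      obtain ⟨m, hm, rfl⟩ := Multiset.mem_map.mp hφ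
      have := hall m (Multiset.mem_of_le hT hm)
      exact this.2.coeff_zero this.1
  have hc := had.coeff_logEuler_ne_zero hpos hG v
  have heq : S.count m₀ = S'.count m₀ := by
    have h1 := hcount S (Multiset.le_add_right _ _)
    rw [h, hcount S' (Multiset.le_add_left _ _), nsmul_eq_mul, nsmul_eq_mul] at h1
    exact_mod_cast (mul_right_cancel₀ hc h1).symm
  have hcount_pos : 0 < (S + S').count m₀ := Multiset.count_pos.mpr hm₀
  rw [Multiset.count_add] at hcount_pos
  have h1 : m₀ ∈ S := Multiset.count_pos.mp (by omega)
  have h2 : m₀ ∈ S' := Multiset.count_pos.mp (by omega)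
  obtain ⟨T, rfl⟩ := Multiset.exists_cons_of_mem h1
  obtain ⟨T', rfl⟩ := Multiset.exists_cons_of_mem h2
  rw [Multiset.map_cons, Multiset.map_cons, Multiset.prod_cons, Multiset.prod_cons] at h
  have hp0 : p m₀ ≠ 0 := fun h0 => by
    have := had.coeff_zero hpos
    rw [h0] at this
    simp at this
  rw [ih (Multiset.card T + Multiset.card T') (by
    simp only [Multiset.card_cons] at hcard; omega) T T'
    (fun m hm => hS m (Multiset.mem_cons_of_mem hm))
    (fun m hm => hS' m (Multiset.mem_cons_of_mem hm)) (mul_left_cancel₀ hp0 h) rfl]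

end Adapted

end MvPowerSeries

lemma MvPowerSeries.coeff_indepSeries_supportExponent {σ K : Type*} [Field K] [DecidableEq σ]
    {G : SimpleGraph σ} {m : σ → ℕ} (hm : ∀ i, 0 < m i) {s t : Finset σ} (hts : t ⊆ s)
    (ht : (t : Set σ).Pairwise fun i j => ¬ G.Adj i j) :
    coeff (supportExponent m t) (indepSeries K G m s) = (-1) ^ t.card := by
  classical
  rw [indepSeries, map_sum, Finset.sum_eq_single t]
  · rw [if_pos ht, coeff_monomial_same]
  · intro t' _ hne
    split_ifs
    · refine coeff_monomial_ne (fun h => hne ?_) _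
      ext i
      have h1 := DFunLike.congr_fun h i
      rw [supportExponent_apply, supportExponent_apply] at h1
      have := hm i
      split_ifs at h1 <;> simp_all
    · simp
  · intro h
    exact absurd (Finset.mem_powerset.mpr hts) h

lemma MvPowerSeries.exists_of_coeff_indepSeries_ne_zero {σ K : Type*} [Field K] [DecidableEq σ]
    {G : SimpleGraph σ} {m : σ → ℕ} {s : Finset σ} {n : σ →₀ ℕ}
    (h : coeff n (indepSeries K G m s) ≠ 0) :
    ∃ t ⊆ s, (t : Set σ).Pairwise (fun i j => ¬ G.Adj i j) ∧ n = supportExponent m t := by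
  classical
  rw [indepSeries, map_sum] at h
  obtain ⟨t, ht, h⟩ := Finset.exists_ne_zero_of_sum_ne_zero h
  split_ifs at h with h1
  · exact ⟨t, Finset.mem_powerset.mp ht, h1, eq_of_coeff_monomial_ne_zero h⟩
  · simp at h

namespace RootPairing

open IsAddIndecomposable

variable {ι M N : Type*} [Finite ι] [AddCommGroup M] [Module ℂ M] [AddCommGroup N] [Module ℂ N]
  (P : RootPairing ι ℂ M N) [P.IsCrystallographic] [P.IsReduced]

/-! ### Exponents of the Weyl group orbit of a half-regular weight -/

section Exponents

variable (b : Set ι)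

/-- The weight `-½ ∑ n_i α_i`. -/
def halfSum : (b →₀ ℕ) →+ M :=
  Finsupp.liftAddHom fun i => multiplesHom M (-(1 / 2 : ℂ) • P.root i)

omit [Finite ι] [P.IsCrystallographic] [P.IsReduced]

lemma halfSum_single (i : b) (k : ℕ) :
    P.halfSum b (Finsupp.single i k) = -((k / 2 : ℂ) • P.root i) := by
  rw [halfSum, Finsupp.liftAddHom_apply_single, multiplesHom_apply, ← Nat.cast_smul_eq_nsmul ℂ,
    smul_smul, ← neg_smul]
  congr 1
  ring

lemma halfSum_injective (hb : LinearIndepOn ℝ P.root b) : Function.Injective (P.halfSum b) := by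
  have hval : ∀ n : b →₀ ℕ, P.halfSum b n =
      -(1 / 2 : ℂ) • Finsupp.linearCombination ℝ (fun i : b => P.root i)
        (n.mapRange (fun k : ℕ => (k : ℝ)) Nat.cast_zero) := fun n => by
    induction n using Finsupp.induction_linear with
    | zero => simp
    | add a c ha hc =>
      rw [map_add, ha, hc, Finsupp.mapRange_add (by simp), map_add, smul_add]
    | single i k =>
      rw [halfSum_single, Finsupp.mapRange_single, Finsupp.linearCombination_single,
        ← Complex.coe_smul, smul_smul, ← neg_smul]
      congr 1
      push_cast
      ring
  intro a c hac
  rw [hval, hval] at hac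
  have h1 := hb (smul_right_injective M (by norm_num : (-(1 / 2 : ℂ)) ≠ 0) hac)
  ext i
  have h2 := DFunLike.congr_fun h1 i
  simpa using h2

lemma coroot'_halfSum (n : b →₀ ℕ) (j : ι) :
    2 * P.coroot' j (P.halfSum b n) = -n.sum fun i k => (k : ℂ) * P.pairing i j := by
  induction n using Finsupp.induction_linear with
  | zero => simp
  | add a c ha hc =>
    rw [map_add, map_add, mul_add, ha, hc, Finsupp.sum_add_index' (by simp)
      (by intros; push_cast; ring), neg_add]
  | single i k =>
    rw [halfSum_single, map_neg, map_smul, root_coroot'_eq_pairing, Finsupp.sum_single_index (by simp),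
      smul_eq_mul]
    ring

end Exponents

section Levels

variable {f : M →+ ℝ} (hf : ∀ i, f (P.root i) ≠ 0)

/-- `2 ⟨Λ, α_i^∨⟩` as a natural number. -/
def level (Λ : M) (i : ι) : ℕ := ⌊(2 * P.coroot' i Λ).re⌋₊

/-- `2 ⟨Λ, α_i^∨⟩` is a positive integer for every simple root `α_i`. -/
def IsHalfRegular (b : Set ι) (Λ : M) : Prop := ∀ i ∈ b, ∃ k : ℕ, 0 < k ∧ 2 * P.coroot' i Λ = k

variable {P}

omit [Finite ι] [P.IsCrystallographic] [P.IsReduced] in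
lemma IsHalfRegular.level_spec {b : Set ι} {Λ : M} (hΛ : P.IsHalfRegular b Λ) {i : ι} (hi : i ∈ b) :
    0 < P.level Λ i ∧ 2 * P.coroot' i Λ = P.level Λ i := by
  obtain ⟨k, hk, h⟩ := hΛ i hi
  have : P.level Λ i = k := by
    rw [level, h]; simp
  rw [this]
  exact ⟨hk, h⟩

variable {Λ : M} (hΛ : P.IsHalfRegular (baseOf P.root f) Λ)

include hf hΛ in
-- In `pos_induction` the value on the coroot of $s_i\alpha_j$ is
-- $\langle\Lambda,\alpha_j^\vee\rangle-\langle\alpha_i,\alpha_j^\vee\rangle\langle\Lambda,\alpha_i^\vee\rangle$,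
-- and the middle pairing is negative.
lemma IsHalfRegular.pos {j : ι} (hj : 0 < f (P.root j)) :
    ∃ k : ℕ, 0 < k ∧ 2 * P.coroot' j Λ = k := by
  refine P.pos_induction hf (p := fun j => ∃ k : ℕ, 0 < k ∧ 2 * P.coroot' j Λ = k)
    (fun i hi => hΛ i hi) (fun i hi j hj hij ih => ?_) hj
  obtain ⟨k, hk, hk'⟩ := ih
  obtain ⟨l, hl, hl'⟩ := hΛ i hi
  obtain ⟨a, ha⟩ : ∃ a : ℕ, P.pairingIn ℤ i j = -a := ⟨(P.pairingIn ℤ i j).natAbs, by omega⟩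
  refine ⟨k + l * a, by omega, ?_⟩
  rw [← coroot'_reflection, reflection_apply, map_sub, map_smul, root_coroot'_eq_pairing,
    ← P.algebraMap_pairingIn ℤ, ha, smul_eq_mul]
  simp only [algebraMap_int_eq, Int.coe_castRingHom]
  push_cast
  linear_combination hk' + a * hl'

include hf hΛ in
/-- A nontrivial element of the Weyl group makes a regular dominant weight negative on some
simple coroot. -/
lemma IsHalfRegular.exists_descent {w : M ≃ₗ[ℂ] M}
    (hw : w ∈ P.reflectionSubgroup (baseOf P.root f)) (hne : w ≠ 1) :
    ∃ i ∈ baseOf P.root f, ∃ k : ℕ, 0 < k ∧ 2 * P.coroot' i (w Λ) = -k := by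
  by_contra! hcon
  -- The value of $w\Lambda$ on $\alpha_i^\vee$ is that of $\Lambda$ on the coroot of
  -- $w^{-1}\alpha_i$. Without a negative value $w^{-1}$ keeps all simple roots positive and is
  -- therefore trivial.
  refine hne (inv_eq_one.mp (P.eq_one_of_forall_pos hf (inv_mem hw) fun i hi => ?_))
  obtain ⟨k, hk1, -, hk3⟩ := P.exists_root_eq_of_mem (inv_mem hw) i
  have h1 : P.coroot' k Λ = P.coroot' i (w Λ) := by
    have := hk3 (w Λ)
    rwa [show w⁻¹ (w Λ) = Λ from w.symm_apply_apply Λ] at this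
  rw [hk1]
  rcases lt_or_gt_of_ne (hf k) with h | h
  · exfalso
    obtain ⟨l, hl, hl'⟩ := hΛ.pos hf (j := P.reflectionPerm k k)
      (by rw [map_root_reflectionPerm_self]; linarith)
    refine hcon i hi l hl ?_
    rw [← h1, ← hl', ← coroot'_reflection, reflection_apply, map_sub, map_smul,
      root_coroot'_eq_pairing, pairing_same, smul_eq_mul]
    ring
  · exact h

include hf hΛ in
lemma IsHalfRegular.eq_of_apply_eq {w w' : M ≃ₗ[ℂ] M}
    (hw : w ∈ P.reflectionSubgroup (baseOf P.root f))
    (hw' : w' ∈ P.reflectionSubgroup (baseOf P.root f)) (h : w Λ = w' Λ) : w = w' := by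
  by_contra hne
  have h1 : w'⁻¹ * w ≠ 1 := fun h => hne (inv_mul_eq_one.mp h).symm
  obtain ⟨i, hi, k, hk, hk'⟩ := hΛ.exists_descent hf (mul_mem (inv_mem hw') hw) h1
  obtain ⟨l, hl, hl'⟩ := hΛ i hi
  rw [LinearEquiv.mul_apply, h, show w'⁻¹ (w' Λ) = Λ from w'.symm_apply_apply Λ, hl'] at hk'
  have : (l : ℤ) = -(k : ℤ) := by exact_mod_cast hk'
  omega

variable (P) in
/-- The properties of the exponent `n` with `w Λ = Λ - ½ ∑ n_i α_i`. -/
structure IsExponent (b : Set ι) (Λ : M) (w : M ≃ₗ[ℂ] M) (n : b →₀ ℕ) : Prop where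
  apply_eq : w Λ = Λ + P.halfSum b n
  gap : ∀ i, n i = 0 ∨ P.level Λ i ≤ n i
  indep : (∀ i, n i ≤ P.level Λ i) → ∀ i j : b, i ≠ j → n i ≠ 0 → n j ≠ 0 → P.pairing i j = 0
  mem : w ∈ P.reflectionSubgroup (Subtype.val '' {i | n i ≠ 0})

include hf hΛ in
-- One has $k=m_j-2n_j-\sum_{i\neq j}n_i\langle\alpha_i,\alpha_j^\vee\rangle$, where the sum is at
-- most zero. If $n_j=0$, the new entry $n_j+k$ is at least $m_j$; if $n_j\ge m_j$, it only grows.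
-- If the new exponent is at most $m$, then $n_j=0$ and $k=m_j$, so the sum vanishes and $\alpha_j$
-- is orthogonal to the support of $n$.
lemma IsExponent.reflection_mul {w : M ≃ₗ[ℂ] M} {n : baseOf P.root f →₀ ℕ}
    (hn : P.IsExponent (baseOf P.root f) Λ w n) (j : baseOf P.root f) {k : ℕ} (hk : 0 < k)
    (hkj : 2 * P.coroot' j (w Λ) = k) :
    P.IsExponent (baseOf P.root f) Λ (P.reflection j * w) (n + Finsupp.single j k) := by
  classical
  have : IsReflexive ℂ M := .of_isPerfPair P.toLinearMap
  obtain ⟨hm0, hm⟩ := hΛ.level_spec j.2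
  have hneg : ∀ i : baseOf P.root f, i ≠ j → P.pairingIn ℤ i j ≤ 0 := fun i hij =>
    P.baseOf_pairwise_pairing_le_zero f hf i.2 j.2 fun h => hij (Subtype.ext h)
  -- the relation between the new exponent and the old one
  have hsum : (k : ℤ) = P.level Λ j - 2 * n j -
      ∑ i ∈ n.support.erase j, (n i : ℤ) * P.pairingIn ℤ i j := by
    have h1 : (k : ℂ) = P.level Λ j - ∑ i ∈ n.support, (n i : ℂ) * P.pairing i j := by
      rw [← hkj, hn.apply_eq, map_add, mul_add, hm, coroot'_halfSum, Finsupp.sum, sub_eq_add_neg]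
    have h2 : ∑ i ∈ n.support, (n i : ℤ) * P.pairingIn ℤ i j =
        2 * n j + ∑ i ∈ n.support.erase j, (n i : ℤ) * P.pairingIn ℤ i j := by
      by_cases hj : j ∈ n.support
      · rw [← Finset.add_sum_erase _ _ hj, P.pairingIn_same]; ring
      · rw [Finset.erase_eq_of_notMem hj, Finsupp.notMem_support_iff.mp hj]; simp
    have h3 : (k : ℤ) = P.level Λ j - ∑ i ∈ n.support, (n i : ℤ) * P.pairingIn ℤ i j := by
      have : ∀ i : baseOf P.root f, P.pairing i j = ((P.pairingIn ℤ i j : ℤ) : ℂ) := fun i =>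
        (P.algebraMap_pairingIn ℤ _ _).symm
      simp only [this] at h1
      exact_mod_cast h1
    rw [h3, h2]; ring
  have hterm : ∀ i ∈ n.support.erase j, (n i : ℤ) * P.pairingIn ℤ i j ≤ 0 := fun i hi =>
    mul_nonpos_of_nonneg_of_nonpos (Int.natCast_nonneg _) (hneg i (Finset.mem_erase.mp hi).1)
  have hle := Finset.sum_nonpos hterm
  have happ : ∀ i, (n + Finsupp.single j k) i = n i + if j = i then k else 0 := fun i => by
    rw [Finsupp.add_apply, Finsupp.single_apply]
  refine ⟨?_, fun i => ?_, fun hbd i l hil hi hl => ?_, ?_⟩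
  · rw [LinearEquiv.mul_apply, reflection_apply, map_add, halfSum_single, ← add_assoc, ← hn.apply_eq,
      sub_eq_add_neg]
    congr 3
    linear_combination hkj / 2
  · rw [happ]
    have := hn.gap i
    split_ifs with h
    · subst h
      omega
    · simpa using this
  · have hbd' : ∀ i, n i ≤ P.level Λ i := fun i => le_trans (by rw [happ]; omega) (hbd i)
    have hnj : n j = 0 := by
      have h1 := hbd j
      rw [happ, if_pos rfl] at h1
      have := hn.gap j
      omega
    have hzero : ∀ i, i ≠ j → n i ≠ 0 → P.pairingIn ℤ i j = 0 := fun i hij hni => by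
      have h1 := hbd j
      rw [happ, if_pos rfl] at h1
      have h2 : ∑ i ∈ n.support.erase j, (n i : ℤ) * P.pairingIn ℤ i j = 0 := by omega
      have h3 := (Finset.sum_eq_zero_iff_of_nonpos hterm).mp h2 i
        (Finset.mem_erase.mpr ⟨hij, Finsupp.mem_support_iff.mpr hni⟩)
      exact (mul_eq_zero.mp h3).resolve_left (by exact_mod_cast hni)
    have hzero' : ∀ i, i ≠ j → n i ≠ 0 → P.pairing i j = 0 := fun i hij hni => by
      rw [← P.algebraMap_pairingIn ℤ, hzero i hij hni, map_zero]
    rw [happ] at hi hl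
    by_cases hij : i = j
    · subst hij
      rw [if_neg hil] at hl
      exact P.pairing_eq_zero_iff.mp (hzero' l (fun h => hil h.symm) (by simpa using hl))
    · rw [if_neg fun h => hij h.symm] at hi
      by_cases hlj : l = j
      · subst hlj
        exact hzero' i hij (by simpa using hi)
      · rw [if_neg fun h => hlj h.symm] at hl
        exact hn.indep hbd' i l hil (by simpa using hi) (by simpa using hl)
  · refine mul_mem (P.reflection_mem_reflectionSubgroup ⟨j, ?_, rfl⟩)
      (P.reflectionSubgroup_mono (Set.image_mono fun i hi => ?_) hn.mem)
    · have : (n + Finsupp.single j k) j = n j + k := by rw [happ, if_pos rfl]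
      rw [Set.mem_ofPred_eq, this]; omega
    · simp only [Set.mem_ofPred_eq, happ] at hi ⊢; omega

include hf hΛ in
-- Induction along the values of `f` on the finite orbit: by `exists_descent`, $w\neq1$ is $s_iw'$
-- with $w'\Lambda$ higher, and `IsExponent.reflection_mul` passes from $w'$ to $w$.
lemma IsHalfRegular.exists_isExponent {w : M ≃ₗ[ℂ] M}
    (hw : w ∈ P.reflectionSubgroup (baseOf P.root f)) :
    ∃ n, P.IsExponent (baseOf P.root f) Λ w n := by
  have hfin : Finite (P.reflectionSubgroup (baseOf P.root f)) := by
    rw [← P.reflectionSubgroup_univ hf]; exact P.finite_reflectionSubgroup hf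
  have hwf : WellFounded fun w w' : P.reflectionSubgroup (baseOf P.root f) =>
      f (w'.1 Λ) < f (w.1 Λ) :=
    haveI : IsTrans (P.reflectionSubgroup (baseOf P.root f)) fun w w' => f (w'.1 Λ) < f (w.1 Λ) :=
      ⟨fun _ _ _ h h' => lt_trans h' h⟩
    haveI : Std.Irrefl fun w w' : P.reflectionSubgroup (baseOf P.root f) =>
      f (w'.1 Λ) < f (w.1 Λ) := ⟨fun _ => lt_irrefl _⟩
    Finite.wellFounded_of_trans_of_irrefl _
  suffices H : ∀ w : P.reflectionSubgroup (baseOf P.root f),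
      ∃ n, P.IsExponent (baseOf P.root f) Λ w.1 n from H ⟨w, hw⟩
  intro w
  induction w using hwf.induction with
  | h w ih =>
  by_cases h1 : w.1 = 1
  · refine ⟨0, by rw [h1]; simp, fun i => Or.inl rfl, fun _ i j _ hi => absurd rfl hi, ?_⟩
    rw [h1]; exact one_mem _
  · obtain ⟨i, hi, k, hk, hk'⟩ := hΛ.exists_descent hf w.2 h1
    let w' : P.reflectionSubgroup (baseOf P.root f) :=
      ⟨P.reflection i * w.1, mul_mem (P.reflection_mem_reflectionSubgroup hi) w.2⟩
    have hw'Λ : w'.1 Λ = w.1 Λ + (k / 2 : ℂ) • P.root i := by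
      change P.reflection i (w.1 Λ) = _
      rw [reflection_apply, sub_eq_add_neg, ← neg_smul]
      congr 2
      linear_combination -hk' / 2
    have hlt : f (w.1 Λ) < f (w'.1 Λ) := by
      rw [hw'Λ, map_add]
      -- Since `f` is only additive, its value on the half-integral multiple is found by doubling.
      have h2 : f ((k / 2 : ℂ) • P.root i) + f ((k / 2 : ℂ) • P.root i) = k * f (P.root i) := by
        rw [← map_add, ← add_smul, add_halves, Nat.cast_smul_eq_nsmul, map_nsmul, nsmul_eq_mul]
      have h3 : 0 < (k : ℝ) * f (P.root i) :=
        mul_pos (by exact_mod_cast hk) (P.pos_of_mem_baseOf hi)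
      linarith
    obtain ⟨n, hn⟩ := ih w' hlt
    have hstep := hn.reflection_mul hf hΛ ⟨i, hi⟩ hk (by
      rw [hw'Λ, map_add, map_smul, root_coroot'_eq_pairing, pairing_same, smul_eq_mul]
      linear_combination hk')
    have hww : P.reflection i * w'.1 = w.1 := by
      change P.reflection i * (P.reflection i * w.1) = w.1
      rw [← mul_assoc, ← sq, reflection_sq, one_mul]
    rw [hww] at hstep
    exact ⟨_, hstep⟩

include hΛ in
-- The element is the product of the commuting reflections in `t`. It realizes each term of the
-- independence polynomial with the right sign.
lemma IsHalfRegular.exists_of_indep [FiniteDimensional ℂ M] (t : Finset (baseOf P.root f))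
    (ht : ∀ i ∈ t, ∀ j ∈ t, i ≠ j → P.pairing i j = 0) :
    ∃ w ∈ P.reflectionSubgroup (baseOf P.root f), LinearMap.det (w : M →ₗ[ℂ] M) = (-1) ^ t.card ∧
      w Λ = Λ + P.halfSum (baseOf P.root f) (∑ i ∈ t, Finsupp.single i (P.level Λ i)) := by
  classical
  induction t using Finset.induction_on with
  | empty => exact ⟨1, one_mem _, by simp, by simp⟩
  | insert j t hj ih =>
    obtain ⟨w, hw, hdet, hwΛ⟩ := ih fun i hi l hl => ht i (Finset.mem_insert_of_mem hi) l
      (Finset.mem_insert_of_mem hl)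
    refine ⟨P.reflection j * w, mul_mem (P.reflection_mem_reflectionSubgroup j.2) hw, ?_, ?_⟩
    · rw [Finset.card_insert_of_notMem hj, pow_succ, ← hdet, mul_comm, ← P.det_reflection j,
        ← LinearMap.det_comp]
      rfl
    · rw [Finset.sum_insert hj, map_add, halfSum_single, LinearEquiv.mul_apply, reflection_apply]
      have h1 : P.coroot' j (P.halfSum (baseOf P.root f)
          (∑ i ∈ t, Finsupp.single i (P.level Λ i))) = 0 := by
        rw [map_sum, map_sum]
        refine Finset.sum_eq_zero fun i hi => ?_
        rw [halfSum_single, map_neg, map_smul, root_coroot'_eq_pairing,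
          ht i (Finset.mem_insert_of_mem hi) j (Finset.mem_insert_self _ _)
            (fun h => hj (h ▸ hi)), smul_zero, neg_zero]
      have h2 : P.coroot' j (w Λ) = P.level Λ j / 2 := by
        rw [hwΛ, map_add, h1, add_zero]
        linear_combination (hΛ.level_spec j.2).2 / 2
      rw [h2, hwΛ]
      abel

omit [Finite ι] [P.IsCrystallographic] [P.IsReduced] in
lemma apply_eq_self_of_mem {s : Set ι} {w : M ≃ₗ[ℂ] M} (hw : w ∈ P.reflectionSubgroup s) {x : M}
    (hx : ∀ i ∈ s, P.coroot' i x = 0) : w x = x := by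
  refine P.reflectionSubgroup_induction (p := fun w => w x = x) rfl (fun i hi w _ ih => ?_) hw
  rw [LinearEquiv.mul_apply, ih, reflection_apply, hx i hi, zero_smul, sub_zero]

end Levels

end RootPairing

lemma Multiset.exists_equiv_of_map_univ_eq {κ κ' β : Type*} [Fintype κ] [Fintype κ'] {f : κ → β}
    {g : κ' → β} (h : Finset.univ.val.map f = Finset.univ.val.map g) :
    ∃ e : κ ≃ κ', ∀ x, f x = g (e x) := by
  classical
  have hcard : ∀ y, Fintype.card {x // f x = y} = Fintype.card {x // g x = y} := fun y => by
    have h1 := congrArg (Multiset.count y) h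
    rw [Multiset.count_map, Multiset.count_map] at h1
    rw [Fintype.card_subtype, Fintype.card_subtype, Finset.card_def, Finset.card_def,
      Finset.filter_val, Finset.filter_val]
    simpa only [eq_comm] using h1
  refine ⟨(Equiv.sigmaFiberEquiv f).symm.trans ((Equiv.sigmaCongrRight fun y =>
    Fintype.equivOfCardEq (hcard y)).trans (Equiv.sigmaFiberEquiv g)), fun x => ?_⟩
  exact (Fintype.equivOfCardEq (hcard (f x)) ⟨x, rfl⟩).2.symm

/-! ### Alternants as polynomials, and their restriction to a connected set of simple roots -/

namespace RootPairing

open IsAddIndecomposable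
open scoped ComplexOrder

variable {ι M N : Type*} [Finite ι] [AddCommGroup M] [Module ℂ M] [AddCommGroup N] [Module ℂ N]
  (P : RootPairing ι ℂ M N) [P.IsCrystallographic] [P.IsReduced] [FiniteDimensional ℂ M]

/-- The alternating sum of the `e^{wΛ - Λ}` over the group generated by all reflections. -/
def alternant (Λ : M) : AddMonoidAlgebra ℂ M :=
  ∑ᶠ w ∈ P.reflectionSubgroup Set.univ,
    AddMonoidAlgebra.single (w Λ - Λ) (LinearMap.det (w : M →ₗ[ℂ] M))

/-- The graph on a set of roots in which distinct nonorthogonal roots are joined. -/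
def nonorthogonalGraph (C : Set ι) : SimpleGraph C :=
  SimpleGraph.fromRel fun i j => P.pairing i j ≠ 0

open Classical in
/-- The coefficient of `e^{-½ ∑ n_i α_i}` in the alternant of `Λ`. -/
def alternantCoeff (b : Set ι) [Fintype (P.reflectionSubgroup b)] (Λ : M) (n : b →₀ ℕ) : ℂ :=
  ∑ w : P.reflectionSubgroup b,
    if w.1 Λ = Λ + P.halfSum b n then LinearMap.det (w.1 : M →ₗ[ℂ] M) else 0

variable {f : M →+ ℝ} (hf : ∀ i, f (P.root i) ≠ 0) (hb : LinearIndepOn ℝ P.root (baseOf P.root f))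
  [Fintype (P.reflectionSubgroup (baseOf P.root f))]

variable {P}

include hf hb in
-- The exponents of `exists_isExponent` write the alternant as the image of a polynomial under
-- $X_i\mapsto e^{-\alpha_i/2}$. As the simple roots are independent, this substitution is
-- injective, and identities of alternants can be moved to polynomials.
lemma IsHalfRegular.exists_polynomial {Λ : M} (hΛ : P.IsHalfRegular (baseOf P.root f) Λ) :
    ∃ u : MvPolynomial (baseOf P.root f) ℂ,
      AddMonoidAlgebra.mapDomainRingHom ℂ (P.halfSum (baseOf P.root f)) u = P.alternant Λ ∧
      ∀ n, u.coeff n = P.alternantCoeff (baseOf P.root f) Λ n := by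
  classical
  choose n hn using fun w : P.reflectionSubgroup (baseOf P.root f) =>
    hΛ.exists_isExponent hf w.2
  refine ⟨∑ w, MvPolynomial.monomial (n w) (LinearMap.det (w.1 : M →ₗ[ℂ] M)), ?_, fun k => ?_⟩
  · rw [map_sum, alternant, P.reflectionSubgroup_univ hf]
    refine Eq.trans ?_ (finsum_mem_eq_finite_toFinset_sum _
      (Set.toFinite (P.reflectionSubgroup (baseOf P.root f) : Set (M ≃ₗ[ℂ] M)))).symm
    refine (Finset.sum_bij' (fun w _ => w.1)
      (fun w hw => ⟨w, by simpa using hw⟩) (by simp) (by simp) (by simp) (by simp) ?_)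
    intro w _
    change AddMonoidAlgebra.mapDomain (P.halfSum (baseOf P.root f)) (AddMonoidAlgebra.single _ _) = _
    rw [AddMonoidAlgebra.mapDomain_single, (hn w).apply_eq, add_sub_cancel_left]
  · rw [MvPolynomial.coeff_sum, alternantCoeff]
    refine Finset.sum_congr rfl fun w _ => ?_
    rw [MvPolynomial.coeff_monomial, (hn w).apply_eq]
    simp only [add_right_inj, (P.halfSum_injective _ hb).eq_iff]

variable {C : Set ι} (hC : C ⊆ baseOf P.root f)

/-- The part of the alternant supported on the roots of `C`, as a power series. -/
def alternantSeries (Λ : M) : MvPowerSeries C ℂ := fun n =>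
  P.alternantCoeff (baseOf P.root f) Λ (n.mapDomain (Set.inclusion hC))

lemma coeff_alternantSeries (Λ : M) (n : C →₀ ℕ) : MvPowerSeries.coeff n (alternantSeries hC Λ) =
    P.alternantCoeff (baseOf P.root f) Λ (n.mapDomain (Set.inclusion hC)) := rfl

lemma mapDomain_inclusion_apply (n : C →₀ ℕ) (i : C) :
    n.mapDomain (Set.inclusion hC) (Set.inclusion hC i) = n i :=
  Finsupp.mapDomain_apply (Set.inclusion_injective hC) _ _

lemma mapDomain_inclusion_eq_zero (n : C →₀ ℕ) (i : baseOf P.root f) (hi : i.1 ∉ C) :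
    n.mapDomain (Set.inclusion hC) i = 0 :=
  Finsupp.mapDomain_of_notMem_range _ _ fun ⟨j, hj⟩ => hi (hj ▸ j.2)

include hf hb in
lemma IsHalfRegular.isExponent_of_apply_eq {Λ : M} (hΛ : P.IsHalfRegular (baseOf P.root f) Λ)
    {w : M ≃ₗ[ℂ] M} (hw : w ∈ P.reflectionSubgroup (baseOf P.root f)) {n : baseOf P.root f →₀ ℕ}
    (h : w Λ = Λ + P.halfSum (baseOf P.root f) n) : P.IsExponent (baseOf P.root f) Λ w n := by
  obtain ⟨n', hn'⟩ := hΛ.exists_isExponent hf hw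
  have := hn'.apply_eq
  rw [h, add_right_inj] at this
  rwa [P.halfSum_injective _ hb this]

include hf hb in
-- If the exponent of $w$ is supported in `C`, then $w$ is a product of reflections in `C` by
-- `IsExponent.mem`, and these fix $\Lambda-\Lambda'$.
lemma IsHalfRegular.apply_eq_congr {Λ Λ' : M} (hΛ : P.IsHalfRegular (baseOf P.root f) Λ)
    (hCΛ : ∀ i ∈ C, P.coroot' i Λ = P.coroot' i Λ') (n : C →₀ ℕ)
    {w : M ≃ₗ[ℂ] M} (hw : w ∈ P.reflectionSubgroup (baseOf P.root f))
    (h : w Λ = Λ + P.halfSum (baseOf P.root f) (n.mapDomain (Set.inclusion hC))) :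
    w Λ' = Λ' + P.halfSum (baseOf P.root f) (n.mapDomain (Set.inclusion hC)) := by
  have hmem := (hΛ.isExponent_of_apply_eq hf hb hw h).mem
  have hwC : w ∈ P.reflectionSubgroup C := P.reflectionSubgroup_mono (by
    rintro - ⟨i, hi, rfl⟩
    by_contra hiC
    exact hi (mapDomain_inclusion_eq_zero hC n i hiC)) hmem
  have h1 : w (Λ - Λ') = Λ - Λ' := apply_eq_self_of_mem hwC fun i hi => by
    rw [map_sub, hCΛ i hi, sub_self]
  rw [map_sub, h] at h1
  have : w Λ' = Λ + P.halfSum (baseOf P.root f) (n.mapDomain (Set.inclusion hC)) - (Λ - Λ') := by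
    rw [← h1]; abel
  rw [this]; abel

include hf hb in
lemma IsHalfRegular.alternantSeries_congr {Λ Λ' : M} (hΛ : P.IsHalfRegular (baseOf P.root f) Λ)
    (hΛ' : P.IsHalfRegular (baseOf P.root f) Λ')
    (hCΛ : ∀ i ∈ C, P.coroot' i Λ = P.coroot' i Λ') :
    alternantSeries hC Λ = alternantSeries hC Λ' := by
  classical
  ext n
  rw [coeff_alternantSeries, coeff_alternantSeries, alternantCoeff, alternantCoeff]
  refine Finset.sum_congr rfl fun w _ => ?_
  congr 1
  exact propext ⟨hΛ.apply_eq_congr hf hb hC hCΛ n w.2,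
    hΛ'.apply_eq_congr hf hb hC (fun i hi => (hCΛ i hi).symm) n w.2⟩

include hf hb in
-- An exponent bounded by the levels has pairwise orthogonal support and equals the level there.
-- Conversely each such exponent occurs by `exists_of_indep`, for exactly one $w$ because $\Lambda$
-- has trivial stabilizer, so nothing cancels.
lemma IsHalfRegular.isAdapted {Λ : M} (hΛ : P.IsHalfRegular (baseOf P.root f) Λ) [Fintype C]
    [DecidableEq C] :
    MvPowerSeries.IsAdapted (P.nonorthogonalGraph C) (fun i : C => P.level Λ i)
      (alternantSeries hC Λ) := by
  classical
  have : IsReflexive ℂ M := .of_isPerfPair P.toLinearMap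
  have hpos : ∀ i : C, 0 < P.level Λ i := fun i => (hΛ.level_spec (hC i.2)).1
  have hadj : ∀ i j : C, (P.nonorthogonalGraph C).Adj i j ↔ i ≠ j ∧ P.pairing i j ≠ 0 :=
    fun i j => by
      have h : P.pairing j i ≠ 0 ↔ P.pairing i j ≠ 0 := P.pairing_eq_zero_iff.not
      rw [nonorthogonalGraph, SimpleGraph.fromRel_adj, h, or_self]
  have hexists : ∀ n : C →₀ ℕ, MvPowerSeries.coeff n (alternantSeries hC Λ) ≠ 0 →
      ∃ w ∈ P.reflectionSubgroup (baseOf P.root f),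
        w Λ = Λ + P.halfSum (baseOf P.root f) (n.mapDomain (Set.inclusion hC)) := fun n h => by
    rw [coeff_alternantSeries, alternantCoeff] at h
    obtain ⟨w, -, hw⟩ := Finset.exists_ne_zero_of_sum_ne_zero h
    exact ⟨w.1, w.2, by by_contra h0; simp [h0] at hw⟩
  have hsupp : ∀ t : Finset C, (MvPowerSeries.supportExponent (fun i : C => P.level Λ i) t).mapDomain
      (Set.inclusion hC) = ∑ i ∈ t.image (Set.inclusion hC), Finsupp.single i (P.level Λ i) :=
    fun t => by
      rw [MvPowerSeries.supportExponent, Finsupp.mapDomain_finsetSum, Finset.sum_image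
        (fun a _ c _ h => Set.inclusion_injective hC h)]
      exact Finset.sum_congr rfl fun i _ => Finsupp.mapDomain_single
  have hindep : ∀ t : Finset C, (t : Set C).Pairwise (fun i j => ¬ (P.nonorthogonalGraph C).Adj i j) →
      MvPowerSeries.coeff (MvPowerSeries.supportExponent (fun i : C => P.level Λ i) t)
        (alternantSeries hC Λ) = (-1) ^ t.card := fun t ht => by
    obtain ⟨w, hw, hdet, hwΛ⟩ := hΛ.exists_of_indep (t.image (Set.inclusion hC)) (by
      intro i hi j hj hij
      obtain ⟨i, hit, rfl⟩ := Finset.mem_image.mp hi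
      obtain ⟨j, hjt, rfl⟩ := Finset.mem_image.mp hj
      have hij' : i ≠ j := fun h => hij (h ▸ rfl)
      have : ¬ (P.nonorthogonalGraph C).Adj i j := ht hit hjt hij'
      rw [hadj] at this
      by_contra h
      exact this ⟨hij', h⟩)
    rw [← hsupp] at hwΛ
    rw [coeff_alternantSeries, alternantCoeff, Finset.sum_eq_single ⟨w, hw⟩, if_pos hwΛ, hdet,
      Finset.card_image_of_injective _ (Set.inclusion_injective hC)]
    · intro w' _ hne
      refine if_neg fun h => hne (Subtype.ext ?_)
      exact hΛ.eq_of_apply_eq hf w'.2 hw (h.trans hwΛ.symm)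
    · intro h; exact absurd (Finset.mem_univ _) h
  refine ⟨fun n hn i => ?_, fun n hn => ?_⟩
  · obtain ⟨w, hw, h⟩ := hexists n hn
    have := (hΛ.isExponent_of_apply_eq hf hb hw h).gap (Set.inclusion hC i)
    rwa [mapDomain_inclusion_apply] at this
  · by_cases hex : ∃ t : Finset C, (t : Set C).Pairwise
        (fun i j => ¬ (P.nonorthogonalGraph C).Adj i j) ∧
        n = MvPowerSeries.supportExponent (fun i : C => P.level Λ i) t
    · obtain ⟨t, ht, rfl⟩ := hex
      rw [hindep t ht, MvPowerSeries.coeff_indepSeries_supportExponent hpos (Finset.subset_univ _) ht]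
    · have h1 : MvPowerSeries.coeff n (MvPowerSeries.indepSeries ℂ (P.nonorthogonalGraph C)
          (fun i : C => P.level Λ i) Finset.univ) = 0 := by
        by_contra h
        obtain ⟨t, -, ht, h2⟩ := MvPowerSeries.exists_of_coeff_indepSeries_ne_zero h
        exact hex ⟨t, ht, h2⟩
      rw [h1]
      by_contra h
      obtain ⟨w, hw, hwΛ⟩ := hexists n h
      have hexp := hΛ.isExponent_of_apply_eq hf hb hw hwΛ
      have hle : ∀ i, (n.mapDomain (Set.inclusion hC)) i ≤ P.level Λ i := fun i => by
        by_cases hi : i.1 ∈ C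
        · have := hn ⟨i, hi⟩
          rwa [← mapDomain_inclusion_apply hC] at this
        · rw [mapDomain_inclusion_eq_zero hC n i hi]; exact Nat.zero_le _
      refine hex ⟨n.support, fun i hi j hj hij => ?_, ?_⟩
      · change ¬ (P.nonorthogonalGraph C).Adj i j
        rw [hadj, not_and, not_not]
        intro _
        refine hexp.indep hle (Set.inclusion hC i) (Set.inclusion hC j)
          (fun h => hij (Set.inclusion_injective hC h)) ?_ ?_
        · rw [mapDomain_inclusion_apply]; simpa using hi
        · rw [mapDomain_inclusion_apply]; simpa using hj
      · ext i
        rw [MvPowerSeries.supportExponent_apply]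
        split_ifs with hi
        · have h2 := hexp.gap (Set.inclusion hC i)
          rw [mapDomain_inclusion_apply] at h2
          exact le_antisymm (hn i) (h2.resolve_left (Finsupp.mem_support_iff.mp hi))
        · exact Finsupp.notMem_support_iff.mp hi

include hf hb hC in
omit [Fintype (P.reflectionSubgroup (baseOf P.root f))] in
/-- Equality of products of alternants determines the levels on each connected set of simple
roots. -/
theorem exists_equiv_of_prod_alternant_eq [Nonempty C] (hconn : (P.nonorthogonalGraph C).Preconnected)
    {κ κ' : Type*} [Fintype κ] [Fintype κ'] (Λ : κ → M) (Λ' : κ' → M)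
    (hΛ : ∀ p, P.IsHalfRegular (baseOf P.root f) (Λ p))
    (hΛ' : ∀ q, P.IsHalfRegular (baseOf P.root f) (Λ' q))
    (h : ∏ p, P.alternant (Λ p) = ∏ q, P.alternant (Λ' q)) :
    ∃ e : κ ≃ κ', ∀ p, ∀ i ∈ C, P.coroot' i (Λ p) = P.coroot' i (Λ' (e p)) := by
  classical
  have hfin : Finite (P.reflectionSubgroup (baseOf P.root f)) := by
    rw [← P.reflectionSubgroup_univ hf]; exact P.finite_reflectionSubgroup hf
  have := Fintype.ofFinite (P.reflectionSubgroup (baseOf P.root f))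
  have := Fintype.ofFinite C
  choose u hu1 hu2 using fun p => (hΛ p).exists_polynomial hf hb
  choose u' hu1' hu2' using fun q => (hΛ' q).exists_polynomial hf hb
  have hprod : ∏ p, u p = ∏ q, u' q := by
    have hinj : Function.Injective
        (AddMonoidAlgebra.mapDomainRingHom ℂ (P.halfSum (baseOf P.root f))) :=
      AddMonoidAlgebra.mapDomain_injective (P.halfSum_injective _ hb)
    apply hinj
    rw [map_prod, map_prod]
    simpa only [hu1, hu1'] using h
  -- `killCompl` sets the variables outside `C` to zero; being a ring homomorphism, it carries the
  -- identity of products over.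
  have hseries : ∀ {Λ : M} {u : MvPolynomial (baseOf P.root f) ℂ},
      (∀ n, u.coeff n = P.alternantCoeff (baseOf P.root f) Λ n) →
      ((MvPolynomial.killCompl (Set.inclusion_injective hC) u : MvPolynomial C ℂ) :
        MvPowerSeries C ℂ) = alternantSeries hC Λ := fun {Λ u} hu => by
    ext n
    rw [MvPolynomial.coeff_coe, MvPolynomial.coeff_killCompl, hu, coeff_alternantSeries]
  have hprod' : ∏ p, alternantSeries hC (Λ p) = ∏ q, alternantSeries hC (Λ' q) := by
    have h1 := congrArg (fun v => ((MvPolynomial.killCompl (Set.inclusion_injective hC) v :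
      MvPolynomial C ℂ) : MvPowerSeries C ℂ)) hprod
    simp only [map_prod] at h1
    rw [← MvPolynomial.coeToMvPowerSeries.ringHom_apply, ← MvPolynomial.coeToMvPowerSeries.ringHom_apply,
      map_prod, map_prod] at h1
    simpa only [MvPolynomial.coeToMvPowerSeries.ringHom_apply, hseries (hu2 _), hseries (hu2' _)]
      using h1
  -- the series depends only on the levels
  let lev : M → C → ℕ := fun Λ i => P.level Λ i
  -- The uniqueness theorem wants a family indexed by level vectors. A representative weight is
  -- chosen for each vector that occurs; the value 1 at the others plays no role.
  let F : (C → ℕ) → MvPowerSeries C ℂ := fun m =>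
    if hm : ∃ Λ, P.IsHalfRegular (baseOf P.root f) Λ ∧ lev Λ = m then
      alternantSeries hC hm.choose else 1
  have hcoroot : ∀ {Λ Λ' : M}, P.IsHalfRegular (baseOf P.root f) Λ →
      P.IsHalfRegular (baseOf P.root f) Λ' → lev Λ = lev Λ' →
      ∀ i ∈ C, P.coroot' i Λ = P.coroot' i Λ' := fun {Λ Λ'} h1 h2 h i hi => by
    have e1 := (h1.level_spec (hC hi)).2
    have e2 := (h2.level_spec (hC hi)).2
    have e3 : P.level Λ i = P.level Λ' i := congrFun h ⟨i, hi⟩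
    rw [e3, ← e2] at e1
    exact mul_left_cancel₀ two_ne_zero e1
  have hF : ∀ {Λ : M}, P.IsHalfRegular (baseOf P.root f) Λ → F (lev Λ) = alternantSeries hC Λ :=
    fun {Λ} h => by
      have hex : ∃ Λ', P.IsHalfRegular (baseOf P.root f) Λ' ∧ lev Λ' = lev Λ := ⟨Λ, h, rfl⟩
      simp only [F]
      rw [dif_pos hex]
      exact hex.choose_spec.1.alternantSeries_congr hf hb hC h
        (hcoroot hex.choose_spec.1 h hex.choose_spec.2)
  have hadapt : ∀ {Λ : M}, P.IsHalfRegular (baseOf P.root f) Λ →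
      (∀ i, 0 < lev Λ i) ∧ MvPowerSeries.IsAdapted (P.nonorthogonalGraph C) (lev Λ) (F (lev Λ)) :=
    fun {Λ} h => ⟨fun i => (h.level_spec (hC i.2)).1, by rw [hF h]; exact h.isAdapted hf hb hC⟩
  have hmulti := MvPowerSeries.multiset_eq_of_prod_eq hconn F
    (Finset.univ.val.map fun p => lev (Λ p)) (Finset.univ.val.map fun q => lev (Λ' q))
    (by
      intro m hm
      obtain ⟨p, -, rfl⟩ := Multiset.mem_map.mp hm
      exact hadapt (hΛ p))
    (by
      intro m hm
      obtain ⟨p, -, rfl⟩ := Multiset.mem_map.mp hm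
      exact hadapt (hΛ' p))
    (by
      rw [Multiset.map_map, Multiset.map_map]
      simp only [Function.comp_def, hF (hΛ _), hF (hΛ' _)]
      exact hprod')
  obtain ⟨e, he⟩ := Multiset.exists_equiv_of_map_univ_eq hmulti
  exact ⟨e, fun p => hcoroot (hΛ p) (hΛ' (e p)) (he p)⟩

end RootPairing

namespace LieSuperalgebra

variable {g : Type*} [AddCommGroup g] [Module ℂ g] {L : LieSuperalgebra g}

/-! ### The supertrace identity -/

section Supertrace

variable [FiniteDimensional ℂ g] {H : LieSubalgebra ℂ L.Even} [H.IsCartanSubalgebra]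
variable {B : LinearMap.BilinForm ℂ g} (hL : L.IsBasicClassical) (hB : L.IsInvariantForm B)

variable (L H) in
/-- The sum of the root spaces of parity `i` over a finite set of weights. -/
def sumRootPart (Γ : Finset (Dual ℂ H)) (i : ZMod 2) : Submodule ℂ g :=
  ⨆ γ ∈ Γ, L.rootPart H γ i

variable (L H) in
/-- The superdimension of a root space. -/
def superdim (γ : Dual ℂ H) : ℂ :=
  finrank ℂ (L.rootPart H γ 0) - finrank ℂ (L.rootPart H γ 1)

lemma br_mem_sumRootPart {Γ : Finset (Dual ℂ H)} {δ : Dual ℂ H} {i j : ZMod 2} {a : g}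
    (ha : a ∈ L.rootPart H δ j) (hΓ : ∀ γ ∈ Γ, L.rootSpace H (δ + γ) = ⊥ ∨ δ + γ ∈ Γ) (x : g)
    (hx : x ∈ L.sumRootPart H Γ i) : L.br a x ∈ L.sumRootPart H Γ (j + i) := by
  have hle : L.sumRootPart H Γ i ≤ (L.sumRootPart H Γ (j + i)).comap (L.br a) := by
    refine iSup₂_le fun γ hγ x hx => ?_
    have h1 := br_mem_rootPart ha hx
    rcases hΓ γ hγ with h | h
    · have h2 : L.br a x ∈ (⊥ : Submodule ℂ g) := h ▸ h1.1
      rw [Submodule.mem_comap, (Submodule.mem_bot ℂ).mp h2]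
      exact zero_mem _
    · exact le_iSup₂ (f := fun γ (_ : γ ∈ Γ) => L.rootPart H γ (j + i)) (δ + γ) h h1
  exact hle hx

lemma trace_sumRootPart (Γ : Finset (Dual ℂ H)) (i : ZMod 2) (h : H)
    (hY : ∀ x ∈ L.sumRootPart H Γ i, L.br ((h : L.Even) : g) x ∈ L.sumRootPart H Γ i) :
    LinearMap.trace ℂ _ ((L.br ((h : L.Even) : g)).restrict hY) =
      ∑ γ ∈ Γ, (finrank ℂ (L.rootPart H γ i) : ℂ) * γ h := by
  classical
  refine trace_restrict_biSup_of_sub_nilpotent (N := fun γ => L.rootPart H γ i) Γ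
    ((L.iSupIndep_rootSpace H).mono fun _ => inf_le_left) _ (fun γ => γ h) (fun γ x hx => ?_)
    (fun γ => ⟨1, fun x hx => ?_⟩) _ rfl hY
  · rw [hx.1 h]; exact Submodule.smul_mem _ _ hx
  · simp [hx.1 h]

include hL hB in
/-- The supertrace of `h_δ` vanishes on a sum of root spaces stable under translation by `±δ`. -/
lemma sum_superdim_mul_pairing {δ : Dual ℂ H} {j : ZMod 2} (hδ : L.rootPart H δ j ≠ ⊥)
    {Γ : Finset (Dual ℂ H)} (h1 : ∀ γ ∈ Γ, L.rootSpace H (δ + γ) = ⊥ ∨ δ + γ ∈ Γ)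
    (h2 : ∀ γ ∈ Γ, L.rootSpace H (-δ + γ) = ⊥ ∨ -δ + γ ∈ Γ) :
    ∑ γ ∈ Γ, L.superdim H γ * L.pairing H B γ δ = 0 := by
  obtain ⟨a, ha, ha0⟩ := Submodule.exists_mem_ne_zero_of_ne_bot hδ
  obtain ⟨b, hb, hab⟩ := hB.exists_dual_root_vector hL ha ha0
  set t := L.dualVector H B δ with ht
  have hbr : L.br a b = ((t : L.Even) : g) := by rw [br_opposite hL hB ha hb, hab, one_smul]
  have hA : ∀ i, ∀ x ∈ L.sumRootPart H Γ i, L.br a x ∈ L.sumRootPart H Γ (j + i) :=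
    fun i => br_mem_sumRootPart ha h1
  have hB' : ∀ i, ∀ x ∈ L.sumRootPart H Γ i, L.br b x ∈ L.sumRootPart H Γ (j + i) :=
    fun i => br_mem_sumRootPart hb h2
  have hT : ∀ i, ∀ x ∈ L.sumRootPart H Γ i,
      L.br ((t : L.Even) : g) x ∈ L.sumRootPart H Γ i := fun i x hx => by
    have := br_mem_sumRootPart (coe_mem_rootPart_zero hL t) (Γ := Γ)
      (fun γ hγ => Or.inr (by rwa [zero_add])) x hx
    rwa [zero_add] at this
  have key : LinearMap.trace ℂ _ ((L.br ((t : L.Even) : g)).restrict (hT 0)) =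
      LinearMap.trace ℂ _ ((L.br ((t : L.Even) : g)).restrict (hT 1)) := by
    -- For even root vectors $h_\delta=ab-ba$ has trace zero on each parity. For odd ones
    -- $h_\delta=ab+ba$, and since $a$ and $b$ exchange the parities, the trace of $ab$ on one
    -- parity is the trace of $ba$ on the other.
    rcases zmod_two_eq_zero_or_one j with rfl | rfl
    · have hz : ∀ i, LinearMap.trace ℂ _ ((L.br ((t : L.Even) : g)).restrict (hT i)) = 0 :=
        fun i => by
        have hA' : ∀ x ∈ L.sumRootPart H Γ i, L.br a x ∈ L.sumRootPart H Γ i := fun x hx => by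
          simpa using hA i x hx
        have hB'' : ∀ x ∈ L.sumRootPart H Γ i, L.br b x ∈ L.sumRootPart H Γ i := fun x hx => by
          simpa using hB' i x hx
        rw [← trace_mul_sub_mul ((L.br a).restrict hA') ((L.br b).restrict hB'')]
        congr 1
        ext x
        have := leibniz_even ha.2 b x
        rw [hbr] at this
        change L.br ((t : L.Even) : g) x = L.br a (L.br b x) - L.br b (L.br a x)
        rw [this]; abel
      rw [hz, hz]
    · have hA0 : ∀ x ∈ L.sumRootPart H Γ 0, L.br a x ∈ L.sumRootPart H Γ 1 := hA 0
      have hA1 : ∀ x ∈ L.sumRootPart H Γ 1, L.br a x ∈ L.sumRootPart H Γ 0 := hA 1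
      have hB0 : ∀ x ∈ L.sumRootPart H Γ 0, L.br b x ∈ L.sumRootPart H Γ 1 := hB' 0
      have hB1 : ∀ x ∈ L.sumRootPart H Γ 1, L.br b x ∈ L.sumRootPart H Γ 0 := hB' 1
      have hj : ∀ x, L.br ((t : L.Even) : g) x = L.br a (L.br b x) + L.br b (L.br a x) := fun x => by
        rw [jacobi_odd ha.2 hb.2 x, hbr]; abel
      have e0 : (L.br ((t : L.Even) : g)).restrict (hT 0) =
          (L.br a).restrict hA1 ∘ₗ (L.br b).restrict hB0 +
            (L.br b).restrict hB1 ∘ₗ (L.br a).restrict hA0 := by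
        ext x; exact hj x
      have e1 : (L.br ((t : L.Even) : g)).restrict (hT 1) =
          (L.br a).restrict hA0 ∘ₗ (L.br b).restrict hB1 +
            (L.br b).restrict hB0 ∘ₗ (L.br a).restrict hA1 := by
        ext x; exact hj x
      rw [e0, e1, map_add, map_add, LinearMap.trace_comp_comm' ((L.br a).restrict hA1),
        LinearMap.trace_comp_comm' ((L.br b).restrict hB1), add_comm]
  rw [trace_sumRootPart, trace_sumRootPart, ← sub_eq_zero, ← Finset.sum_sub_distrib] at key
  rw [← key]
  refine Finset.sum_congr rfl fun γ _ => ?_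
  rw [superdim, pairing_eq hB]
  ring

end Supertrace

/-! ### The Weyl vector as a sum over roots weighted by superdimension -/

section WeylVector

variable [FiniteDimensional ℂ g] {H : LieSubalgebra ℂ L.Even} [H.IsCartanSubalgebra]
variable {B : LinearMap.BilinForm ℂ g} (hL : L.IsBasicClassical) (hB : L.IsInvariantForm B)

variable (L H) in
/-- The roots on which the functional `f` is positive. -/
def positiveRoots (f : Dual ℂ H →ₗ[ℝ] ℝ) : Set (Dual ℂ H) := {α | α ∈ L.roots H ∧ 0 < f α}

open Classical in
variable (L H) in
/-- The roots on which the functional `f` is positive, as a finite set. -/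
def positiveRootsFinset (f : Dual ℂ H →ₗ[ℝ] ℝ) : Finset (Dual ℂ H) :=
  (L.finite_roots H).toFinset.filter fun α => 0 < f α

lemma mem_positiveRootsFinset {f : Dual ℂ H →ₗ[ℝ] ℝ} {α : Dual ℂ H} :
    α ∈ L.positiveRootsFinset H f ↔ α ∈ L.roots H ∧ 0 < f α := by
  simp [positiveRootsFinset]

include hL hB in
lemma two_smul_weylVector (f : Dual ℂ H →ₗ[ℝ] ℝ) :
    (2 : ℂ) • L.weylVector H (L.positiveRoots H f) =
      ∑ γ ∈ L.positiveRootsFinset H f, L.superdim H γ • γ := by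
  classical
  have hfin : (L.positiveRoots H f).Finite := (L.finite_roots H).subset fun _ h => h.1
  have h0 : ∑ᶠ α ∈ L.positiveRoots H f ∩ L.evenRoots H, α =
      ∑ γ ∈ L.positiveRootsFinset H f, (finrank ℂ (L.rootPart H γ 0) : ℂ) • γ := by
    rw [finsum_mem_eq_finite_toFinset_sum _ (hfin.inter_of_left _)]
    refine Finset.sum_subset_zero_on_sdiff (fun α hα => ?_) (fun α hα => ?_) fun α hα => ?_
    · rw [Set.Finite.mem_toFinset] at hα
      exact mem_positiveRootsFinset.mpr hα.1
    · rw [Finset.mem_sdiff, Set.Finite.mem_toFinset, mem_positiveRootsFinset] at hα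
      have : L.rootPart H α 0 = ⊥ := by
        by_contra h
        exact hα.2 ⟨hα.1, hα.1.1.1, h⟩
      rw [this, finrank_bot, Nat.cast_zero, zero_smul]
    · rw [Set.Finite.mem_toFinset] at hα
      rw [(evenRoots_structure hL hB hα.2).1, Nat.cast_one, one_smul]
  have h1 : ∑ᶠ α ∈ L.positiveRoots H f ∩ L.oddRoots H, finrank ℂ (L.rootPart H α 1) • α =
      ∑ γ ∈ L.positiveRootsFinset H f, (finrank ℂ (L.rootPart H γ 1) : ℂ) • γ := by
    rw [finsum_mem_eq_finite_toFinset_sum _ (hfin.inter_of_left _)]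
    refine Finset.sum_subset_zero_on_sdiff (fun α hα => ?_) (fun α hα => ?_) fun α hα => ?_
    · rw [Set.Finite.mem_toFinset] at hα
      exact mem_positiveRootsFinset.mpr hα.1
    · rw [Finset.mem_sdiff, Set.Finite.mem_toFinset, mem_positiveRootsFinset] at hα
      have : L.rootPart H α 1 = ⊥ := by
        by_contra h
        exact hα.2 ⟨hα.1, hα.1.1.1, h⟩
      rw [this, finrank_bot, Nat.cast_zero, zero_smul]
    · rw [Nat.cast_smul_eq_nsmul]
  rw [weylVector, h0, h1, smul_sub, smul_smul, smul_smul]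
  norm_num
  rw [← Finset.sum_sub_distrib]
  exact Finset.sum_congr rfl fun γ _ => by rw [superdim, sub_smul]

end WeylVector

/-! ### Positive systems and linear functionals -/

section Functional

variable [FiniteDimensional ℂ g] {H : LieSubalgebra ℂ L.Even} [H.IsCartanSubalgebra]
variable {B : LinearMap.BilinForm ℂ g} (hL : L.IsBasicClassical) (hB : L.IsInvariantForm B)

include hL hB in
/-- A positive system is given by the sign of a linear functional. -/
lemma IsPositiveSystem.exists_functional {P : Set (Dual ℂ H)} (hP : L.IsPositiveSystem H P) :
    ∃ f : Dual ℂ H →ₗ[ℝ] ℝ, (∀ α ∈ L.roots H, f α ≠ 0) ∧ P = L.positiveRoots H f := by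
  obtain ⟨_, _, _, hP⟩ := hP
  have : FiniteDimensional ℝ (L.realSpan H) := FiniteDimensional.span_of_finite ℝ (L.finite_roots H)
  let e := (Module.finBasis ℝ (L.realSpan H)).equivFun
  let S : Set (L.realSpan H) := {x | (x : Dual ℂ H) ∈ L.roots H ∧ 0 < x}
  have hS : S.Finite := Set.Finite.of_injOn (f := Subtype.val) (t := L.roots H)
    (fun x hx => hx.1) Subtype.val_injective.injOn (L.finite_roots H)
  have hconv : Convex ℝ {x : L.realSpan H | 0 < x} := by
    intro x hx y hy a b ha hb hab
    rcases ha.eq_or_lt with rfl | ha'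
    · rw [zero_add] at hab
      simpa [hab] using hy
    · exact add_pos_of_pos_of_nonneg
        (lt_of_le_of_ne (smul_nonneg ha (le_of_lt hx)) (smul_ne_zero ha'.ne' (ne_of_gt hx)).symm)
        (smul_nonneg hb (le_of_lt hy))
  have hsub : convexHull ℝ S ⊆ {x | 0 < x} := convexHull_min (fun x hx => hx.2) hconv
  have h0 : (0 : Fin (finrank ℝ (L.realSpan H)) → ℝ) ∉ convexHull ℝ (e '' S) := by
    intro h
    have himg : convexHull ℝ (e '' S) = e '' convexHull ℝ S :=
      (LinearMap.image_convexHull e.toLinearMap S).symm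
    rw [himg] at h
    obtain ⟨x, hx, hx0⟩ := h
    rw [(LinearEquiv.map_eq_zero_iff e).mp hx0] at hx
    exact lt_irrefl _ (hsub hx)
  -- Positive elements form a convex set without zero, so the convex hull of the finitely many
  -- positive roots misses zero and is strictly separated from it.
  obtain ⟨φ, u, hu0, hu⟩ := geometric_hahn_banach_point_closed (convex_convexHull ℝ (e '' S))
    ((hS.image e).isClosed_convexHull ℝ) h0
  rw [map_zero] at hu0
  obtain ⟨f, hf⟩ := LinearMap.exists_extend (p := L.realSpan H) (φ.toLinearMap ∘ₗ e.toLinearMap)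
  have hfpos : ∀ x ∈ S, 0 < f x := fun x hx => by
    have h1 := hu (e x) (subset_convexHull ℝ _ ⟨x, hx, rfl⟩)
    have h2 : f x = φ (e x) := LinearMap.congr_fun hf x
    rw [h2]; linarith
  have hcases : ∀ α (hα : α ∈ L.roots H),
      (0 < (⟨α, Submodule.subset_span hα⟩ : L.realSpan H) ∧ 0 < f α) ∨
      (¬ 0 < (⟨α, Submodule.subset_span hα⟩ : L.realSpan H) ∧ f α < 0) := fun α hα => by
    set x : L.realSpan H := ⟨α, Submodule.subset_span hα⟩ with hx
    rcases lt_trichotomy 0 x with h | h | h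
    · exact Or.inl ⟨h, hfpos x ⟨hα, h⟩⟩
    · exact absurd (congrArg Subtype.val h).symm hα.1
    · refine Or.inr ⟨not_lt.mpr h.le, ?_⟩
      have := hfpos (-x) ⟨neg_mem_roots hL hB hα, neg_pos.mpr h⟩
      rw [Submodule.coe_neg, map_neg] at this
      have h3 : (x : Dual ℂ H) = α := rfl
      rw [h3] at this
      linarith
  refine ⟨f, fun α hα => ?_, ?_⟩
  · rcases hcases α hα with h | h
    · exact h.2.ne'
    · exact h.2.ne
  · rw [hP]
    ext α
    constructor
    · rintro ⟨hα, h⟩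
      rcases hcases α hα with h' | h'
      · exact ⟨hα, h'.2⟩
      · exact absurd h h'.1
    · rintro ⟨hα, h⟩
      rcases hcases α hα with h' | h'
      · exact ⟨hα, h'.1⟩
      · linarith [h'.2]

/-- A small perturbation of a functional, resolving zeros on a finite set by a second one. -/
lemma exists_perturbation {M : Type*} [AddCommGroup M] [Module ℝ M] {R : Set M} (hR : R.Finite)
    (a b : M →ₗ[ℝ] ℝ) : ∃ ε : ℝ, 0 < ε ∧ ∀ x ∈ R, (0 < a x → 0 < (a + ε • b) x) ∧
      (a x < 0 → (a + ε • b) x < 0) := by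
  have h : ∀ᶠ ε : ℝ in nhdsWithin 0 (Set.Ioi 0), ∀ x ∈ R, (0 < a x → 0 < (a + ε • b) x) ∧
      (a x < 0 → (a + ε • b) x < 0) := by
    refine (Filter.eventually_all_finite hR).mpr fun x _ => ?_
    have ht : Filter.Tendsto (fun ε : ℝ => (a + ε • b) x) (nhdsWithin 0 (Set.Ioi 0))
        (nhds (a x)) := by
      have hc : Continuous fun ε : ℝ => a x + ε * b x := by fun_prop
      have := (hc.tendsto 0).mono_left (nhdsWithin_le_nhds (s := Set.Ioi 0))
      simpa using this
    rcases lt_trichotomy (a x) 0 with h | h | h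
    · filter_upwards [ht.eventually_lt_const h] with ε hε
      exact ⟨fun h' => absurd h' (not_lt.mpr h.le), fun _ => hε⟩
    · exact Filter.Eventually.of_forall fun ε => ⟨fun h' => absurd h h'.ne', fun h' => absurd h h'.ne⟩
    · filter_upwards [ht.eventually_const_lt h] with ε hε
      exact ⟨fun _ => hε, fun h' => absurd h' (not_lt.mpr h.le)⟩
  obtain ⟨ε, hε, hpos⟩ := (h.and self_mem_nhdsWithin).exists
  exact ⟨ε, hpos, hε⟩

end Functional

end LieSuperalgebra

namespace LieSuperalgebra

variable {g : Type*} [AddCommGroup g] [Module ℂ g] {L : LieSuperalgebra g}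

/-! ### Dual bases of opposite root spaces, and highest weight vectors -/

section DualBases

variable [FiniteDimensional ℂ g] {H : LieSubalgebra ℂ L.Even} [H.IsCartanSubalgebra]
variable {B : LinearMap.BilinForm ℂ g} (hL : L.IsBasicClassical) (hB : L.IsInvariantForm B)

variable (L H B) in
/-- The pairing of opposite root spaces of the same parity. -/
def rootPartPairing (α : Dual ℂ H) (i : ZMod 2) :
    L.rootPart H α i →ₗ[ℂ] L.rootPart H (-α) i →ₗ[ℂ] ℂ :=
  B.compl₁₂ (L.rootPart H α i).subtype (L.rootPart H (-α) i).subtype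

include hL hB in
lemma rootPartPairing_isPerfPair (α : Dual ℂ H) (i : ZMod 2) :
    (L.rootPartPairing H B α i).IsPerfPair := by
  refine LinearMap.IsPerfPair.of_injective ?_ ?_
  · rw [injective_iff_map_eq_zero]
    intro x hx
    by_contra hx0
    obtain ⟨y, hy, hxy⟩ := hB.exists_dual_root_vector hL x.2 fun h => hx0 (Subtype.ext h)
    have : B x y = 0 := LinearMap.congr_fun hx ⟨y, hy⟩
    exact one_ne_zero (hxy.symm.trans this)
  · rw [injective_iff_map_eq_zero]
    intro y hy
    by_contra hy0
    obtain ⟨x, hx, hxy⟩ := hB.exists_dual_root_vector hL y.2 fun h => hy0 (Subtype.ext h)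
    rw [neg_neg] at hx
    have h0 : B x y = 0 := LinearMap.congr_fun hy ⟨x, hx⟩
    rw [hB.supersymmetric y.2.2 hx.2, h0, mul_zero] at hxy
    exact zero_ne_one hxy

include hL hB in
lemma finrank_rootPart_neg (α : Dual ℂ H) (i : ZMod 2) :
    finrank ℂ (L.rootPart H (-α) i) = finrank ℂ (L.rootPart H α i) := by
  have := rootPartPairing_isPerfPair hL hB α i
  exact (Module.finrank_of_isPerfPair (L.rootPartPairing H B α i)).symm

include hL hB in
lemma superdim_neg (α : Dual ℂ H) : L.superdim H (-α) = L.superdim H α := by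
  rw [superdim, superdim, finrank_rootPart_neg hL hB, finrank_rootPart_neg hL hB]

include hL hB in
/-- Opposite root spaces of the same parity have dual bases. -/
lemma exists_dual_bases (α : Dual ℂ H) (i : ZMod 2) :
    ∃ x y : Fin (finrank ℂ (L.rootPart H α i)) → g,
      (∀ k, x k ∈ L.rootPart H α i) ∧ (∀ k, y k ∈ L.rootPart H (-α) i) ∧
      (∀ j k, B (x j) (y k) = if j = k then 1 else 0) ∧
      Submodule.span ℂ (Set.range y) = L.rootPart H (-α) i := by
  have := rootPartPairing_isPerfPair hL hB α i
  let b := Module.finBasis ℂ (L.rootPart H α i)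
  let c := b.dualBasis.map (L.rootPartPairing H B α i).flip.toPerfPair.symm
  refine ⟨fun k => b k, fun k => c k, fun k => (b k).2, fun k => (c k).2, fun j k => ?_, ?_⟩
  · have h := LinearMap.apply_toPerfPair_flip (p := L.rootPartPairing H B α i) (b.dualBasis k) (b j)
    rw [Module.Basis.dualBasis_apply_self] at h
    have h' : B (b j) (c k) = if k = j then 1 else 0 := by
      rw [Basis.map_apply]; exact h.trans (by simp [eq_comm])
    rw [h']; simp [eq_comm]
  · have : Set.range (fun k => ((c k : L.rootPart H (-α) i) : g)) =
      (L.rootPart H (-α) i).subtype '' Set.range c := by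
      rw [← Set.range_comp]; rfl
    rw [this, Submodule.span_image, c.span_eq, Submodule.map_top, Submodule.range_subtype]

end DualBases

namespace SuperModule

variable {V : Type*} [AddCommGroup V] [Module ℂ V] (M : L.SuperModule V)

lemma act_br_even {a b : g} {i : ZMod 2} (ha : a ∈ L.part 0) (hb : b ∈ L.part i) (v : V) :
    M.act (L.br a b) v = M.act a (M.act b v) - M.act b (M.act a v) := by
  rw [M.act_br v ha hb, superSign_zero_left, one_smul]

lemma act_br_odd {a b : g} (ha : a ∈ L.part 1) (hb : b ∈ L.part 1) (v : V) :
    M.act (L.br a b) v = M.act a (M.act b v) + M.act b (M.act a v) := by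
  rw [M.act_br v ha hb, superSign_one_one, neg_one_smul, sub_neg_eq_add]

/-- `v` is a vector of weight `l`. -/
def HasWeight (H : LieSubalgebra ℂ L.Even) (v : V) (l : Dual ℂ H) : Prop :=
  ∀ h : H, M.act ((h : L.Even) : g) v = l h • v

variable {M} {H : LieSubalgebra ℂ L.Even}

lemma HasWeight.act {v : V} {l α : Dual ℂ H} (hv : M.HasWeight H v l) {i : ZMod 2} {x : g}
    (hx : x ∈ L.rootPart H α i) : M.HasWeight H (M.act x v) (l + α) := fun h => by
  have h1 := M.act_br_even (h : L.Even).2 hx.2 v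
  rw [hx.1 h, hv h, map_smul, map_smul, LinearMap.smul_apply] at h1
  rw [LinearMap.add_apply, add_smul, h1]
  abel

variable (M H) in
/-- `v` is a highest weight vector of weight `l` for the positive roots defined by `f`. -/
structure IsHighestWeight (f : Dual ℂ H →ₗ[ℝ] ℝ) (v : V) (l : Dual ℂ H) : Prop where
  ne_zero : v ≠ 0
  hasWeight : M.HasWeight H v l
  act_eq_zero : ∀ α ∈ L.positiveRoots H f, ∀ x ∈ L.rootSpace H α, M.act x v = 0

/-- Applying mutually anticommuting odd lowering operators, each of which has a raising partner, to
a vector on which these act without degeneration. -/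
lemma exists_lowered {B : LinearMap.BilinForm ℂ g} (hB : L.IsInvariantForm B)
    [FiniteDimensional ℂ g] [H.IsCartanSubalgebra]
    {κ : Type*} [DecidableEq κ] (wt : κ → Dual ℂ H) (x y : κ → g)
    (hx : ∀ k, x k ∈ L.rootPart H (wt k) 1) (hy : ∀ k, y k ∈ L.rootPart H (-wt k) 1)
    (hxy : ∀ j k, L.br (x j) (y k) = if j = k then ((L.dualVector H B (wt k) : L.Even) : g) else 0)
    (hyy : ∀ j k, L.br (y j) (y k) = 0) (hwt : ∀ j k, L.pairing H B (wt j) (wt k) = 0)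
    (N : Set (Dual ℂ H)) (hN : ∀ γ ∈ N, ∀ k, γ + -wt k ∈ N)
    {v : V} (hv0 : v ≠ 0) {l : Dual ℂ H} (hv : M.HasWeight H v l)
    (hvN : ∀ γ ∈ N, ∀ i, ∀ z ∈ L.rootPart H γ i, M.act z v = 0) (hvx : ∀ k, M.act (x k) v = 0)
    (hl : ∀ k, L.pairing H B l (wt k) ≠ 0) (s : Finset κ) :
    ∃ u : V, u ≠ 0 ∧ M.HasWeight H u (l - ∑ k ∈ s, wt k) ∧
      (∀ γ ∈ N, ∀ i, ∀ z ∈ L.rootPart H γ i, M.act z u = 0) ∧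
      (∀ k ∈ s, M.act (y k) u = 0) ∧ ∀ k ∉ s, M.act (x k) u = 0 := by
  induction s using Finset.induction_on with
  | empty => exact ⟨v, hv0, by simpa using hv, hvN, by simp, fun k _ => hvx k⟩
  | insert k s hk ih =>
    obtain ⟨u, hu0, hu, huN, huy, hux⟩ := ih
    refine ⟨M.act (y k) u, fun h0 => ?_, ?_, fun γ hγ i z hz => ?_, fun j hj => ?_, fun j hj => ?_⟩
    -- Since $x_ku=0$, applying $x_k$ to $y_ku$ gives $h_ku$, which is $(l,\mathrm{wt}_k)u$ because
    -- the weights already subtracted are orthogonal to $\mathrm{wt}_k$. So $y_ku\neq0$.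
    · have h1 := M.act_br_odd (hx k).2 (hy k).2 u
      rw [hxy, if_pos rfl, h0, hux k hk, map_zero, map_zero, add_zero, hu, ← pairing_eq hB] at h1
      have h2 : L.pairing H B (l - ∑ j ∈ s, wt j) (wt k) = L.pairing H B l (wt k) := by
        have : ∀ j, wt j (L.dualVector H B (wt k)) = 0 := fun j => by
          rw [← pairing_eq hB]; exact hwt j k
        rw [pairing_eq hB, pairing_eq hB, LinearMap.sub_apply, LinearMap.sum_apply,
          Finset.sum_eq_zero fun j _ => this j, sub_zero]
      rw [h2] at h1
      exact (smul_ne_zero (hl k) hu0) h1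
    · have := hu.act (hy k)
      rwa [Finset.sum_insert hk, add_comm (wt k), ← sub_sub, sub_eq_add_neg (l - _)]
    · have h1 := huN _ (hN γ hγ k) _ _ (br_mem_rootPart hz (hy k))
      rw [M.act_br u hz.2 (hy k).2, huN γ hγ i z hz, map_zero, smul_zero, sub_zero] at h1
      exact h1
    · have h1 := M.act_br_odd (hy j).2 (hy k).2 u
      rw [hyy, map_zero, LinearMap.zero_apply] at h1
      rcases Finset.mem_insert.mp hj with rfl | hj
      · have h2 : (2 : ℂ) • M.act (y j) (M.act (y j) u) = 0 := by rw [two_smul, ← h1]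
        exact (smul_eq_zero.mp h2).resolve_left two_ne_zero
      · rw [huy j hj, map_zero, add_zero] at h1
        exact h1.symm
    · have h1 := M.act_br_odd (hx j).2 (hy k).2 u
      rw [Finset.mem_insert, not_or] at hj
      rw [hxy, if_neg hj.1, map_zero, LinearMap.zero_apply, hux j hj.2, map_zero, add_zero] at h1
      exact h1.symm

end SuperModule

/-! ### Crossing a wall of odd roots -/

section Flip

variable [FiniteDimensional ℂ g] {H : LieSubalgebra ℂ L.Even} [H.IsCartanSubalgebra]
variable {B : LinearMap.BilinForm ℂ g} (hL : L.IsBasicClassical) (hB : L.IsInvariantForm B)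

lemma rootPart_eq_bot_of_notMem {α : Dual ℂ H} (h0 : α ≠ 0) (hα : α ∉ L.evenRoots H) :
    L.rootPart H α 0 = ⊥ := by
  by_contra h
  exact hα ⟨h0, h⟩

/-- A functional `f₀` whose zeros among the roots are odd roots, separating the positive systems of
`f₁` and `f₂`. -/
structure IsWall (L : LieSuperalgebra g) (H : LieSubalgebra ℂ L.Even)
    (f₀ f₁ f₂ : Dual ℂ H →ₗ[ℝ] ℝ) : Prop where
  pos : ∀ γ ∈ L.roots H, 0 < f₀ γ → 0 < f₁ γ ∧ 0 < f₂ γ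
  sign : ∀ γ ∈ L.roots H, f₀ γ = 0 → (0 < f₁ γ ↔ f₂ γ < 0) ∧ f₁ γ ≠ 0
  even : ∀ γ ∈ L.evenRoots H, f₀ γ ≠ 0

variable {f₀ f₁ f₂ : Dual ℂ H →ₗ[ℝ] ℝ}

open Classical in
variable (L H) in
/-- The roots on which `f₀` vanishes and `f₁` is positive. -/
def wallRoots (f₀ f₁ : Dual ℂ H →ₗ[ℝ] ℝ) : Finset (Dual ℂ H) :=
  (L.positiveRootsFinset H f₁).filter fun γ => f₀ γ = 0

lemma mem_wallRoots {γ : Dual ℂ H} :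
    γ ∈ L.wallRoots H f₀ f₁ ↔ γ ∈ L.roots H ∧ 0 < f₁ γ ∧ f₀ γ = 0 := by
  simp [wallRoots, mem_positiveRootsFinset, and_assoc]

namespace IsWall

variable (hW : L.IsWall H f₀ f₁ f₂)
include hW

lemma filter_pos : (L.positiveRootsFinset H f₁).filter (fun γ => 0 < f₀ γ) =
    L.positiveRootsFinset H f₀ := by
  ext γ
  simp only [Finset.mem_filter, mem_positiveRootsFinset]
  exact ⟨fun h => ⟨h.1.1, h.2⟩, fun h => ⟨⟨h.1, (hW.pos γ h.1 h.2).1⟩, h.2⟩⟩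

lemma filter_pos_right : (L.positiveRootsFinset H f₂).filter (fun γ => 0 < f₀ γ) =
    L.positiveRootsFinset H f₀ := by
  ext γ
  simp only [Finset.mem_filter, mem_positiveRootsFinset]
  exact ⟨fun h => ⟨h.1.1, h.2⟩, fun h => ⟨⟨h.1, (hW.pos γ h.1 h.2).2⟩, h.2⟩⟩

include hL hB in
lemma eq_zero_of_not_pos {γ : Dual ℂ H} (hγ : γ ∈ L.roots H) (h : 0 < f₁ γ ∨ 0 < f₂ γ)
    (h0 : ¬ 0 < f₀ γ) : f₀ γ = 0 := by
  rcases (not_lt.mp h0).lt_or_eq with h1 | h1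
  · have := hW.pos _ (neg_mem_roots hL hB hγ) (by rw [map_neg]; linarith)
    rw [map_neg, map_neg] at this
    rcases h with h | h
    · linarith [this.1]
    · linarith [this.2]
  · exact h1

include hL hB in
lemma filter_not_pos : (L.positiveRootsFinset H f₁).filter (fun γ => ¬ 0 < f₀ γ) =
    L.wallRoots H f₀ f₁ := by
  ext γ
  simp only [Finset.mem_filter, mem_positiveRootsFinset, mem_wallRoots]
  exact ⟨fun h => ⟨h.1.1, h.1.2, hW.eq_zero_of_not_pos hL hB h.1.1 (Or.inl h.1.2) h.2⟩,
    fun h => ⟨⟨h.1, h.2.1⟩, h.2.2.not_gt⟩⟩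

include hL hB in
lemma filter_not_pos_right : (L.positiveRootsFinset H f₂).filter (fun γ => ¬ 0 < f₀ γ) =
    (L.wallRoots H f₀ f₁).map (Equiv.neg _).toEmbedding := by
  ext γ
  rw [Finset.mem_map_equiv]
  simp only [Finset.mem_filter, mem_positiveRootsFinset, mem_wallRoots, Equiv.neg_symm,
    Equiv.neg_apply]
  constructor
  · intro h
    have h0 := hW.eq_zero_of_not_pos hL hB h.1.1 (Or.inr h.1.2) h.2
    have hn := neg_mem_roots hL hB h.1.1
    refine ⟨hn, ((hW.sign _ hn (by simpa using h0)).1).mpr ?_, by simpa using h0⟩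
    rw [map_neg]; linarith [h.1.2]
  · intro h
    have := ((hW.sign _ h.1 h.2.2).1).mp h.2.1
    have h0 := h.2.2
    rw [map_neg] at this h0
    refine ⟨⟨?_, by linarith⟩, by linarith⟩
    simpa using neg_mem_roots hL hB h.1

include hL hB in
lemma two_smul_weylVector_left : (2 : ℂ) • L.weylVector H (L.positiveRoots H f₁) =
    ∑ γ ∈ L.positiveRootsFinset H f₀, L.superdim H γ • γ +
      ∑ γ ∈ L.wallRoots H f₀ f₁, L.superdim H γ • γ := by
  classical
  rw [two_smul_weylVector hL hB, ← Finset.sum_filter_add_sum_filter_not _ (fun γ => 0 < f₀ γ),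
    hW.filter_pos, hW.filter_not_pos hL hB]

include hL hB in
lemma two_smul_weylVector_right : (2 : ℂ) • L.weylVector H (L.positiveRoots H f₂) =
    ∑ γ ∈ L.positiveRootsFinset H f₀, L.superdim H γ • γ -
      ∑ γ ∈ L.wallRoots H f₀ f₁, L.superdim H γ • γ := by
  classical
  rw [two_smul_weylVector hL hB, ← Finset.sum_filter_add_sum_filter_not _ (fun γ => 0 < f₀ γ),
    hW.filter_pos_right, hW.filter_not_pos_right hL hB, Finset.sum_map, sub_eq_add_neg,
    ← Finset.sum_neg_distrib]
  congr 1
  refine Finset.sum_congr rfl fun γ _ => ?_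
  change L.superdim H (-γ) • (-γ) = _
  rw [superdim_neg hL hB, smul_neg]

lemma rootPart_zero_eq_bot {γ : Dual ℂ H} (h0 : γ ≠ 0) (hγ : f₀ γ = 0) :
    L.rootPart H γ 0 = ⊥ :=
  rootPart_eq_bot_of_notMem h0 fun h => hW.even γ h hγ

lemma superdim_eq {γ : Dual ℂ H} (hγ : γ ∈ L.wallRoots H f₀ f₁) :
    L.superdim H γ = -(finrank ℂ (L.rootPart H γ 1) : ℂ) := by
  rw [mem_wallRoots] at hγ
  rw [superdim, hW.rootPart_zero_eq_bot hγ.1.1 hγ.2.2]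
  simp

lemma mem_oddRoots {γ : Dual ℂ H} (hγ : γ ∈ L.roots H) (h0 : f₀ γ = 0) : γ ∈ L.oddRoots H :=
  (mem_roots_iff.mp hγ).resolve_left fun h => hW.even γ h h0

include hL hB in
lemma pairing_self_eq_zero {γ : Dual ℂ H} (hγ : γ ∈ L.roots H) (h0 : f₀ γ = 0) :
    L.pairing H B γ γ = 0 := by
  by_contra h
  have h2 := two_smul_mem_evenRoots hL hB (hW.mem_oddRoots hγ h0) h
  refine hW.even _ h2 ?_
  rw [two_smul, map_add, h0, add_zero]

lemma br_eq_zero {β γ : Dual ℂ H} (hβ : f₀ β = 0) (hγ : f₀ γ = 0) (h0 : β + γ ≠ 0) {x y : g}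
    (hx : x ∈ L.rootPart H β 1) (hy : y ∈ L.rootPart H γ 1) : L.br x y = 0 := by
  have h := br_mem_rootPart hx hy
  rw [CharTwo.add_self_eq_zero, hW.rootPart_zero_eq_bot h0 (by rw [map_add, hβ, hγ, add_zero])] at h
  simpa using h

lemma add_ne_zero {β γ : Dual ℂ H} (hβ : β ∈ L.wallRoots H f₀ f₁)
    (hγ : γ ∈ L.wallRoots H f₀ f₁) : β + γ ≠ 0 := by
  rw [mem_wallRoots] at hβ hγ
  intro h
  have := congrArg f₁ h
  rw [map_add, map_zero] at this
  linarith [hβ.2.1, hγ.2.1]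

include hL hB in
-- Roots on the wall are isotropic. For different $\beta,\gamma$ neither $\beta+\gamma$ nor
-- $\beta-\gamma$ is an even root, so a root vector of $\beta$ commutes with those of $\pm\gamma$
-- and hence with $h_\gamma$.
lemma pairing_eq_zero {β γ : Dual ℂ H} (hβ : β ∈ L.wallRoots H f₀ f₁)
    (hγ : γ ∈ L.wallRoots H f₀ f₁) : L.pairing H B β γ = 0 := by
  have hadd := hW.add_ne_zero hβ hγ
  rw [mem_wallRoots] at hβ hγ
  by_cases hne : β = γ
  · rw [hne]; exact hW.pairing_self_eq_zero hL hB hγ.1 hγ.2.2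
  obtain ⟨z, hz, hz0⟩ := Submodule.exists_mem_ne_zero_of_ne_bot (hW.mem_oddRoots hβ.1 hβ.2.2).2
  obtain ⟨x, hx, hx0⟩ := Submodule.exists_mem_ne_zero_of_ne_bot (hW.mem_oddRoots hγ.1 hγ.2.2).2
  obtain ⟨y, hy, hxy⟩ := hB.exists_dual_root_vector hL hx hx0
  have h1 := jacobi_odd hz.2 hx.2 y
  rw [hW.br_eq_zero hβ.2.2 hγ.2.2 hadd hz hx,
    hW.br_eq_zero hβ.2.2 (by rw [map_neg, hγ.2.2, neg_zero])
      (by rwa [← sub_eq_add_neg, sub_ne_zero]) hz hy,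
    br_opposite hL hB hx hy, hxy, one_smul, map_zero, LinearMap.zero_apply, map_zero,
    sub_zero] at h1
  have h2 := br_skew_even (L.dualVector H B γ : L.Even).2 z
  rw [h1, neg_zero, hz.1, ← pairing_eq hB] at h2
  exact (smul_eq_zero.mp h2).resolve_right hz0

include hL hB in
-- The roots with $f_0>0$ are stable under translation by $\pm\beta$, up to non-roots, so the
-- supertrace identity removes them from $(2\rho,\beta)$. The remaining positive roots lie on the
-- wall and are orthogonal to $\beta$.
lemma pairing_weylVector_eq_zero {β : Dual ℂ H} (hβ : β ∈ L.wallRoots H f₀ f₁) :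
    L.pairing H B (L.weylVector H (L.positiveRoots H f₁)) β = 0 := by
  have hβ' := mem_wallRoots.mp hβ
  have key : ∀ δ : Dual ℂ H, f₀ δ = 0 → ∀ γ ∈ L.positiveRootsFinset H f₀,
      L.rootSpace H (δ + γ) = ⊥ ∨ δ + γ ∈ L.positiveRootsFinset H f₀ := fun δ hδ γ hγ => by
    rw [mem_positiveRootsFinset] at hγ ⊢
    by_cases h : L.rootSpace H (δ + γ) = ⊥
    · exact Or.inl h
    · have hp : 0 < f₀ (δ + γ) := by rw [map_add, hδ, zero_add]; exact hγ.2
      refine Or.inr ⟨⟨fun h0 => ?_, h⟩, hp⟩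
      rw [h0, map_zero] at hp
      exact lt_irrefl _ hp
  have h1 := sum_superdim_mul_pairing hL hB (hW.mem_oddRoots hβ'.1 hβ'.2.2).2
    (key β hβ'.2.2) (key (-β) (by rw [map_neg, hβ'.2.2, neg_zero]))
  have h2 := congrArg (fun ν => L.pairing H B ν β) (hW.two_smul_weylVector_left hL hB)
  simp only [pairing_eq hB, LinearMap.smul_apply, LinearMap.add_apply, LinearMap.sum_apply] at h2 h1
  simp only [smul_eq_mul] at h2
  have h3 : ∑ γ ∈ L.wallRoots H f₀ f₁, L.superdim H γ * γ (L.dualVector H B β) = 0 :=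
    Finset.sum_eq_zero fun γ hγ => by
      rw [← pairing_eq hB, hW.pairing_eq_zero hL hB hγ hβ, mul_zero]
  rw [h1, h3, add_zero] at h2
  rw [pairing_eq hB]
  exact (mul_eq_zero.mp h2).resolve_left two_ne_zero

include hL hB in
/-- Crossing a wall of odd roots: the shifted highest weight is unchanged if it is typical. -/
lemma exists_isHighestWeight {V : Type*} [AddCommGroup V] [Module ℂ V] {M : L.SuperModule V}
    {v : V} {l Λ : Dual ℂ H} (hv : M.IsHighestWeight H f₁ v l)
    (hΛ : l + L.weylVector H (L.positiveRoots H f₁) = Λ)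
    (htyp : ∀ β ∈ L.oddRoots H, L.pairing H B β β = 0 → L.pairing H B Λ β ≠ 0) :
    ∃ (u : V) (m : Dual ℂ H), M.IsHighestWeight H f₂ u m ∧
      m + L.weylVector H (L.positiveRoots H f₂) = Λ := by
  classical
  let F := L.wallRoots H f₀ f₁
  choose x y hx hy hxy hspan using fun β : F => exists_dual_bases hL hB β.1 1
  -- All roots of the wall are crossed at once, with one lowering operator for each basis vector.
  -- This also covers odd root spaces of dimension greater than one.
  let κ := Σ β : F, Fin (finrank ℂ (L.rootPart H β.1 1))
  have hF : ∀ β : F, β.1 ∈ L.roots H ∧ 0 < f₁ β.1 ∧ f₀ β.1 = 0 := fun β => mem_wallRoots.mp β.2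
  have hbr : ∀ j k : κ, L.br (x j.1 j.2) (y k.1 k.2) =
      if j = k then ((L.dualVector H B k.1.1 : L.Even) : g) else 0 := fun j k => by
    by_cases h : j.1 = k.1
    · obtain ⟨β, j⟩ := j
      obtain ⟨β', k⟩ := k
      obtain rfl : β = β' := h
      rw [br_opposite hL hB (hx β j) (hy β k), hxy]
      by_cases hjk : j = k
      · rw [if_pos hjk, if_pos (by rw [hjk]), one_smul]
      · have hne : ¬ (⟨β, j⟩ : κ) = ⟨β, k⟩ := fun h' => hjk (eq_of_heq (Sigma.mk.inj h').2)
        rw [if_neg hjk, if_neg hne, zero_smul]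
    · rw [if_neg fun h' => h (congrArg Sigma.fst h')]
      refine hW.br_eq_zero (hF j.1).2.2 (by rw [map_neg, (hF k.1).2.2, neg_zero]) ?_ (hx _ _) (hy _ _)
      rw [← sub_eq_add_neg, sub_ne_zero]
      exact fun h' => h (Subtype.ext h')
  have hbr' : ∀ j k : κ, L.br (y j.1 j.2) (y k.1 k.2) = 0 := fun j k => by
    refine hW.br_eq_zero (by rw [map_neg, (hF j.1).2.2, neg_zero])
      (by rw [map_neg, (hF k.1).2.2, neg_zero]) ?_ (hy _ _) (hy _ _)
    rw [← neg_add]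
    exact neg_ne_zero.mpr (hW.add_ne_zero j.1.2 k.1.2)
  have hN : ∀ γ ∈ {γ : Dual ℂ H | 0 < f₀ γ}, ∀ k : κ, γ + -k.1.1 ∈ {γ | 0 < f₀ γ} := fun γ hγ k => by
    change 0 < f₀ _
    rw [map_add, map_neg, (hF k.1).2.2, neg_zero, add_zero]
    exact hγ
  have hvN : ∀ γ ∈ {γ : Dual ℂ H | 0 < f₀ γ}, ∀ i, ∀ z ∈ L.rootPart H γ i, M.act z v = 0 :=
    fun γ (hγ : 0 < f₀ γ) i z hz => by
    by_cases hb : L.rootPart H γ i = ⊥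
    · rw [hb, Submodule.mem_bot] at hz
      rw [hz, map_zero, LinearMap.zero_apply]
    · have hr : γ ∈ L.roots H := ⟨fun h => by rw [h, map_zero] at hγ; exact lt_irrefl _ hγ,
        fun h => hb (le_bot_iff.mp (h ▸ inf_le_left))⟩
      exact hv.act_eq_zero γ ⟨hr, (hW.pos γ hr hγ).1⟩ z hz.1
  have hl : ∀ k : κ, L.pairing H B l k.1.1 ≠ 0 := fun k => by
    have h1 := htyp _ (hW.mem_oddRoots (hF k.1).1 (hF k.1).2.2)
      (hW.pairing_self_eq_zero hL hB (hF k.1).1 (hF k.1).2.2)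
    rwa [← hΛ, pairing_add_left hB, hW.pairing_weylVector_eq_zero hL hB k.1.2, add_zero] at h1
  obtain ⟨u, hu0, hu, huN, huy, -⟩ := SuperModule.exists_lowered hB (κ := κ) (fun k => k.1.1)
    (fun k => x k.1 k.2) (fun k => y k.1 k.2) (fun k => hx _ _) (fun k => hy _ _)
    hbr hbr' (fun j k => hW.pairing_eq_zero hL hB j.1.2 k.1.2)
    {γ | 0 < f₀ γ} hN hv.ne_zero hv.hasWeight hvN
    (fun k => hv.act_eq_zero _ ⟨(hF k.1).1, (hF k.1).2.1⟩ _ (hx _ _).1) hl Finset.univ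
  -- The total weight subtracted is minus the difference of the old and the new Weyl vectors, which
  -- is why the shifted weight does not change.
  have hsum : ∑ k : κ, (k.1.1 : Dual ℂ H) = -∑ γ ∈ F, L.superdim H γ • γ := by
    rw [Fintype.sum_sigma, ← Finset.sum_coe_sort F, ← Finset.sum_neg_distrib]
    refine Finset.sum_congr rfl fun β _ => ?_
    rw [hW.superdim_eq β.2, neg_smul, neg_neg, Nat.cast_smul_eq_nsmul]
    simp
  refine ⟨u, _, ⟨hu0, hu, fun α hα z hz => ?_⟩, ?_⟩
  · by_cases hp : 0 < f₀ α
    · exact rootSpace_homogeneous_induction (p := fun z => M.act z u = 0)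
        (fun i z hz => huN α hp i z hz)
        (fun a b ha hb => by rw [map_add, LinearMap.add_apply, ha, hb, add_zero]) z hz
    · have hmem : α ∈ (L.positiveRootsFinset H f₂).filter (fun γ => ¬ 0 < f₀ γ) := by
        rw [Finset.mem_filter, mem_positiveRootsFinset]
        exact ⟨hα, hp⟩
      rw [hW.filter_not_pos_right hL hB, Finset.mem_map] at hmem
      obtain ⟨β, hβ, rfl⟩ := hmem
      change z ∈ L.rootSpace H (-β) at hz
      have hβ' := mem_wallRoots.mp hβ
      rw [rootSpace_eq_sup, hW.rootPart_zero_eq_bot (neg_ne_zero.mpr hβ'.1.1)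
        (by rw [map_neg, hβ'.2.2, neg_zero]), bot_sup_eq, ← hspan ⟨β, hβ⟩] at hz
      induction hz using Submodule.span_induction with
      | mem z hz =>
        obtain ⟨k, rfl⟩ := hz
        exact huy ⟨⟨β, hβ⟩, k⟩ (Finset.mem_univ _)
      | zero => simp
      | add a b _ _ ha hb => rw [map_add, LinearMap.add_apply, ha, hb, add_zero]
      | smul c a _ ha => rw [map_smul, LinearMap.smul_apply, ha, smul_zero]
  · rw [hsum, ← hΛ]
    have h1 := hW.two_smul_weylVector_left hL hB
    have h2 := hW.two_smul_weylVector_right hL hB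
    have h3 : (2 : ℂ) • (L.weylVector H (L.positiveRoots H f₁) -
        L.weylVector H (L.positiveRoots H f₂)) =
        (2 : ℂ) • ∑ γ ∈ F, L.superdim H γ • γ := by
      rw [smul_sub, h1, h2, two_smul]; abel
    have h4 := smul_right_injective _ (two_ne_zero (α := ℂ)) h3
    rw [← h4]
    abel

end IsWall

end Flip

end LieSuperalgebra

namespace LieSuperalgebra

variable {g : Type*} [AddCommGroup g] [Module ℂ g] {L : LieSuperalgebra g}

/-! ### Positive systems with the same even positive roots -/

section Path

variable [FiniteDimensional ℂ g] {H : LieSubalgebra ℂ L.Even} [H.IsCartanSubalgebra]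
variable {B : LinearMap.BilinForm ℂ g} (hL : L.IsBasicClassical) (hB : L.IsInvariantForm B)

variable (L H) in
/-- The roots that are positive for `f` and negative for `f'`. -/
def separatingRoots (f f' : Dual ℂ H →ₗ[ℝ] ℝ) : Set (Dual ℂ H) :=
  {β | β ∈ L.roots H ∧ 0 < f β ∧ f' β < 0}

include hL hB in
lemma positiveRoots_eq_of_separatingRoots_eq_empty {f f' : Dual ℂ H →ₗ[ℝ] ℝ}
    (hf : ∀ γ ∈ L.roots H, f γ ≠ 0) (hf' : ∀ γ ∈ L.roots H, f' γ ≠ 0)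
    (h : L.separatingRoots H f f' = ∅) : L.positiveRoots H f = L.positiveRoots H f' := by
  have key : ∀ γ ∈ L.roots H, 0 < f γ → 0 < f' γ := fun γ hγ hp => by
    rcases lt_or_gt_of_ne (hf' γ hγ) with h1 | h1
    · exact absurd (show γ ∈ L.separatingRoots H f f' from ⟨hγ, hp, h1⟩) (h ▸ Set.notMem_empty γ)
    · exact h1
  ext γ
  refine ⟨fun hγ => ⟨hγ.1, key γ hγ.1 hγ.2⟩, fun hγ => ⟨hγ.1, ?_⟩⟩
  rcases lt_or_gt_of_ne (hf γ hγ.1) with h1 | h1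
  · have h2 := key (-γ) (neg_mem_roots hL hB hγ.1) (by rw [map_neg]; linarith)
    rw [map_neg] at h2
    linarith [hγ.2]
  · exact h1

include hL hB in
/-- The first wall between two positive systems with the same even roots. -/
lemma exists_isWall {f f' : Dual ℂ H →ₗ[ℝ] ℝ} (hf : ∀ γ ∈ L.roots H, f γ ≠ 0)
    (hf' : ∀ γ ∈ L.roots H, f' γ ≠ 0) (heven : ∀ γ ∈ L.evenRoots H, 0 < f γ → 0 < f' γ)
    (hne : (L.separatingRoots H f f').Nonempty) :
    ∃ f₀ f₂ : Dual ℂ H →ₗ[ℝ] ℝ, L.IsWall H f₀ f f₂ ∧ (∀ γ ∈ L.roots H, f₂ γ ≠ 0) ∧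
      (∀ γ ∈ L.evenRoots H, 0 < f₂ γ → 0 < f' γ) ∧
      L.separatingRoots H f₂ f' ⊂ L.separatingRoots H f f' := by
  have hfin : (L.separatingRoots H f f').Finite := (L.finite_roots H).subset fun _ h => h.1
  -- On the segment $(1-t)f+tf'$ a separating root vanishes at $t=f(\beta)/(f(\beta)-f'(\beta))$;
  -- the smallest such $t$ gives the first wall.
  obtain ⟨β, hβ, hmin⟩ := Set.exists_min_image _ (fun β => f β / (f β - f' β)) hfin hne
  set t := f β / (f β - f' β) with ht
  have hd : 0 < f β - f' β := by linarith [hβ.2.1, hβ.2.2]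
  have ht0 : 0 < t := div_pos hβ.2.1 hd
  have ht1 : t < 1 := by rw [ht, div_lt_one hd]; linarith [hβ.2.2]
  let f₀ : Dual ℂ H →ₗ[ℝ] ℝ := (1 - t) • f + t • f'
  have hf₀ : ∀ γ, f₀ γ = (1 - t) * f γ + t * f' γ := fun γ => by simp [f₀]
  have hf₀β : f₀ β = 0 := by rw [hf₀, ht]; field_simp; ring
  have hneg : ∀ γ ∈ L.roots H, f γ < 0 → f₀ γ ≤ 0 := fun γ hγ h => by
    by_contra! hcon
    rw [hf₀] at hcon
    have h1 : 0 < f' γ := by nlinarith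
    have hm := hmin (-γ) ⟨neg_mem_roots hL hB hγ, by rw [map_neg]; linarith, by rw [map_neg]; linarith⟩
    rw [map_neg, map_neg, le_div_iff₀ (by linarith)] at hm
    linarith
  have hpos : ∀ γ ∈ L.roots H, 0 < f₀ γ → 0 < f γ := fun γ hγ h => by
    rcases lt_or_gt_of_ne (hf γ hγ) with h1 | h1
    · exact absurd (hneg γ hγ h1) (not_le.mpr h)
    · exact h1
  have hevenneg : ∀ γ ∈ L.evenRoots H, f γ < 0 → f' γ < 0 := fun γ hγ h => by
    have := heven _ (neg_mem_evenRoots hL hB hγ) (by rw [map_neg]; linarith)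
    rw [map_neg] at this
    linarith
  -- Adding a small multiple of $f'$ moves just past the wall: the roots with $f_0=0$ take the sign
  -- of $f'$, the others keep theirs.
  obtain ⟨ε, hε, hpert⟩ := exists_perturbation (L.finite_roots H) f₀ f'
  have hzero : ∀ γ, f₀ γ = 0 → (f₀ + ε • f') γ = ε * f' γ := fun γ h => by simp [h]
  have hsign : ∀ γ ∈ L.roots H, f₀ γ = 0 → (0 < f γ ↔ f' γ < 0) := fun γ hγ h => by
    rw [hf₀] at h
    constructor <;> intro h1 <;> by_contra! h2
    · nlinarith
    · have := lt_of_le_of_ne h2 (hf γ hγ)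
      nlinarith
  refine ⟨f₀, f₀ + ε • f', ⟨fun γ hγ h => ⟨hpos γ hγ h, (hpert γ hγ).1 h⟩,
    fun γ hγ h => ⟨?_, hf γ hγ⟩, fun γ hγ h => ?_⟩, fun γ hγ => ?_, fun γ hγ h => ?_, ?_⟩
  · rw [hzero γ h, hsign γ hγ h, mul_neg_iff]
    constructor
    · exact fun h' => Or.inl ⟨hε, h'⟩
    · rintro (h' | h')
      · exact h'.2
      · linarith [h'.1]
  · have hγ' := mem_roots_iff.mpr (Or.inl hγ)
    rcases lt_or_gt_of_ne (hf γ hγ') with h1 | h1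
    · have h2 := hevenneg γ hγ h1
      rw [hf₀] at h
      nlinarith
    · have h2 := heven γ hγ h1
      rw [hf₀] at h
      nlinarith
  · rcases lt_trichotomy (f₀ γ) 0 with h | h | h
    · exact ((hpert γ hγ).2 h).ne
    · rw [hzero γ h]; exact mul_ne_zero hε.ne' (hf' γ hγ)
    · exact ((hpert γ hγ).1 h).ne'
  · have hγ' := mem_roots_iff.mpr (Or.inl hγ)
    rcases lt_trichotomy (f₀ γ) 0 with h1 | h1 | h1
    · linarith [(hpert γ hγ').2 h1]
    · rw [hzero γ h1] at h
      exact pos_of_mul_pos_right h hε.le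
    · exact heven γ hγ (hpos γ hγ' h1)
  · have hsub : L.separatingRoots H (f₀ + ε • f') f' ⊆ L.separatingRoots H f f' := by
      rintro γ ⟨hγ1, hγ2, hγ3⟩
      refine ⟨hγ1, ?_, hγ3⟩
      rcases lt_trichotomy (f₀ γ) 0 with h1 | h1 | h1
      · linarith [(hpert γ hγ1).2 h1]
      · exact (hsign γ hγ1 h1).mpr hγ3
      · exact hpos γ hγ1 h1
    refine (Set.ssubset_iff_of_subset hsub).mpr ⟨β, hβ, fun h => ?_⟩
    have h1 := h.2.1
    rw [hzero β hf₀β] at h1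
    nlinarith [hβ.2.2]

include hL hB in
/-- The shifted highest weight of a typical module does not depend on the choice of the odd
positive roots. -/
lemma SuperModule.IsHighestWeight.exists_of_evenRoots {V : Type*} [AddCommGroup V] [Module ℂ V]
    {M : L.SuperModule V} {Λ : Dual ℂ H}
    (htyp : ∀ β ∈ L.oddRoots H, L.pairing H B β β = 0 → L.pairing H B Λ β ≠ 0)
    {f f' : Dual ℂ H →ₗ[ℝ] ℝ} (hf : ∀ γ ∈ L.roots H, f γ ≠ 0)
    (hf' : ∀ γ ∈ L.roots H, f' γ ≠ 0) (heven : ∀ γ ∈ L.evenRoots H, 0 < f γ → 0 < f' γ)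
    {v : V} {l : Dual ℂ H} (hv : M.IsHighestWeight H f v l)
    (hΛ : l + L.weylVector H (L.positiveRoots H f) = Λ) :
    ∃ (u : V) (m : Dual ℂ H), M.IsHighestWeight H f' u m ∧
      m + L.weylVector H (L.positiveRoots H f') = Λ := by
  induction h : (L.separatingRoots H f f').ncard using Nat.strong_induction_on
    generalizing f v l with
  | _ n ih =>
  subst h
  rcases (L.separatingRoots H f f').eq_empty_or_nonempty with he | hne
  · have := positiveRoots_eq_of_separatingRoots_eq_empty hL hB hf hf' he
    exact ⟨v, l, ⟨hv.ne_zero, hv.hasWeight, this ▸ hv.act_eq_zero⟩, this ▸ hΛ⟩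
  · obtain ⟨f₀, f₂, hW, h1, h2, h3⟩ := exists_isWall hL hB hf hf' heven hne
    obtain ⟨u, m, hu, hm⟩ := hW.exists_isHighestWeight hL hB hv hΛ htyp
    exact ih _ (Set.ncard_lt_ncard h3 ((L.finite_roots H).subset fun _ h => h.1)) h1 h2 hu hm rfl

end Path

/-! ### Values of the shifted highest weight on simple even coroots -/

section SimpleEvenRoot

open IsAddIndecomposable

variable [FiniteDimensional ℂ g] {H : LieSubalgebra ℂ L.Even} [H.IsCartanSubalgebra]
variable {B : LinearMap.BilinForm ℂ g} (hL : L.IsBasicClassical) (hB : L.IsInvariantForm B)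

include hL hB in
lemma superdim_eq_one {α : Dual ℂ H} (hα : α ∈ L.evenRoots H) : L.superdim H α = 1 := by
  have h1 : L.rootPart H α 1 = ⊥ := by
    by_contra h
    exact notMem_oddRoots hL hB hα ⟨hα.1, h⟩
  rw [superdim, (evenRoots_structure hL hB hα).1, h1]
  simp

include hL hB in
lemma superdim_half {α : Dual ℂ H} (hα : α ∈ L.evenRoots H)
    (h : (1 / 2 : ℂ) • α ∈ L.roots H) : L.superdim H ((1 / 2 : ℂ) • α) = -1 := by
  have h0 : (1 / 2 : ℂ) • α ∉ L.evenRoots H := fun h' => by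
    rcases eq_or_eq_neg_of_smul_mem_evenRoots hL hB hα h' with h | h <;> norm_num at h
  have h1 := (mem_roots_iff.mp h).resolve_left h0
  rw [superdim, rootPart_eq_bot_of_notMem h.1 h0, finrank_oddRoot_eq_one hL hB h1]
  · simp
  · rw [pairing_smul_left hB, pairing_smul_right hB]
    have := pairing_self_ne_zero hL hB hα
    simpa using this

include hL hB in
lemma eq_or_eq_half_of_pos {f : Dual ℂ H →ₗ[ℝ] ℝ} {α : Dual ℂ H} (hα : α ∈ L.evenRoots H)
    (hαf : 0 < f α) {c : ℂ} (hc : c • α ∈ L.roots H) (hpos : 0 < f (c • α)) : c = 1 ∨ c = 1 / 2 := by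
  have hreal : ∀ r : ℝ, f (((r : ℝ) : ℂ) • α) = r * f α := fun r => by
    rw [Complex.coe_smul, map_smul, smul_eq_mul]
  rcases mem_roots_iff.mp hc with h | h
  · rcases eq_or_eq_neg_of_smul_mem_evenRoots hL hB hα h with h | h
    · exact Or.inl h
    · rw [h, neg_smul, one_smul, map_neg] at hpos
      linarith
  · rcases eq_half_of_smul_mem_oddRoots hL hB hα h with h | h
    · exact Or.inr h
    · have h' : c = ((-1 / 2 : ℝ) : ℂ) := by rw [h]; push_cast; rfl
      rw [h', hreal] at hpos
      linarith

include hL hB in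
/-- A functional that is positive on the same even roots, for which the even simple root `α` or its
half is a simple root. -/
lemma exists_adapted_functional {f : Dual ℂ H →ₗ[ℝ] ℝ} (hf : ∀ γ ∈ L.roots H, f γ ≠ 0)
    {α : L.evenRoots H}
    (hα : α ∈ baseOf (evenRootPairing hL hB).root (f : Dual ℂ H →+ ℝ)) :
    ∃ f₀ f₁ : Dual ℂ H →ₗ[ℝ] ℝ, (∀ γ ∈ L.roots H, f₁ γ ≠ 0) ∧
      (∀ γ ∈ L.evenRoots H, 0 < f γ → 0 < f₁ γ) ∧ f₀ α = 0 ∧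
      (∀ γ ∈ L.roots H, 0 < f₀ γ → 0 < f₁ γ) ∧
      ∀ γ ∈ L.roots H, f₀ γ = 0 → ∃ c : ℂ, γ = c • (α : Dual ℂ H) := by
  classical
  have hα0 : 0 < f α := hα.1
  let s : Dual ℂ H →ₗ[ℝ] Dual ℂ H :=
    ((evenRootPairing hL hB).reflection α).toLinearMap.restrictScalars ℝ
  have hs : ∀ ν, s ν = ν - ν (L.corootVector H B α) • (α : Dual ℂ H) := fun ν => rfl
  have hsα : s α = -α := by
    rw [hs, apply_corootVector_self hL hB α.2, two_smul]; abel
  have hpos : ∀ γ (hγ : γ ∈ L.evenRoots H), γ ≠ α → 0 < f γ → 0 < f (s γ) := fun γ hγ hne hp => by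
    have h := (evenRootPairing hL hB).pos_reflectionPerm (f := (f : Dual ℂ H →+ ℝ))
      (fun i => hf _ (mem_roots_iff.mpr (Or.inl i.2))) hα (j := ⟨γ, hγ⟩) hp
      (fun h => hne (congrArg Subtype.val h))
    rw [RootPairing.root_reflectionPerm] at h
    exact h
  let R : Set (Dual ℂ H) := {γ | γ ∈ L.roots H ∧ γ + s γ ≠ 0}
  have hR : R.Finite := (L.finite_roots H).subset fun _ h => h.1
  have : Finite R := hR.to_subtype
  -- $f+f\circ s_\alpha$ vanishes at $\alpha$ and is positive on the other positive even roots,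
  -- which $s_\alpha$ permutes. The $s_\alpha$-invariant perturbation by $h$ makes it nonzero on
  -- every root with $\gamma+s_\alpha\gamma\neq0$; the remaining roots are multiples of $\alpha$.
  obtain ⟨h, hh⟩ := Module.exists_dual_forall_apply_ne_zero (K := ℝ)
    (fun γ : R => γ.1 + s γ.1) fun γ => γ.2.2
  obtain ⟨ε', hε', hpert'⟩ := exists_perturbation (L.finite_roots H) (f + f ∘ₗ s) (h + h ∘ₗ s)
  set f₀ : Dual ℂ H →ₗ[ℝ] ℝ := (f + f ∘ₗ s) + ε' • (h + h ∘ₗ s) with hf₀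
  obtain ⟨ε, hε, hpert⟩ := exists_perturbation (L.finite_roots H) f₀ f
  have hf₀α : f₀ α = 0 := by simp [hf₀, hsα]
  have hprop : ∀ γ ∈ L.roots H, f₀ γ = 0 → ∃ c : ℂ, γ = c • (α : Dual ℂ H) := fun γ hγ h0 => by
    by_cases hsum : γ + s γ = 0
    · refine ⟨γ (L.corootVector H B α) / 2, ?_⟩
      rw [hs] at hsum
      have : (2 : ℂ) • γ = γ (L.corootVector H B α) • (α : Dual ℂ H) := by
        rw [two_smul, ← sub_eq_zero, ← hsum]; abel
      rw [div_eq_inv_mul, mul_smul, ← this, smul_smul]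
      norm_num
    · exfalso
      rcases lt_trichotomy ((f + f ∘ₗ s) γ) 0 with h1 | h1 | h1
      · exact ((hpert' γ hγ).2 h1).ne h0
      · have h2 : f₀ γ = ε' * h (γ + s γ) := by
          rw [hf₀, LinearMap.add_apply, h1]
          simp [mul_add]
        rw [h2] at h0
        exact mul_ne_zero hε'.ne' (hh ⟨γ, hγ, hsum⟩) h0
      · exact ((hpert' γ hγ).1 h1).ne' h0
  refine ⟨f₀, f₀ + ε • f, fun γ hγ => ?_, fun γ hγ hp => ?_, hf₀α, fun γ hγ => (hpert γ hγ).1,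
    hprop⟩
  · rcases lt_trichotomy (f₀ γ) 0 with h1 | h1 | h1
    · exact ((hpert γ hγ).2 h1).ne
    · simpa [h1] using ⟨hε.ne', hf γ hγ⟩
    · exact ((hpert γ hγ).1 h1).ne'
  · have hγ' := mem_roots_iff.mpr (Or.inl hγ)
    by_cases hγα : γ = α
    · rw [hγα]
      simpa [hf₀α] using mul_pos hε hα0
    · refine (hpert γ hγ').1 ((hpert' γ hγ').1 ?_)
      have := hpos γ hγ hγα hp
      simpa using add_pos hp this

include hL hB in
/-- The value of `2ρ` on the coroot of an even root `α` such that `α` or its half is simple. -/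
lemma weylVector_corootVector {f₀ f₁ : Dual ℂ H →ₗ[ℝ] ℝ} {α : Dual ℂ H} (hα : α ∈ L.evenRoots H)
    (hα1 : 0 < f₁ α) (h0 : f₀ α = 0) (hpos : ∀ γ ∈ L.roots H, 0 < f₀ γ → 0 < f₁ γ)
    (hprop : ∀ γ ∈ L.roots H, f₀ γ = 0 → ∃ c : ℂ, γ = c • α) :
    ∃ k : ℕ, 0 < k ∧
      2 * L.weylVector H (L.positiveRoots H f₁) (L.corootVector H B α) = k := by
  classical
  have key : ∀ δ : Dual ℂ H, f₀ δ = 0 → ∀ γ ∈ L.positiveRootsFinset H f₀,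
      L.rootSpace H (δ + γ) = ⊥ ∨ δ + γ ∈ L.positiveRootsFinset H f₀ := fun δ hδ γ hγ => by
    rw [mem_positiveRootsFinset] at hγ ⊢
    by_cases h : L.rootSpace H (δ + γ) = ⊥
    · exact Or.inl h
    · have hp : 0 < f₀ (δ + γ) := by rw [map_add, hδ, zero_add]; exact hγ.2
      refine Or.inr ⟨⟨fun h0 => ?_, h⟩, hp⟩
      rw [h0, map_zero] at hp
      exact lt_irrefl _ hp
  have h1 := sum_superdim_mul_pairing hL hB hα.2 (key α h0) (key (-α) (by rw [map_neg, h0, neg_zero]))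
  have h1' : ∑ γ ∈ L.positiveRootsFinset H f₀, L.superdim H γ * γ (L.corootVector H B α) = 0 := by
    have : ∀ γ : Dual ℂ H, L.superdim H γ * γ (L.corootVector H B α) =
        (2 / L.pairing H B α α) * (L.superdim H γ * L.pairing H B γ α) := fun γ => by
      rw [apply_corootVector hB]; ring
    rw [Finset.sum_congr rfl fun γ _ => this γ, ← Finset.mul_sum, h1, mul_zero]
  have h2 := congrArg (fun ν : Dual ℂ H => ν (L.corootVector H B α)) (two_smul_weylVector hL hB f₁)
  simp only [LinearMap.smul_apply, LinearMap.sum_apply, smul_eq_mul] at h2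
  have hfil : (L.positiveRootsFinset H f₁).filter (fun γ => 0 < f₀ γ) =
      L.positiveRootsFinset H f₀ := by
    ext γ
    simp only [Finset.mem_filter, mem_positiveRootsFinset]
    exact ⟨fun h => ⟨h.1.1, h.2⟩, fun h => ⟨⟨h.1, hpos γ h.1 h.2⟩, h.2⟩⟩
  rw [h2, ← Finset.sum_filter_add_sum_filter_not _ (fun γ => 0 < f₀ γ), hfil, h1', zero_add]
  have hαr : α ∈ L.roots H := mem_roots_iff.mpr (Or.inl hα)
  -- By the supertrace identity the roots with $f_0>0$ contribute nothing. Only $\alpha$,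
  -- contributing 2, and possibly the odd root $\alpha/2$, contributing $-1$, are left.
  have hmem : ∀ γ, γ ∈ (L.positiveRootsFinset H f₁).filter (fun γ => ¬ 0 < f₀ γ) ↔
      γ = α ∨ γ ∈ L.roots H ∧ γ = (1 / 2 : ℂ) • α := fun γ => by
    rw [Finset.mem_filter, mem_positiveRootsFinset]
    constructor
    · rintro ⟨⟨hγ, hγ1⟩, hγ0⟩
      have hz : f₀ γ = 0 := by
        rcases (not_lt.mp hγ0).lt_or_eq with h | h
        · have := hpos _ (neg_mem_roots hL hB hγ) (by rw [map_neg]; linarith)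
          rw [map_neg] at this
          linarith
        · exact h
      obtain ⟨c, rfl⟩ := hprop γ hγ hz
      rcases eq_or_eq_half_of_pos hL hB hα hα1 hγ hγ1 with rfl | rfl
      · exact Or.inl (one_smul _ _)
      · exact Or.inr ⟨hγ, rfl⟩
    · have hhalf : ∀ f : Dual ℂ H →ₗ[ℝ] ℝ, f ((1 / 2 : ℂ) • α) = 1 / 2 * f α := fun f => by
        have : (1 / 2 : ℂ) = ((1 / 2 : ℝ) : ℂ) := by push_cast; rfl
        rw [this, Complex.coe_smul, map_smul, smul_eq_mul]
      rintro (rfl | ⟨hγ, rfl⟩)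
      · exact ⟨⟨hαr, hα1⟩, h0.not_gt⟩
      · refine ⟨⟨hγ, ?_⟩, ?_⟩
        · rw [hhalf]; linarith
        · rw [hhalf, h0]; simp
  by_cases hh : (1 / 2 : ℂ) • α ∈ L.roots H
  · have hset : (L.positiveRootsFinset H f₁).filter (fun γ => ¬ 0 < f₀ γ) =
        {α, (1 / 2 : ℂ) • α} := by
      ext γ
      rw [hmem, Finset.mem_insert, Finset.mem_singleton]
      exact or_congr_right ⟨fun h => h.2, fun h => ⟨h ▸ hh, h⟩⟩
    have hne : α ≠ (1 / 2 : ℂ) • α := fun h => by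
      have h3 : (1 / 2 : ℂ) • α = 0 := by
        have : (1 / 2 : ℂ) • α = α - (1 / 2 : ℂ) • α := by module
        rw [this, sub_eq_zero]; exact h
      exact hα.1 ((smul_eq_zero.mp h3).resolve_left (by norm_num))
    refine ⟨1, one_pos, ?_⟩
    rw [hset, Finset.sum_pair hne, superdim_eq_one hL hB hα, superdim_half hL hB hα hh,
      LinearMap.smul_apply, apply_corootVector_self hL hB hα]
    norm_num
  · have hset : (L.positiveRootsFinset H f₁).filter (fun γ => ¬ 0 < f₀ γ) = {α} := by
      ext γ
      rw [hmem, Finset.mem_singleton]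
      exact or_iff_left fun h => hh (h.2 ▸ h.1)
    refine ⟨2, two_pos, ?_⟩
    rw [hset, Finset.sum_singleton, superdim_eq_one hL hB hα, apply_corootVector_self hL hB hα]
    norm_num

/-- The action of the even part on a module. -/
abbrev SuperModule.evenLieRingModule {V : Type*} [AddCommGroup V] [Module ℂ V]
    (M : L.SuperModule V) : LieRingModule L.Even V where
  bracket a v := M.act a v
  add_lie a b v := by simp
  lie_add a v w := by simp
  leibniz_lie a b v := by
    change M.act a (M.act b v) = M.act (L.br a b) v + M.act b (M.act a v)
    rw [M.act_br_even a.2 b.2]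
    abel

lemma SuperModule.evenLieModule {V : Type*} [AddCommGroup V] [Module ℂ V] (M : L.SuperModule V) :
    letI := M.evenLieRingModule
    LieModule ℂ L.Even V :=
  letI := M.evenLieRingModule
  { smul_lie := fun t a v => by
      change M.act (t • (a : g)) v = t • M.act a v
      rw [map_smul, LinearMap.smul_apply]
    lie_smul := fun t a v => (M.act a).map_smul t v }

include hL hB in
/-- A highest weight of a finite-dimensional module takes natural numbers as values on the
coroots of the positive even roots. -/
lemma SuperModule.IsHighestWeight.exists_nat {V : Type*} [AddCommGroup V] [Module ℂ V]
    [FiniteDimensional ℂ V] {M : L.SuperModule V} {f : Dual ℂ H →ₗ[ℝ] ℝ} {v : V} {l : Dual ℂ H}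
    (hv : M.IsHighestWeight H f v l) {α : Dual ℂ H} (hα : α ∈ L.evenRoots H) (hα0 : 0 < f α) :
    ∃ n : ℕ, l (L.corootVector H B α) = n := by
  let := M.evenLieRingModule
  have := M.evenLieModule
  obtain ⟨e, f', he, -, ht⟩ := exists_isSl2Triple hL hB hα
  have hprim : ht.HasPrimitiveVectorWith v (l (L.corootVector H B α)) :=
    ⟨hv.ne_zero, hv.hasWeight _,
      hv.act_eq_zero α ⟨mem_roots_iff.mpr (Or.inl hα), hα0⟩ _ he.1⟩
  exact hprim.exists_nat

include hL hB in
/-- The shifted highest weight of a typical finite-dimensional module takes positive half-integral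
values on the simple coroots. -/
lemma SuperModule.IsHighestWeight.isHalfRegular {V : Type*} [AddCommGroup V] [Module ℂ V]
    [FiniteDimensional ℂ V] {M : L.SuperModule V} {f : Dual ℂ H →ₗ[ℝ] ℝ}
    (hf : ∀ γ ∈ L.roots H, f γ ≠ 0) {v : V} {l : Dual ℂ H} (hv : M.IsHighestWeight H f v l)
    (htyp : ∀ β ∈ L.oddRoots H, L.pairing H B β β = 0 →
      L.pairing H B (l + L.weylVector H (L.positiveRoots H f)) β ≠ 0) :
    (evenRootPairing hL hB).IsHalfRegular
      (baseOf (evenRootPairing hL hB).root (f : Dual ℂ H →+ ℝ))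
      (l + L.weylVector H (L.positiveRoots H f)) := by
  intro α hα
  obtain ⟨f₀, f₁, h1, h2, h3, h4, h5⟩ := exists_adapted_functional hL hB hf hα
  have hα1 : 0 < f₁ α := h2 α α.2 hα.1
  obtain ⟨u, m, hu, hm⟩ := hv.exists_of_evenRoots hL hB htyp hf h1 h2 rfl
  obtain ⟨k, hk, hk'⟩ := weylVector_corootVector hL hB α.2 hα1 h3 h4 h5
  obtain ⟨n, hn⟩ := hu.exists_nat hL hB α.2 hα1
  refine ⟨2 * n + k, by omega, ?_⟩
  rw [← hm]
  change 2 * (m + L.weylVector H (L.positiveRoots H f₁)) (L.corootVector H B α) = _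
  rw [LinearMap.add_apply, mul_add, hk', hn]
  push_cast
  rfl

end SimpleEvenRoot

end LieSuperalgebra

namespace LieSuperalgebra

open IsAddIndecomposable

variable {g : Type*} [AddCommGroup g] [Module ℂ g] {L : LieSuperalgebra g}

/-! ### Numerators and component factors in terms of the even root pairing -/

section WeylGroup

variable [FiniteDimensional ℂ g] {H : LieSubalgebra ℂ L.Even} [H.IsCartanSubalgebra]
variable {B : LinearMap.BilinForm ℂ g} (hL : L.IsBasicClassical) (hB : L.IsInvariantForm B)

lemma evenSimpleRoots_subset_evenBase (P : Set (Dual ℂ H)) :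
    L.evenSimpleRoots H P ⊆ L.evenBase H P := fun _ hα =>
  ⟨⟨hα.1.1, hα.2⟩, fun ⟨β, hβ, γ, hγ, h⟩ => hα.1.2 ⟨β, hβ.1, γ, hγ.1, h⟩⟩

lemma evenBase_subset_evenRoots (P : Set (Dual ℂ H)) : L.evenBase H P ⊆ L.evenRoots H :=
  fun _ hα => hα.1.2

lemma mem_evenBase_iff {f : Dual ℂ H →ₗ[ℝ] ℝ} (α : L.evenRoots H) :
    (α : Dual ℂ H) ∈ L.evenBase H (L.positiveRoots H f) ↔
      α ∈ baseOf (evenRootPairing hL hB).root (f : Dual ℂ H →+ ℝ) := by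
  have hpos : ∀ {β : Dual ℂ H}, β ∈ L.positiveRoots H f ∩ L.evenRoots H ↔
      β ∈ L.evenRoots H ∧ 0 < f β := fun {β} =>
    ⟨fun h => ⟨h.2, h.1.2⟩, fun h => ⟨⟨mem_roots_iff.mpr (Or.inl h.1), h.2⟩, h.1⟩⟩
  constructor
  · rintro ⟨h1, h2⟩
    refine ⟨(hpos.mp h1).2, fun β hβ γ hγ h => absurd ?_ h2⟩
    exact ⟨β, hpos.mpr ⟨β.2, hβ⟩, γ, hpos.mpr ⟨γ.2, hγ⟩, h⟩
  · rintro ⟨h1, h2⟩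
    refine ⟨hpos.mpr ⟨α.2, h1⟩, fun ⟨β, hβ, γ, hγ, h⟩ => ?_⟩
    rw [hpos] at hβ hγ
    exact (h2 ⟨β, hβ.1⟩ hβ.2 ⟨γ, hγ.1⟩ hγ.2 h).elim hβ.1.1 hγ.1.1

lemma isReflection_iff (α : L.evenRoots H) (w : Dual ℂ H ≃ₗ[ℂ] Dual ℂ H) :
    L.IsReflection H B α w ↔ w = (evenRootPairing hL hB).reflection α := by
  rw [IsReflection, LinearEquiv.ext_iff]
  refine forall_congr' fun ν => ?_
  rw [evenRootPairing_reflection, apply_corootVector hB]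

lemma reflectionGroup_eq {S : Set (Dual ℂ H)} (hS : S ⊆ L.evenRoots H) :
    L.reflectionGroup H B S =
      (evenRootPairing hL hB).reflectionSubgroup (Subtype.val ⁻¹' S) := by
  rw [reflectionGroup, RootPairing.reflectionSubgroup]
  congr 1
  ext w
  constructor
  · rintro ⟨α, hα, hw⟩
    exact ⟨⟨α, hS hα⟩, hα, ((isReflection_iff hL hB ⟨α, hS hα⟩ w).mp hw).symm⟩
  · rintro ⟨α, hα, rfl⟩
    exact ⟨α, hα, (isReflection_iff hL hB α _).mpr rfl⟩

lemma weylGroup_eq : L.weylGroup H B = (evenRootPairing hL hB).reflectionSubgroup Set.univ := by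
  rw [weylGroup, reflectionGroup_eq hL hB subset_rfl]
  congr 1
  ext α
  simp

include hL hB in
lemma det_list_prod {P : Set (Dual ℂ H)} {l : List (Dual ℂ H ≃ₗ[ℂ] Dual ℂ H)}
    (hl : ∀ s ∈ l, ∃ α ∈ L.evenBase H P, L.IsReflection H B α s) :
    LinearMap.det (l.prod : Dual ℂ H →ₗ[ℂ] Dual ℂ H) = (-1) ^ l.length := by
  induction l with
  | nil => exact LinearMap.det_id
  | cons s l ih =>
    obtain ⟨α, hα, hs⟩ := hl s List.mem_cons_self
    have hs' := (isReflection_iff hL hB ⟨α, hα.1.2⟩ s).mp hs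
    rw [List.prod_cons, List.length_cons, pow_succ', ← ih fun s hs => hl s (List.mem_cons_of_mem _ hs)]
    have := (evenRootPairing hL hB).det_reflection ⟨α, hα.1.2⟩
    rw [← hs'] at this
    rw [← this]
    exact LinearMap.det_comp _ _

include hL hB in
/-- The sign of an element of the Weyl group is its determinant. -/
lemma neg_one_pow_length {f : Dual ℂ H →ₗ[ℝ] ℝ} (hf : ∀ γ ∈ L.roots H, f γ ≠ 0)
    {w : Dual ℂ H ≃ₗ[ℂ] Dual ℂ H} (hw : w ∈ L.weylGroup H B) :
    (-1 : ℂ) ^ L.length H (L.positiveRoots H f) B w =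
      LinearMap.det (w : Dual ℂ H →ₗ[ℂ] Dual ℂ H) := by
  -- The infimum of an empty set of naturals would be 0, so some word in simple reflections has to
  -- be exhibited.
  have hne : {k | ∃ l : List (Dual ℂ H ≃ₗ[ℂ] Dual ℂ H), l.length = k ∧
      (∀ s ∈ l, ∃ α ∈ L.evenBase H (L.positiveRoots H f), L.IsReflection H B α s) ∧
        l.prod = w}.Nonempty := by
    rw [weylGroup_eq hL hB, (evenRootPairing hL hB).reflectionSubgroup_univ
      (f := (f : Dual ℂ H →+ ℝ)) fun i => hf _ (mem_roots_iff.mpr (Or.inl i.2))] at hw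
    obtain ⟨l, hl, rfl⟩ := (evenRootPairing hL hB).exists_list_of_mem hw
    refine ⟨_, _, rfl, fun s hs => ?_, rfl⟩
    obtain ⟨i, hi, rfl⟩ := List.mem_map.mp hs
    exact ⟨i, (mem_evenBase_iff hL hB i).mpr (hl i hi), (isReflection_iff hL hB i _).mpr rfl⟩
  obtain ⟨l, h1, h2, h3⟩ := Nat.sInf_mem hne
  rw [length, ← h1, ← det_list_prod hL hB h2, h3]

include hL hB in
lemma alternatingSum_eq {f : Dual ℂ H →ₗ[ℝ] ℝ} (hf : ∀ γ ∈ L.roots H, f γ ≠ 0)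
    {G : Subgroup (Dual ℂ H ≃ₗ[ℂ] Dual ℂ H)} (hG : G ≤ L.weylGroup H B) (wt : Dual ℂ H) :
    L.alternatingSum H (L.positiveRoots H f) B G wt = ∑ᶠ w ∈ G, AddMonoidAlgebra.single
      (w (wt + L.weylVector H (L.positiveRoots H f)) -
        (wt + L.weylVector H (L.positiveRoots H f)))
      (LinearMap.det (w : Dual ℂ H →ₗ[ℂ] Dual ℂ H)) :=
  finsum_mem_congr rfl fun w hw => by rw [neg_one_pow_length hL hB hf (hG hw)]

lemma numerator_eq {f : Dual ℂ H →ₗ[ℝ] ℝ} (hf : ∀ γ ∈ L.roots H, f γ ≠ 0) (wt : Dual ℂ H) :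
    L.numerator H (L.positiveRoots H f) B wt =
      (evenRootPairing hL hB).alternant (wt + L.weylVector H (L.positiveRoots H f)) := by
  rw [numerator, alternatingSum_eq hL hB hf le_rfl, RootPairing.alternant, weylGroup_eq hL hB]

/-- The reflections of the component fix the difference of the two shifted weights, so each exponent
$w\Lambda-\Lambda$ is the same for both. -/
lemma componentFactor_congr {f : Dual ℂ H →ₗ[ℝ] ℝ} (hf : ∀ γ ∈ L.roots H, f γ ≠ 0)
    {S : Set (Dual ℂ H)} (hS : S ⊆ L.evenRoots H) (C : (L.rootGraph H B S).ConnectedComponent)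
    {wt wt' : Dual ℂ H} (h : ∀ i ∈ (Subtype.val ⁻¹' (Subtype.val '' C.supp) : Set (L.evenRoots H)),
      (evenRootPairing hL hB).coroot' i (wt + L.weylVector H (L.positiveRoots H f)) =
        (evenRootPairing hL hB).coroot' i (wt' + L.weylVector H (L.positiveRoots H f))) :
    L.componentFactor H (L.positiveRoots H f) B S C wt =
      L.componentFactor H (L.positiveRoots H f) B S C wt' := by
  have hC : Subtype.val '' C.supp ⊆ L.evenRoots H := by
    rintro - ⟨α, -, rfl⟩
    exact hS α.2
  have hG : L.reflectionGroup H B (Subtype.val '' C.supp) ≤ L.weylGroup H B := by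
    rw [weylGroup_eq hL hB, reflectionGroup_eq hL hB hC]
    exact RootPairing.reflectionSubgroup_mono _ (Set.subset_univ _)
  rw [componentFactor, componentFactor, alternatingSum_eq hL hB hf hG, alternatingSum_eq hL hB hf hG]
  refine finsum_mem_congr rfl fun w hw => ?_
  have hw' : w ∈ L.reflectionGroup H B (Subtype.val '' C.supp) := hw
  rw [reflectionGroup_eq hL hB hC] at hw'
  congr 1
  set Λ := wt + L.weylVector H (L.positiveRoots H f)
  set Λ' := wt' + L.weylVector H (L.positiveRoots H f)
  have := (evenRootPairing hL hB).apply_eq_self_of_mem hw' (x := Λ - Λ')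
    fun i hi => by rw [map_sub, h i hi, sub_self]
  rw [map_sub] at this
  rw [sub_eq_sub_iff_sub_eq_sub]
  exact this

lemma preconnected_of_component {S : Set (Dual ℂ H)} (hS : S ⊆ L.evenRoots H)
    (C : (L.rootGraph H B S).ConnectedComponent) :
    ((evenRootPairing hL hB).nonorthogonalGraph
      (Subtype.val ⁻¹' (Subtype.val '' C.supp) : Set (L.evenRoots H))).Preconnected := by
  have hpair : ∀ α β : L.evenRoots H, L.pairing H B α β ≠ 0 →
      (evenRootPairing hL hB).pairing α β ≠ 0 := fun α β h => by
    rw [evenRootPairing_pairing, apply_corootVector hB]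
    exact div_ne_zero (mul_ne_zero two_ne_zero h) (pairing_self_ne_zero hL hB β.2)
  let φ : C.toSimpleGraph →g (evenRootPairing hL hB).nonorthogonalGraph
      (Subtype.val ⁻¹' (Subtype.val '' C.supp) : Set (L.evenRoots H)) :=
    { toFun := fun x => ⟨⟨x.1.1, hS x.1.2⟩, x.1, x.2, rfl⟩
      map_rel' := fun {x y} hxy => by
        have h : (L.rootGraph H B S).Adj x.1 y.1 := hxy
        have h := (SimpleGraph.fromRel_adj _ _ _).mp h
        rw [RootPairing.nonorthogonalGraph, SimpleGraph.fromRel_adj]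
        refine ⟨fun he => h.1 (Subtype.ext ?_), h.2.imp (hpair _ _) (hpair _ _)⟩
        exact congrArg (fun z => z.1.1) he }
  refine C.connected_toSimpleGraph.preconnected.map φ ?_
  rintro ⟨α, β, hβ, h⟩
  exact ⟨⟨β, hβ⟩, Subtype.ext (Subtype.ext h)⟩

include hL hB in
lemma isHalfRegular_of_isTypical {f : Dual ℂ H →ₗ[ℝ] ℝ} (hf : ∀ γ ∈ L.roots H, f γ ≠ 0)
    {wt : Dual ℂ H} (htyp : L.IsTypical H (L.positiveRoots H f) B wt)
    (hdom : L.IsDominantIntegral H (L.positiveRoots H f) wt) :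
    (evenRootPairing hL hB).IsHalfRegular
      (baseOf (evenRootPairing hL hB).root (f : Dual ℂ H →+ ℝ))
      (wt + L.weylVector H (L.positiveRoots H f)) := by
  obtain ⟨V, _, _, _, M, -, v, hv0, hv, hvP⟩ := hdom
  refine SuperModule.IsHighestWeight.isHalfRegular hL hB hf (M := M) ⟨hv0, hv, hvP⟩
    fun β hβ h0 => ?_
  have hr := mem_roots_iff.mpr (Or.inr hβ)
  rcases lt_or_gt_of_ne (hf β hr) with h | h
  · have hn := neg_mem_oddRoots hL hB hβ
    have e : -β = (-1 : ℂ) • β := by rw [neg_one_smul]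
    have := htyp (-β) ⟨⟨mem_roots_iff.mpr (Or.inr hn), by rw [map_neg]; linarith⟩, hn⟩
      (by rw [e, pairing_smul_left hB, pairing_smul_right hB, h0]; simp)
    rw [e, pairing_smul_right hB] at this
    exact right_ne_zero_of_mul this
  · exact htyp β ⟨⟨hr, h⟩, hβ⟩ h0

end WeylGroup

/-! ### Matching the factors -/

section Factorization

variable [FiniteDimensional ℂ g] {H : LieSubalgebra ℂ L.Even} [H.IsCartanSubalgebra]
variable {B : LinearMap.BilinForm ℂ g} (hL : L.IsBasicClassical) (hB : L.IsInvariantForm B)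
variable {f : Dual ℂ H →ₗ[ℝ] ℝ} (hf : ∀ γ ∈ L.roots H, f γ ≠ 0) {r s : ℕ}
  {lam : Fin r → Dual ℂ H} {mu : Fin s → Dual ℂ H}
  (hlam : ∀ p, L.IsTypical H (L.positiveRoots H f) B (lam p) ∧
    L.IsDominantIntegral H (L.positiveRoots H f) (lam p))
  (hmu : ∀ q, L.IsTypical H (L.positiveRoots H f) B (mu q) ∧
    L.IsDominantIntegral H (L.positiveRoots H f) (mu q))
  (hU : ∏ p, L.numerator H (L.positiveRoots H f) B (lam p) =
    ∏ q, L.numerator H (L.positiveRoots H f) B (mu q))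

include hf hlam hmu hU

lemma exists_equiv_of_connected {C : Set (L.evenRoots H)}
    (hC : C ⊆ baseOf (evenRootPairing hL hB).root (f : Dual ℂ H →+ ℝ)) (hne : C.Nonempty)
    (hconn : ((evenRootPairing hL hB).nonorthogonalGraph C).Preconnected) :
    ∃ e : Fin r ≃ Fin s, ∀ p, ∀ i ∈ C,
      (evenRootPairing hL hB).coroot' i (lam p + L.weylVector H (L.positiveRoots H f)) =
        (evenRootPairing hL hB).coroot' i (mu (e p) + L.weylVector H (L.positiveRoots H f)) := by
  have hf' : ∀ i, (f : Dual ℂ H →+ ℝ) ((evenRootPairing hL hB).root i) ≠ 0 :=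
    fun i => hf _ (mem_roots_iff.mpr (Or.inl i.2))
  have : (evenRootPairing (H := H) hL hB).IsValuedIn ℝ :=
    RootPairing.IsValuedIn.trans (evenRootPairing hL hB) ℝ ℤ
  have hb := (evenRootPairing hL hB).linearIndepOn_root_baseOf' (S := ℝ) f hf'
  have := hne.to_subtype
  refine RootPairing.exists_equiv_of_prod_alternant_eq hf' hb hC hconn _ _
    (fun p => isHalfRegular_of_isTypical hL hB hf (hlam p).1 (hlam p).2)
    (fun q => isHalfRegular_of_isTypical hL hB hf (hmu q).1 (hmu q).2) ?_
  simpa only [numerator_eq hL hB hf] using hU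

include hL hB

/-- A single simple even root is already a connected set, and one exists because there are even
roots. -/
lemma card_eq_of_prod_numerator_eq : r = s := by
  have hf' : ∀ i, (f : Dual ℂ H →+ ℝ) ((evenRootPairing hL hB).root i) ≠ 0 :=
    fun i => hf _ (mem_roots_iff.mpr (Or.inl i.2))
  obtain ⟨β, hβ, hβ0⟩ : ∃ β ∈ L.evenRoots H, 0 < f β := by
    obtain ⟨β, hβ⟩ := evenRoots_nonempty (H := H) hL hB
    rcases lt_or_gt_of_ne (hf β (mem_roots_iff.mpr (Or.inl hβ))) with h | h
    · exact ⟨-β, neg_mem_evenRoots hL hB hβ, by rw [map_neg]; linarith⟩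
    · exact ⟨β, hβ, h⟩
  obtain ⟨i, hi, -⟩ := (evenRootPairing hL hB).exists_mem_baseOf_pairing_pos hf' (j := ⟨β, hβ⟩) hβ0
  obtain ⟨e, -⟩ := exists_equiv_of_connected hL hB hf hlam hmu hU
    (Set.singleton_subset_iff.mpr hi) (Set.singleton_nonempty i)
    (SimpleGraph.Preconnected.of_subsingleton)
  simpa using Fintype.card_congr e

/-- Each component `C` has its own bijection of the weights, and `σ` combines them without moving
the component. -/
lemma exists_equiv_componentFactor_eq {S : Set (Dual ℂ H)}
    (hS : S ⊆ L.evenBase H (L.positiveRoots H f)) :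
    ∃ σ : (L.rootGraph H B S).ConnectedComponent × Fin r ≃
        (L.rootGraph H B S).ConnectedComponent × Fin s,
      ∀ x, L.componentFactor H (L.positiveRoots H f) B S x.1 (lam x.2) =
        L.componentFactor H (L.positiveRoots H f) B S (σ x).1 (mu (σ x).2) := by
  have hS' : S ⊆ L.evenRoots H := hS.trans (evenBase_subset_evenRoots _)
  choose e he using fun C : (L.rootGraph H B S).ConnectedComponent =>
    exists_equiv_of_connected hL hB hf hlam hmu hU
      (C := Subtype.val ⁻¹' (Subtype.val '' C.supp))
      (fun α ⟨β, _, h⟩ => (mem_evenBase_iff hL hB α).mp (h ▸ hS β.2))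
      (by
        obtain ⟨β, hβ⟩ := C.nonempty_supp
        exact ⟨⟨β.1, hS' β.2⟩, β, hβ, rfl⟩)
      (preconnected_of_component hL hB hS' C)
  exact ⟨Equiv.prodCongrRight e, fun x => componentFactor_congr hL hB hf hS' x.1 (he x.1 x.2)⟩

end Factorization

end LieSuperalgebra

theorem mainTheorem4 {g : Type*} [AddCommGroup g] [Module ℂ g] [FiniteDimensional ℂ g]
    (L : LieSuperalgebra g) (hL : L.IsBasicClassical)
    (B : LinearMap.BilinForm ℂ g) (hB : L.IsInvariantForm B)
    (H : LieSubalgebra ℂ L.Even) (hH : H.IsCartanSubalgebra)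
    (P : Set (Module.Dual ℂ H)) (hP : L.IsPositiveSystem H P)
    (r s : ℕ) (lam : Fin r → Module.Dual ℂ H) (mu : Fin s → Module.Dual ℂ H)
    (hlam : ∀ p, L.IsTypical H P B (lam p) ∧ L.IsDominantIntegral H P (lam p))
    (hmu : ∀ q, L.IsTypical H P B (mu q) ∧ L.IsDominantIntegral H P (mu q))
    (hU : ∏ p, L.numerator H P B (lam p) = ∏ q, L.numerator H P B (mu q)) :
    r = s ∧
    (∃ σ : (L.rootGraph H B (L.evenBase H P)).ConnectedComponent × Fin r ≃
        (L.rootGraph H B (L.evenBase H P)).ConnectedComponent × Fin s,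
      ∀ x, L.componentFactor H P B (L.evenBase H P) x.1 (lam x.2) =
        L.componentFactor H P B (L.evenBase H P) (σ x).1 (mu (σ x).2)) ∧
    (∃ σ : (L.rootGraph H B (L.evenSimpleRoots H P)).ConnectedComponent × Fin r ≃
        (L.rootGraph H B (L.evenSimpleRoots H P)).ConnectedComponent × Fin s,
      ∀ x, L.componentFactor H P B (L.evenSimpleRoots H P) x.1 (lam x.2) =
        L.componentFactor H P B (L.evenSimpleRoots H P) (σ x).1 (mu (σ x).2)) := by
  have := hH
  obtain ⟨f, hf, rfl⟩ := hP.exists_functional hL hB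
  exact ⟨LieSuperalgebra.card_eq_of_prod_numerator_eq hL hB hf hlam hmu hU,
    LieSuperalgebra.exists_equiv_componentFactor_eq hL hB hf hlam hmu hU subset_rfl,
    LieSuperalgebra.exists_equiv_componentFactor_eq hL hB hf hlam hmu hU
      (LieSuperalgebra.evenSimpleRoots_subset_evenBase _)⟩
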